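/- Let $b,s\in\mathbb R$ with $b\neq0$ and $27s-38b^2>0$. For $\varepsilon>0$ and $\omega\in[-\frac12,\frac12]$ consider on $\mathbb R^2\ni(x,y)$ the generalized Swift–Hohenberg equation $$\partial_t u=-(1+(1+2\varepsilon\omega)\partial_x^2+\partial_y^2)^2u+\varepsilon^2u+bu^2-su^3 .\tag{1}$$ A family of rolls on $(0,\varepsilon_0]$ is a family of functions $\tilde u_{\varepsilon,\omega}(x)$, $0<\varepsilon\le\varepsilon_0$, $|\omega|\le\frac12$, each of which is an even, $2\pi$-periodic, $C^4$ stationary solution of (1) depending on $x$ only, which vanishes identically exactly when $\omega=\pm\frac12$, and such that, with $D=27s-38b^2$, $$\tilde u_{\varepsilon,\omega}(x)=\varepsilon\frac{6\sqrt{1-4\omega^2}}{\sqrt D}\cos x+\varepsilon^2\Big[\frac{18b(1-4\omega^2)}{D}-\frac{32b^2\omega\sqrt{1-4\omega^2}}{D\sqrt D}\cos x+\frac{2b(1-4\omega^2)}{D}\cos2x\Big]+O(\varepsilon^3)$$ uniformly in $x$ and $\omega$. **Theorem (nonlinear instability).** A family of rolls exists on $(0,\varepsilon_0]$ for some $\varepsilon_0>0$.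 For every family of rolls on an interval $(0,\varepsilon_0]$ there is $\bar\varepsilon_0\in(0,\varepsilon_0]$ such that for all $0<\varepsilon<\bar\varepsilon_0$ and all $\omega\in(-\frac12,\frac12)$ the following holds. There are $\theta>0$ and times $T^\delta>0$ $(\delta>0)$, with $C^{-1}|\ln\delta|\le T^\delta\le C|\ln\delta|$ for some constant $C\geq 1$ and all sufficiently small $\delta>0$, such that for every $\delta>0$ there is a solution $V_\delta$ of (1) on $[0,T^\delta]$ with $$\|V_\delta(0)-\tilde u_{\varepsilon,\omega}\|_{H^4(\mathbb R^2)}\le\delta\qquad\text{and}\qquad\|V_\delta(T^\delta)-\tilde u_{\varepsilon,\omega}\|_{L^2(\mathbb R^2)}\ge\theta .$$ Here a solution on $[0,T]$ is a real function $V$ such that $V-\tilde u_{\varepsilon,\omega}\in C([0,T];H^2(\mathbb R^2))$ and (1) holds in the sense of distributions on $\mathbb R^2$ at every time $t\in[0,T]$ (one-sided time derivatives at the end points). -/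

import Mathlib

open MeasureTheory Filter Topology Set Asymptotics
open scoped ENNReal FourierTransform

noncomputable section

namespace GSH

/-- The plane `ℝ²`, with coordinates `p 0 = x` and `p 1 = y`. -/
abbrev Plane : Type := EuclideanSpace ℝ (Fin 2)

/-- The classical partial derivative of `f : ℝ² → ℝ` in the `i`-th coordinate direction. -/
def partialDeriv (i : Fin 2) (f : Plane → ℝ) : Plane → ℝ :=
  fun p => fderiv ℝ f p (EuclideanSpace.single i 1)

/-- The operator `1 + (1 + 2εω) ∂ₓ² + ∂ᵧ²`. -/
def opA (ε ω : ℝ) (f : Plane → ℝ) : Plane → ℝ :=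
  fun p => f p + (1 + 2 * ε * ω) * partialDeriv 0 (partialDeriv 0 f) p
    + partialDeriv 1 (partialDeriv 1 f) p

/-- The zeroth order part `ε² u + b u² - s u³` of the equation. -/
def reaction (b s ε u : ℝ) : ℝ := ε ^ 2 * u + b * u ^ 2 - s * u ^ 3

/-- A function of `x` alone, regarded as a function of `(x, y)`. -/
def extend (u : ℝ → ℝ) : Plane → ℝ := fun p => u (p 0)

/-- `u` is an even, `2π`-periodic function of `x` alone which is a (classical) stationary solution
of `∂ₜ u = -(1 + (1 + 2εω) ∂ₓ² + ∂ᵧ²)² u + ε² u + b u² - s u³`. -/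
structure IsEvenStationary (b s ε ω : ℝ) (u : ℝ → ℝ) : Prop where
  contDiff : ContDiff ℝ 4 u
  even : ∀ x, u (-x) = u x
  periodic : ∀ x, u (x + 2 * Real.pi) = u x
  stationary : ∀ p : Plane,
    -(opA ε ω (opA ε ω (extend u)) p) + reaction b s ε (extend u p) = 0

/-- The expansion of the rolls up to and including the order `ε²`. -/
def rollExpansion (b s ε ω x : ℝ) : ℝ :=
  ε * (6 * √(1 - 4 * ω ^ 2) / √(27 * s - 38 * b ^ 2)) * Real.cos x
    + ε ^ 2 * (18 * b * (1 - 4 * ω ^ 2) / (27 * s - 38 * b ^ 2)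
        - 32 * b ^ 2 * ω * √(1 - 4 * ω ^ 2)
            / ((27 * s - 38 * b ^ 2) * √(27 * s - 38 * b ^ 2)) * Real.cos x
        + 2 * b * (1 - 4 * ω ^ 2) / (27 * s - 38 * b ^ 2) * Real.cos (2 * x))

/-- `u ε ω` (for `0 < ε ≤ ε₀`, `|ω| ≤ 1/2`) is the family of roll solutions bifurcating from `0`:
even `2π`-periodic stationary solutions with the leading order expansion above, the remainder being
`O(ε³)` uniformly in `x` and `ω`, and trivial exactly at the end points `ω = ±1/2`. -/
structure IsRollFamily (b s ε₀ : ℝ) (u : ℝ → ℝ → ℝ → ℝ) : Prop where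
  pos : 0 < ε₀
  solution : ∀ ε ∈ Ioc 0 ε₀, ∀ ω ∈ Icc (-(1 / 2) : ℝ) (1 / 2), IsEvenStationary b s ε ω (u ε ω)
  trivial_iff : ∀ ε ∈ Ioc 0 ε₀, ∀ ω ∈ Icc (-(1 / 2) : ℝ) (1 / 2),
    ((∀ x, u ε ω x = 0) ↔ |ω| = 1 / 2)
  expansion : ∃ C : ℝ, ∀ ε ∈ Ioc 0 ε₀, ∀ ω ∈ Icc (-(1 / 2) : ℝ) (1 / 2), ∀ x,
    |u ε ω x - rollExpansion b s ε ω x| ≤ C * ε ^ 3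

/-- The norm of `H^k(ℝ²)`: it is
`(∫ (1 + |2πξ|²)^k |f̂(ξ)|² dξ)^{1/2}` with the `L²` Fourier transform `f̂` (normalized with the
kernel `exp (-2πi ξ·x)`) if `f` is an `L²` function, and `∞` otherwise. The infimum is over the
class of `f` in `L²(ℝ²; ℂ)`, which is unique if it exists. -/
def sobolevENorm (k : ℕ) (f : Plane → ℝ) : ℝ≥0∞ :=
  ⨅ (F : Lp ℂ 2 (volume : Measure Plane)) (_ : F =ᵐ[volume] fun p => (f p : ℂ)),
    (∫⁻ ξ : Plane, ENNReal.ofReal ((1 + (2 * Real.pi * ‖ξ‖) ^ 2) ^ k) *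
      ‖(𝓕 F : Lp ℂ 2 (volume : Measure Plane)) ξ‖ₑ ^ 2) ^ (1 / 2 : ℝ)

/-- `V` is an `H²` solution on `[0, T]` of
`∂ₜ V = -(1 + (1 + 2εω) ∂ₓ² + ∂ᵧ²)² V + ε² V + b V² - s V³` around the state `U`: `V - U` is
continuous on `[0, T]` with values in `H²(ℝ²)`, and the equation holds at all times in the sense of
distributions on `ℝ²`. -/
structure IsSolution (b s ε ω : ℝ) (U : Plane → ℝ) (T : ℝ) (V : ℝ → Plane → ℝ) : Prop where
  mem : ∀ t ∈ Icc 0 T, sobolevENorm 2 (V t - U) < ∞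
  continuous : ∀ t₀ ∈ Icc 0 T,
    Tendsto (fun t => sobolevENorm 2 (V t - V t₀)) (𝓝[Icc 0 T] t₀) (𝓝 0)
  equation : ∀ φ : Plane → ℝ, ContDiff ℝ (⊤ : ℕ∞) φ → HasCompactSupport φ → ∀ t ∈ Icc 0 T,
    HasDerivWithinAt (fun τ => ∫ p, V τ p * φ p)
      (∫ p, (-(V t p * opA ε ω (opA ε ω φ) p) + reaction b s ε (V t p) * φ p)) (Icc 0 T) t

end GSH

end

noncomputable section

/-- A globally Lipschitz autonomous vector field has integral curves on every interval `[0, T]`. -/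
theorem LipschitzWith.exists_hasDerivWithinAt_Icc {E : Type*} [NormedAddCommGroup E]
    [NormedSpace ℝ E] [CompleteSpace E] {X : E → E} {L : NNReal} (hX : LipschitzWith L X)
    (x : E) (T : ℝ) :
    ∃ α : ℝ → E, α 0 = x ∧
      ∀ t ∈ Icc 0 T, HasDerivWithinAt α (X (α t)) (Icc 0 T) t := by
  set τ : ℝ := 1 / (2 * (L + 1)) with hτ
  have hτ0 : 0 < τ := by positivity
  have step : ∀ y : E, ∃ β : ℝ → E, β 0 = y ∧
      ∀ t ∈ Icc 0 τ, HasDerivWithinAt β (X (β t)) (Icc 0 τ) t := by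
    intro y
    set a : NNReal := ‖X y‖₊ + 1 with ha
    have hpl : IsPicardLindelof (fun _ : ℝ => X) (tmin := 0) (tmax := τ) ⟨0, le_rfl, hτ0.le⟩ y a 0
        (‖X y‖₊ + L * a) L := by
      refine ⟨fun t _ => hX.lipschitzOnWith, fun _ _ => continuousOn_const, fun t _ z hz => ?_, ?_⟩
      · have h1 : ‖X z - X y‖ ≤ L * ‖z - y‖ := hX.norm_sub_le z y
        have h2 : ‖z - y‖ ≤ a := by simpa [dist_eq_norm] using hz
        have h3 : ‖X z‖ ≤ ‖X z - X y‖ + ‖X y‖ := by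
          simpa using norm_add_le (X z - X y) (X y)
        have h4 : (L : ℝ) * ‖z - y‖ ≤ L * a := by gcongr
        push_cast
        change ‖X z‖ ≤ ‖X y‖ + L * a
        linarith
      · have hL : (0 : ℝ) ≤ L := L.2
        simp only [sub_zero, sub_self, NNReal.coe_zero]
        rw [max_eq_left hτ0.le, hτ, mul_one_div, div_le_iff₀ (by positivity)]
        push_cast [ha]
        have := norm_nonneg (X y)
        nlinarith
    simpa using hpl.exists_eq_forall_mem_Icc_hasDerivWithinAt₀
  have key : ∀ k : ℕ, ∃ α : ℝ → E, α 0 = x ∧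
      ∀ t ∈ Icc 0 (k * τ), HasDerivWithinAt α (X (α t)) (Icc 0 (k * τ)) t := by
    intro k
    induction k with
    | zero =>
      refine ⟨fun _ => x, rfl, fun t ht => ?_⟩
      have : Icc (0 : ℝ) ((0 : ℕ) * τ) = {0} := by simp
      rw [this] at ht ⊢
      rw [mem_singleton_iff.1 ht]
      exact HasFDerivWithinAt.of_subsingleton subsingleton_singleton
    | succ k ih =>
      obtain ⟨α, hα0, hα⟩ := ih
      obtain ⟨β, hβ0, hβ⟩ := step (α (k * τ))
      set c : ℝ := k * τ with hc
      have hc0 : 0 ≤ c := by positivity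
      have hsucc : ((k + 1 : ℕ) : ℝ) * τ = c + τ := by push_cast; ring
      have hU : Icc 0 (c + τ) = Icc 0 c ∪ Icc c (c + τ) :=
        (Icc_union_Icc_eq_Icc hc0 (by linarith)).symm
      set γ : ℝ → E := fun t => if t ≤ c then α t else β (t - c) with hγ
      have hγ1 : ∀ t ≤ c, γ t = α t := fun t ht => if_pos ht
      have hγ2 : ∀ t, c ≤ t → γ t = β (t - c) := by
        intro t ht
        rcases ht.eq_or_lt with rfl | ht
        · rw [hγ1 _ le_rfl, sub_self, hβ0]
        · exact if_neg ht.not_ge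
      have d1 : ∀ t ∈ Icc 0 c, HasDerivWithinAt γ (X (γ t)) (Icc 0 c) t := by
        intro t ht
        rw [hγ1 t ht.2]
        exact (hα t ht).congr_of_mem (fun x hx => hγ1 x hx.2) ht
      have d2 : ∀ t ∈ Icc c (c + τ), HasDerivWithinAt γ (X (γ t)) (Icc c (c + τ)) t := by
        intro t ht
        rw [hγ2 t ht.1]
        have ht' : t - c ∈ Icc 0 τ := ⟨by linarith [ht.1], by linarith [ht.2]⟩
        have h := HasDerivWithinAt.scomp (h := fun x => x - c) (t' := Icc 0 τ) t (hβ (t - c) ht')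
          (((hasDerivAt_id t).sub_const c).hasDerivWithinAt (s := Icc c (c + τ)))
          (fun x hx => ⟨by simpa using hx.1, by simpa [add_comm] using hx.2⟩)
        rw [one_smul] at h
        exact h.congr_of_mem (fun x hx => hγ2 x hx.1) ht
      refine ⟨γ, by rw [hγ1 0 hc0, hα0], fun t ht => ?_⟩
      rw [hsucc] at ht ⊢
      rw [hU]
      refine HasDerivWithinAt.union ?_ ?_
      · by_cases htc : t ≤ c
        · exact d1 t ⟨ht.1, htc⟩
        · refine HasFDerivWithinAt.of_notMem_closure ?_
          rw [isClosed_Icc.closure_eq]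
          exact fun h => htc h.2
      · by_cases htc : c ≤ t
        · exact d2 t ⟨htc, ht.2⟩
        · refine HasFDerivWithinAt.of_notMem_closure ?_
          rw [isClosed_Icc.closure_eq]
          exact fun h => htc h.1
  obtain ⟨k, hk⟩ := exists_nat_gt (T / τ)
  obtain ⟨α, hα0, hα⟩ := key k
  have hT : T ≤ k * τ := by rw [div_lt_iff₀ hτ0] at hk; exact hk.le
  exact ⟨α, hα0, fun t ht => (hα t ⟨ht.1, ht.2.trans hT⟩).mono (Icc_subset_Icc_right hT)⟩

theorem HasDerivWithinAt.Ici_of_Icc {E : Type*} [NormedAddCommGroup E] [NormedSpace ℝ E]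
    {f : ℝ → E} {f' : E} {a b t : ℝ} (h : HasDerivWithinAt f f' (Icc a b) t)
    (ht : t ∈ Ico a b) : HasDerivWithinAt f f' (Ici t) t :=
  h.mono_of_mem_nhdsWithin (Icc_mem_nhdsGE_of_mem ht)

/-- Gronwall's inequality for the square of the norm. -/
theorem norm_sq_le_of_inner_deriv_le {H : Type*} [NormedAddCommGroup H] [InnerProductSpace ℝ H]
    {w w' : ℝ → H} {T K ε : ℝ} (hK : 1 ≤ K) (hε : 0 ≤ ε)
    (hw : ∀ t ∈ Icc 0 T, HasDerivWithinAt w (w' t) (Icc 0 T) t)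
    (h : ∀ t ∈ Icc 0 T, inner ℝ (w' t) (w t) ≤ K * ‖w t‖ ^ 2 + ε) :
    ∀ t ∈ Icc 0 T, ‖w t‖ ^ 2 ≤ (‖w 0‖ ^ 2 + ε) * Real.exp (2 * K * t) := by
  intro t ht
  have hd : ∀ t ∈ Icc 0 T, HasDerivWithinAt (fun τ => ‖w τ‖ ^ 2) (2 * inner ℝ (w t) (w' t))
      (Icc 0 T) t := fun t ht => (hw t ht).norm_sq
  have := le_gronwallBound_of_liminf_deriv_right_le (f := fun τ => ‖w τ‖ ^ 2)
    (f' := fun τ => 2 * inner ℝ (w τ) (w' τ)) (δ := ‖w 0‖ ^ 2) (K := 2 * K) (ε := 2 * ε)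
    (a := 0) (b := T) (fun t ht => (hd t ht).continuousWithinAt)
    (fun x hx r hr => by
      have := ((hd x (Ico_subset_Icc_self hx)).Ici_of_Icc hx).liminf_right_slope_le hr
      simpa [slope_def_field, div_eq_inv_mul] using this) le_rfl
    (fun x hx => by
      have := h x (Ico_subset_Icc_self hx)
      rw [real_inner_comm] at this
      linarith) t ht
  refine this.trans ?_
  rw [gronwallBound_of_K_ne_0 (by positivity), sub_zero]
  have h1 : 2 * ε / (2 * K) ≤ ε := by
    rw [div_le_iff₀ (by positivity)]; nlinarith
  have h2 : 0 ≤ Real.exp (2 * K * t) - 1 := by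
    have : 0 ≤ 2 * K * t := by have := ht.1; positivity
    linarith [Real.add_one_le_exp (2 * K * t)]
  have h3 := mul_le_mul_of_nonneg_right h1 h2
  nlinarith

/-- The scalar differential inequality behind the nonlinear instability of gradient flows: the
Rayleigh quotient `-J / M` cannot decay much, so that `M` grows exponentially. -/
theorem exp_growth_of_gradient_flow {M J M' J' : ℝ → ℝ} {T C q μ : ℝ} (hC : 0 ≤ C) (hq : 0 < q)
    (hμ : 3 * C * √μ < q)
    (hM : ∀ t ∈ Icc 0 T, HasDerivWithinAt M (M' t) (Icc 0 T) t)
    (hJ : ∀ t ∈ Icc 0 T, HasDerivWithinAt J (J' t) (Icc 0 T) t)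
    (hpos : ∀ t ∈ Icc 0 T, 0 < M t) (hle : ∀ t ∈ Icc 0 T, M t ≤ μ)
    (hdiss : ∀ t ∈ Icc 0 T, 2 * M t * J' t ≤ -(M' t) ^ 2)
    (herr : ∀ t ∈ Icc 0 T, |M' t + 2 * J t| ≤ C * √(M t) * M t)
    (h0 : q * M 0 ≤ -J 0) :
    ∀ t ∈ Icc 0 T, M 0 * Real.exp (q * t) ≤ M t := by
  intro t₁ ht₁
  have hT : 0 ≤ T := ht₁.1.trans ht₁.2
  set Z : ℝ → ℝ := fun t => -J t / M t + C * √(M t) with hZ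
  set Z' : ℝ → ℝ := fun t => (-J' t * M t - -J t * M' t) / M t ^ 2 + C * (M' t / (2 * √(M t)))
    with hZ'
  have dZ : ∀ t ∈ Icc 0 T, HasDerivWithinAt Z (Z' t) (Icc 0 T) t := fun t ht =>
    ((hJ t ht).neg.div (hM t ht) (hpos t ht).ne').add
      (((hM t ht).sqrt (hpos t ht).ne').const_mul C)
  -- the rate `M' / M` is at least `2 Z - 3 C √M`
  have rate : ∀ t ∈ Icc 0 T, (2 * Z t - 3 * C * √(M t)) * M t ≤ M' t := by
    intro t ht
    have h1 := (abs_le.1 (herr t ht)).1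
    have hp := hpos t ht
    have : Z t * M t = -J t + C * √(M t) * M t := by
      simp only [hZ]; field_simp
    nlinarith
  have mono : ∀ t ∈ Icc 0 T, 0 ≤ M' t → 0 ≤ Z' t := by
    intro t ht hM'
    have hp := hpos t ht
    have hs : 0 < √(M t) := Real.sqrt_pos.2 hp
    have hsq : √(M t) ^ 2 = M t := Real.sq_sqrt hp.le
    have h1 := (abs_le.1 (herr t ht)).1
    have h2 := hdiss t ht
    have e1 : Z' t = (2 * (-J' t * M t + J t * M' t) + C * √(M t) * M t * M' t) / (2 * M t ^ 2) := by
      simp only [hZ']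
      rw [← hsq]
      have : √(√(M t) ^ 2) = √(M t) := by rw [hsq]
      rw [this]
      field_simp
      ring
    rw [e1]
    refine div_nonneg ?_ (by positivity)
    nlinarith
  have hsm : ∀ t ∈ Icc 0 T, 3 * C * √(M t) < q := fun t ht =>
    lt_of_le_of_lt (by have := Real.sqrt_le_sqrt (hle t ht); gcongr) hμ
  have key : ∀ t ∈ Icc 0 T, ∀ η ∈ Ioo 0 (q / 4), q - η ≤ Z t := by
    intro t ht η hη
    have hZ0 : q ≤ Z 0 := by
      have h00 : (0 : ℝ) ∈ Icc 0 T := ⟨le_rfl, hT⟩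
      have : q ≤ -J 0 / M 0 := by rw [le_div_iff₀ (hpos 0 h00)]; exact h0
      have : 0 ≤ C * √(M 0) := by positivity
      simp only [hZ]; linarith
    have := image_le_of_deriv_right_lt_deriv_boundary (f := fun t => -Z t) (f' := fun t => -Z' t)
      (a := 0) (b := T) (B := fun t => -q + η * ((t + 1) / (T + 1))) (B' := fun _ => η * (1 / (T + 1)))
      (fun t ht => (dZ t ht).neg.continuousWithinAt)
      (fun t ht => ((dZ t (Ico_subset_Icc_self ht)).Ici_of_Icc ht).neg)
      (by
        have : 0 ≤ η * ((0 + 1) / (T + 1)) := by have := hη.1; positivity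
        linarith)
      (fun t => by
        have := ((((hasDerivAt_id t).add_const (1 : ℝ)).div_const (T + 1)).const_mul η).const_add (-q)
        simpa using this)
      (fun t ht heq => by
        have ht' := Ico_subset_Icc_self ht
        have hη0 := hη.1
        have h1 : 0 < η * (1 / (T + 1)) := by positivity
        have h2 : η * ((t + 1) / (T + 1)) ≤ η := by
          have : (t + 1) / (T + 1) ≤ 1 := by
            rw [div_le_one (by linarith)]; linarith [ht.2]
          nlinarith
        have h3 : q - q / 4 ≤ Z t := by
          have := hη.2
          linarith
        have h4 := rate t ht'
        have h5 := hsm t ht'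
        have h6 : 0 ≤ M' t := by
          have := hpos t ht'
          have : 0 ≤ (2 * Z t - 3 * C * √(M t)) * M t := by
            apply mul_nonneg _ this.le
            linarith
          linarith
        have := mono t ht' h6
        linarith) ht
    have h2 : η * ((t + 1) / (T + 1)) ≤ η := by
      have : (t + 1) / (T + 1) ≤ 1 := by
        rw [div_le_one (by linarith)]; linarith [ht.2]
      have := hη.1
      nlinarith
    linarith
  have hZq : ∀ t ∈ Icc 0 T, q ≤ Z t := by
    intro t ht
    by_contra! hlt
    have := key t ht (min (q / 8) ((q - Z t) / 2)) ⟨by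
      apply lt_min <;> linarith, (min_le_left _ _).trans_lt (by linarith)⟩
    have h2 := min_le_right (q / 8) ((q - Z t) / 2)
    linarith
  have grow : ∀ t ∈ Icc 0 T, q * M t ≤ M' t := by
    intro t ht
    have h1 := rate t ht
    have h2 := hZq t ht
    have h3 := hsm t ht
    have h4 := hpos t ht
    have : q * M t ≤ (2 * Z t - 3 * C * √(M t)) * M t := by
      apply mul_le_mul_of_nonneg_right _ h4.le
      linarith
    linarith
  have hmono : MonotoneOn (fun t => M t * Real.exp (-(q * t))) (Icc 0 T) := by
    have hd : ∀ t ∈ Icc 0 T, HasDerivWithinAt (fun t => M t * Real.exp (-(q * t)))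
        (M' t * Real.exp (-(q * t)) + M t * (Real.exp (-(q * t)) * (-(q * 1)))) (Icc 0 T) t := by
      intro t ht
      exact (hM t ht).mul (((hasDerivAt_id t).const_mul q).neg.exp.hasDerivWithinAt)
    refine monotoneOn_of_deriv_nonneg (convex_Icc 0 T) (fun t ht => (hd t ht).continuousWithinAt)
      (fun t ht => ?_) (fun t ht => ?_)
    · rw [interior_Icc] at ht
      exact ((hd t (Ioo_subset_Icc_self ht)).hasDerivAt
        (Icc_mem_nhds ht.1 ht.2)).differentiableAt.differentiableWithinAt
    · rw [interior_Icc] at ht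
      rw [((hd t (Ioo_subset_Icc_self ht)).hasDerivAt (Icc_mem_nhds ht.1 ht.2)).deriv]
      have := grow t (Ioo_subset_Icc_self ht)
      have he := Real.exp_pos (-(q * t))
      nlinarith
  have := hmono ⟨le_rfl, hT⟩ ht₁ ht₁.1
  simp only [mul_zero, neg_zero, Real.exp_zero, mul_one] at this
  calc M 0 * Real.exp (q * t₁) ≤ (M t₁ * Real.exp (-(q * t₁))) * Real.exp (q * t₁) := by gcongr
    _ = M t₁ := by rw [mul_assoc, ← Real.exp_add]; simp

/-- Spectral truncations `P n` and the corresponding truncations `A n` of an unbounded nonnegative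
self-adjoint operator on a real Hilbert space. -/
structure SpectralScale (H : Type*) [NormedAddCommGroup H] [InnerProductSpace ℝ H] where
  P : ℕ → H →L[ℝ] H
  A : ℕ → H →L[ℝ] H
  P_inner : ∀ n u v, inner ℝ (P n u) v = inner ℝ u (P n v)
  P_P : ∀ {m n} u, m ≤ n → P m (P n u) = P m u
  P_P' : ∀ {m n} u, m ≤ n → P n (P m u) = P m u
  A_inner : ∀ n u v, inner ℝ (A n u) v = inner ℝ u (A n v)
  A_nonneg : ∀ n u, 0 ≤ inner ℝ (A n u) u
  A_mono : ∀ {m n} u, m ≤ n → inner ℝ (A m u) u ≤ inner ℝ (A n u) u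
  P_A : ∀ {m n} u, m ≤ n → P m (A n u) = A m u
  A_P : ∀ {m n} u, m ≤ n → A n (P m u) = A m u
  tail : ∃ η : ℕ → ℝ, Tendsto η atTop (𝓝 0) ∧
    ∀ m n u, m ≤ n → ‖P n u - P m u‖ ≤ η m * (‖u‖ + ‖A n u‖)

/-- `N` is globally Lipschitz, vanishes at `0`, and is one-sided Lipschitz with constant `K`. -/
structure IsOneSidedLipschitz {H : Type*} [NormedAddCommGroup H] [InnerProductSpace ℝ H]
    (N : H → H) (K : ℝ) : Prop where
  lip : ∃ L : NNReal, LipschitzWith L N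
  zero : N 0 = 0
  one_le : 1 ≤ K
  inner_le : ∀ u v, inner ℝ (N u - N v) (u - v) ≤ K * ‖u - v‖ ^ 2

namespace SpectralScale

variable {H : Type*} [NormedAddCommGroup H] [InnerProductSpace ℝ H]

/-- The Galerkin vector field. -/
def field (S : SpectralScale H) (N : H → H) (n : ℕ) (u : H) : H := -S.A n u + S.P n (N u)

/-- `v` solves the `n`-th Galerkin equation on `[0, T]`. -/
structure IsGalerkin (S : SpectralScale H) (N : H → H) (n : ℕ) (T : ℝ) (v : ℝ → H) : Prop where
  deriv : ∀ t ∈ Icc 0 T, HasDerivWithinAt v (S.field N n (v t)) (Icc 0 T) t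
  proj : ∀ t ∈ Icc 0 T, S.P n (v t) = v t

variable {S : SpectralScale H} {N : H → H} {K T : ℝ} {n : ℕ} {v w : ℝ → H}

theorem norm_P_le (S : SpectralScale H) (n : ℕ) (u : H) : ‖S.P n u‖ ≤ ‖u‖ := by
  have h : ‖S.P n u‖ ^ 2 ≤ ‖u‖ * ‖S.P n u‖ := by
    rw [← real_inner_self_eq_norm_sq, S.P_inner, S.P_P u le_rfl]
    exact real_inner_le_norm _ _
  by_contra! hlt
  have := norm_nonneg u
  nlinarith

theorem norm_A_le (S : SpectralScale H) {m n : ℕ} (h : m ≤ n) (u : H) : ‖S.A m u‖ ≤ ‖S.A n u‖ := by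
  rw [← S.P_A u h]; exact S.norm_P_le m _

theorem lipschitz_field (S : SpectralScale H) (hN : IsOneSidedLipschitz N K) (n : ℕ) :
    ∃ L : NNReal, LipschitzWith L (S.field N n) := by
  obtain ⟨L, hL⟩ := hN.lip
  exact ⟨_, (S.A n).lipschitz.neg.add ((S.P n).lipschitz.comp hL)⟩

theorem inner_field_sub_le (S : SpectralScale H) (hN : IsOneSidedLipschitz N K) {u v : H}
    (hu : S.P n u = u) (hv : S.P n v = v) :
    inner ℝ (S.field N n u - S.field N n v) (u - v) ≤ K * ‖u - v‖ ^ 2 := by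
  have h1 : S.field N n u - S.field N n v = -(S.A n (u - v)) + S.P n (N u - N v) := by
    simp only [field, map_sub]; abel
  have h2 : S.P n (u - v) = u - v := by rw [map_sub, hu, hv]
  rw [h1, inner_add_left, inner_neg_left, S.P_inner, h2]
  linarith [S.A_nonneg n (u - v), hN.inner_le u v]

theorem exists_isGalerkin [CompleteSpace H] (S : SpectralScale H) (hN : IsOneSidedLipschitz N K)
    {v₀ : H} (h₀ : S.P n v₀ = v₀) (T : ℝ) :
    ∃ v : ℝ → H, v 0 = v₀ ∧ S.IsGalerkin N n T v := by
  obtain ⟨L, hL⟩ := S.lipschitz_field hN n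
  obtain ⟨v, hv0, hv⟩ := hL.exists_hasDerivWithinAt_Icc v₀ T
  refine ⟨v, hv0, hv, fun t ht => ?_⟩
  have hd : ∀ t ∈ Icc 0 T, HasDerivWithinAt (fun τ => S.P n (v τ) - v τ) 0 (Icc 0 T) t := by
    intro t ht
    have h1 := ((S.P n).hasFDerivAt.comp_hasDerivWithinAt t (hv t ht)).sub (hv t ht)
    have h2 : S.P n (S.field N n (v t)) - S.field N n (v t) = 0 := by
      simp [field, S.P_A _ le_rfl, S.P_P _ le_rfl]
    rw [h2] at h1
    exact h1
  have := norm_sq_le_of_inner_deriv_le (w' := fun _ => 0) (K := 1) (ε := 0) le_rfl le_rfl hd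
    (fun t _ => by simp) t ht
  have h3 : ‖S.P n (v t) - v t‖ ^ 2 = 0 := by
    refine le_antisymm ?_ (sq_nonneg _)
    simpa [hv0, h₀] using this
  exact sub_eq_zero.1 (norm_eq_zero.1 (pow_eq_zero_iff two_ne_zero |>.1 h3))

namespace IsGalerkin

theorem mono (hv : S.IsGalerkin N n T v) {T' : ℝ} (h : T' ≤ T) : S.IsGalerkin N n T' v :=
  ⟨fun t ht => (hv.deriv t ⟨ht.1, ht.2.trans h⟩).mono (Icc_subset_Icc_right h),
    fun t ht => hv.proj t ⟨ht.1, ht.2.trans h⟩⟩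

theorem norm_sub_le (hN : IsOneSidedLipschitz N K) (hv : S.IsGalerkin N n T v)
    (hw : S.IsGalerkin N n T w) {t : ℝ} (ht : t ∈ Icc 0 T) :
    ‖v t - w t‖ ≤ ‖v 0 - w 0‖ * Real.exp (K * t) := by
  have := norm_sq_le_of_inner_deriv_le (ε := 0) hN.one_le le_rfl
    (fun t ht => (hv.deriv t ht).sub (hw.deriv t ht))
    (fun t ht => by simpa using S.inner_field_sub_le hN (hv.proj t ht) (hw.proj t ht)) t ht
  have h2 : Real.exp (2 * K * t) = Real.exp (K * t) ^ 2 := by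
    rw [← Real.exp_nat_mul]; congr 1; push_cast; ring
  rw [h2, add_zero, ← mul_pow] at this
  exact (pow_le_pow_iff_left₀ (norm_nonneg _) (by positivity) two_ne_zero).1 this

theorem norm_le (hN : IsOneSidedLipschitz N K) (hv : S.IsGalerkin N n T v) {t : ℝ}
    (ht : t ∈ Icc 0 T) : ‖v t‖ ≤ ‖v 0‖ * Real.exp (K * t) := by
  have h0 : S.IsGalerkin N n T (fun _ => 0) :=
    ⟨fun t _ => by simpa [field, hN.zero] using hasDerivWithinAt_const t (Icc 0 T) (0 : H),
      fun t _ => by simp⟩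
  simpa using norm_sub_le hN hv h0 ht

theorem shift (hv : S.IsGalerkin N n T v) {h : ℝ} (hh : 0 ≤ h) :
    S.IsGalerkin N n (T - h) (fun t => v (t + h)) := by
  have hm : ∀ t ∈ Icc 0 (T - h), t + h ∈ Icc 0 T := fun t ht =>
    ⟨by linarith [ht.1], by linarith [ht.2]⟩
  refine ⟨fun t ht => ?_, fun t ht => hv.proj _ (hm t ht)⟩
  have := HasDerivWithinAt.scomp (h := fun x => x + h) (t' := Icc 0 T) t (hv.deriv _ (hm t ht))
    (((hasDerivAt_id t).add_const h).hasDerivWithinAt (s := Icc 0 (T - h))) hm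
  rw [one_smul] at this
  exact this

theorem norm_field_le (hN : IsOneSidedLipschitz N K) (hv : S.IsGalerkin N n T v) {t : ℝ}
    (ht : t ∈ Ico 0 T) :
    ‖S.field N n (v t)‖ ≤ ‖S.field N n (v 0)‖ * Real.exp (K * t) := by
  have hT : 0 < T := ht.1.trans_lt ht.2
  have tend : ∀ s ∈ Ico 0 T, Tendsto (fun h => ‖h⁻¹ • (v (s + h) - v s)‖) (𝓝[>] 0)
      (𝓝 ‖S.field N n (v s)‖) := by
    intro s hs
    have h1 := (hv.deriv s (Ico_subset_Icc_self hs)).Ici_of_Icc hs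
    rw [← hasDerivWithinAt_Ioi_iff_Ici, hasDerivWithinAt_iff_tendsto_slope' self_notMem_Ioi] at h1
    have h2 : Tendsto (fun h => s + h) (𝓝[>] 0) (𝓝[>] s) := by
      refine tendsto_nhdsWithin_iff.2 ⟨?_, ?_⟩
      · have : Tendsto (fun h => s + h) (𝓝 0) (𝓝 (s + 0)) := (continuous_const.add continuous_id).tendsto _
        rw [add_zero] at this
        exact this.mono_left nhdsWithin_le_nhds
      · filter_upwards [self_mem_nhdsWithin] with h hh
        simpa using hh
    refine ((h1.comp h2).norm).congr fun h => ?_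
    simp [slope_def_module]
  refine le_of_tendsto_of_tendsto (tend t ht) ((tend 0 ⟨le_rfl, hT⟩).mul_const _) ?_
  have hpos : (0 : ℝ) < T - t := by linarith [ht.2]
  filter_upwards [Ioo_mem_nhdsGT hpos] with h hh
  have h3 := norm_sub_le hN (hv.shift hh.1.le) (hv.mono (by linarith [hh.1] : T - h ≤ T))
    (t := t) ⟨ht.1, by linarith [hh.2]⟩
  rw [norm_smul, norm_smul]
  simp only [zero_add] at h3 ⊢
  rw [mul_assoc]
  gcongr

theorem norm_field_le_of_proj (hN : IsOneSidedLipschitz N K) (hv : S.IsGalerkin N n T v) {n₀ : ℕ}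
    (hn : n₀ ≤ n) (h₀ : S.P n₀ (v 0) = v 0) {t : ℝ} (ht : t ∈ Ico 0 T) :
    ‖S.field N n (v t)‖ ≤ (‖S.A n₀ (v 0)‖ + ‖N (v 0)‖) * Real.exp (K * t) := by
  refine (hv.norm_field_le hN ht).trans ?_
  gcongr
  have h1 : S.A n (v 0) = S.A n₀ (v 0) := by rw [← h₀, S.A_P _ hn, S.A_P _ le_rfl]
  refine (norm_add_le _ _).trans ?_
  rw [norm_neg, h1]
  gcongr
  exact S.norm_P_le _ _

theorem inner_A_le (hN : IsOneSidedLipschitz N K) (hv : S.IsGalerkin N n T v) {n₀ : ℕ}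
    (hn : n₀ ≤ n) (h₀ : S.P n₀ (v 0) = v 0) {t : ℝ} (ht : t ∈ Ico 0 T) :
    inner ℝ (S.A n (v t)) (v t) ≤
      (‖S.A n₀ (v 0)‖ + ‖N (v 0)‖ + K * ‖v 0‖) * ‖v 0‖ * Real.exp (K * t) ^ 2 := by
  have ht' := Ico_subset_Icc_self ht
  have hK : 0 ≤ K := zero_le_one.trans hN.one_le
  have h1 := hv.norm_field_le_of_proj hN hn h₀ ht
  have h2 := hv.norm_le hN ht'
  have h3 : inner ℝ (S.A n (v t)) (v t) = inner ℝ (N (v t)) (v t)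
      - inner ℝ (S.field N n (v t)) (v t) := by
    rw [field, inner_add_left, inner_neg_left, S.P_inner, hv.proj t ht']; ring
  have h4 : inner ℝ (N (v t)) (v t) ≤ K * ‖v t‖ ^ 2 := by
    simpa [hN.zero] using hN.inner_le (v t) 0
  have h5 : -inner ℝ (S.field N n (v t)) (v t) ≤ ‖S.field N n (v t)‖ * ‖v t‖ :=
    (neg_le_abs _).trans (abs_real_inner_le_norm _ _)
  have h6 : ‖S.field N n (v t)‖ * ‖v t‖ ≤ ((‖S.A n₀ (v 0)‖ + ‖N (v 0)‖) * Real.exp (K * t)) *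
      (‖v 0‖ * Real.exp (K * t)) := by gcongr
  have h7 : K * ‖v t‖ ^ 2 ≤ K * (‖v 0‖ * Real.exp (K * t)) ^ 2 := by gcongr
  rw [h3]
  linarith

theorem norm_A_le (hN : IsOneSidedLipschitz N K) (hv : S.IsGalerkin N n T v) {n₀ : ℕ}
    {L : NNReal} (hL : LipschitzWith L N)
    (hn : n₀ ≤ n) (h₀ : S.P n₀ (v 0) = v 0) {t : ℝ} (ht : t ∈ Ico 0 T) :
    ‖S.A n (v t)‖ ≤ (‖S.A n₀ (v 0)‖ + ‖N (v 0)‖ + L * ‖v 0‖) * Real.exp (K * t) := by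
  have ht' := Ico_subset_Icc_self ht
  have h1 := hv.norm_field_le_of_proj hN hn h₀ ht
  have h2 := hv.norm_le hN ht'
  have h3 : S.A n (v t) = S.P n (N (v t)) - S.field N n (v t) := by simp [field]
  have h4 : ‖N (v t)‖ ≤ L * ‖v t‖ := by
    simpa [hN.zero] using hL.norm_sub_le (v t) 0
  have h5 : (L : ℝ) * ‖v t‖ ≤ L * (‖v 0‖ * Real.exp (K * t)) := by gcongr
  rw [h3]
  have h6 := S.norm_P_le n (N (v t))
  have h7 := _root_.norm_sub_le (S.P n (N (v t))) (S.field N n (v t))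
  linarith

/-- Galerkin solutions with different truncations are close. -/
theorem norm_sub_sq_le {m : ℕ} (hN : IsOneSidedLipschitz N K) (hv : S.IsGalerkin N n T v)
    (hw : S.IsGalerkin N m T w) (hmn : m ≤ n) (h0 : v 0 = w 0) {ε : ℝ} (hε : 0 ≤ ε)
    (h : ∀ t ∈ Icc 0 T, ‖N (w t)‖ * ‖S.P n (v t) - S.P m (v t)‖ ≤ ε) {t : ℝ} (ht : t ∈ Icc 0 T) :
    ‖v t - w t‖ ^ 2 ≤ ε * Real.exp (2 * K * t) := by
  have := norm_sq_le_of_inner_deriv_le hN.one_le hε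
    (fun t ht => (hv.deriv t ht).sub (hw.deriv t ht))
    (fun t ht => ?_) t ht
  · simpa [h0] using this
  have e1 := hv.proj t ht
  have e2 := hw.proj t ht
  have e3 : S.P n (w t) = w t := by rw [← e2, S.P_P' _ hmn]
  have e4 : S.P n (v t - w t) = v t - w t := by rw [map_sub, e1, e3]
  have e5 : S.A m (w t) = S.A n (w t) := by
    conv_rhs => rw [← e2, S.A_P _ hmn]
  have e6 : S.field N n (v t) - S.field N m (w t) = -(S.A n (v t - w t)) +
      S.P n (N (v t) - N (w t)) + (S.P n (N (w t)) - S.P m (N (w t))) := by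
    simp only [field, map_sub, e5]; abel
  have e7 : inner ℝ (S.P n (N (w t)) - S.P m (N (w t))) (v t - w t) =
      inner ℝ (N (w t)) (S.P n (v t) - S.P m (v t)) := by
    rw [inner_sub_left, S.P_inner, S.P_inner, ← inner_sub_right]
    congr 1
    rw [e4, map_sub, e1, e2]; abel
  have e8 := (real_inner_le_norm (N (w t)) (S.P n (v t) - S.P m (v t))).trans (h t ht)
  have e9 := hN.inner_le (v t) (w t)
  have e10 := S.A_nonneg n (v t - w t)
  simp only [Pi.sub_apply]
  rw [e6, inner_add_left, inner_add_left, inner_neg_left, S.P_inner, e4, e7]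
  linarith

end IsGalerkin

end SpectralScale

/-- Differentiation of a limit of functions on a convex set on which the derivatives converge
uniformly. -/
theorem hasDerivWithinAt_of_tendstoUniformlyOn_of_convex {E : Type*} [NormedAddCommGroup E]
    [NormedSpace ℝ E] {s : Set ℝ} (hs : Convex ℝ s) {f g : ℝ → E} {F G : ℕ → ℝ → E}
    (hF : ∀ᶠ n in atTop, ∀ x ∈ s, HasDerivWithinAt (F n) (G n x) s x)
    (hf : ∀ x ∈ s, Tendsto (fun n => F n x) atTop (𝓝 (f x)))
    (hG : TendstoUniformlyOn G g atTop s) {x : ℝ} (hx : x ∈ s) (hg : ContinuousWithinAt g s x) :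
    HasDerivWithinAt f (g x) s x := by
  rw [hasDerivWithinAt_iff_isLittleO, isLittleO_iff]
  intro ε hε
  obtain ⟨δ, hδ, hball⟩ := Metric.continuousWithinAt_iff.1 hg (ε / 2) (half_pos hε)
  filter_upwards [self_mem_nhdsWithin, mem_nhdsWithin_of_mem_nhds (Metric.ball_mem_nhds x hδ)]
    with y hy hyb
  have hlim : Tendsto (fun n => F n y - F n x - (y - x) • g x) atTop
      (𝓝 (f y - f x - (y - x) • g x)) := ((hf y hy).sub (hf x hx)).sub_const _
  refine le_of_tendsto hlim.norm ?_
  filter_upwards [hF, Metric.tendstoUniformlyOn_iff.1 hG (ε / 2) (half_pos hε)] with n hFn hGn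
  have hconv : Convex ℝ (s ∩ Metric.ball x δ) := hs.inter (convex_ball x δ)
  have := hconv.norm_image_sub_le_of_norm_hasDerivWithin_le
    (f := fun z => F n z - z • g x) (f' := fun z => G n z - g x) (C := ε) (fun z hz => ?_)
    (fun z hz => ?_) ⟨hx, Metric.mem_ball_self hδ⟩ ⟨hy, hyb⟩
  · have h5 : F n y - y • g x - (F n x - x • g x) = F n y - F n x - (y - x) • g x := by
      rw [sub_smul]; abel
    rwa [h5] at this
  · have := ((hFn z hz.1).mono (inter_subset_left (t := Metric.ball x δ))).sub
      (((hasDerivAt_id z).smul_const (g x)).hasDerivWithinAt (s := s ∩ Metric.ball x δ))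
    rw [one_smul] at this
    exact this
  · have h1 := hGn z hz.1
    have h2 := hball hz.1 hz.2
    rw [dist_eq_norm] at h1 h2
    have h3 := norm_add_le (-(g z - G n z)) (g z - g x)
    rw [norm_neg] at h3
    have h4 : -(g z - G n z) + (g z - g x) = G n z - g x := by abel
    rw [h4] at h3
    linarith

namespace SpectralScale

variable {H : Type*} [NormedAddCommGroup H] [InnerProductSpace ℝ H] [CompleteSpace H]

/-- The Galerkin solutions starting from a spectrally truncated state converge, uniformly on
`[0, T]`, to a weak solution of `v' = -A v + N v`. Lower bounds for the Galerkin solutions are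
inherited by the limit. -/
theorem exists_weak_solution (S : SpectralScale H) {N : H → H} {K : ℝ}
    (hN : IsOneSidedLipschitz N K) {v₀ : H} {n₀ : ℕ} (h₀ : S.P n₀ v₀ = v₀) {T : ℝ} (hT : 0 ≤ T) :
    ∃ v : ℝ → H, v 0 = v₀ ∧ ContinuousOn v (Icc 0 T) ∧
      (∀ t ∈ Icc 0 T, ‖v t‖ ≤ ‖v₀‖ * Real.exp (K * t)) ∧
      (∀ t ∈ Icc 0 T, ∀ m, inner ℝ (S.A m (v t)) (v t) ≤
        (‖S.A n₀ v₀‖ + ‖N v₀‖ + K * ‖v₀‖) * ‖v₀‖ * Real.exp (K * T) ^ 2) ∧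
      (∃ B, ∀ t ∈ Icc 0 T, ∀ m, ‖S.A m (v t)‖ ≤ B) ∧
      (∀ φ ψ : H, Tendsto (fun n => S.P n φ) atTop (𝓝 φ) → Tendsto (fun n => S.A n φ) atTop (𝓝 ψ) →
        ∀ t ∈ Icc 0 T, HasDerivWithinAt (fun τ => inner ℝ (v τ) φ)
          (-inner ℝ (v t) ψ + inner ℝ (N (v t)) φ) (Icc 0 T) t) ∧
      (∀ θ : ℝ, (∀ n ≥ n₀, ∀ w, S.IsGalerkin N n T w → w 0 = v₀ → ∃ t ∈ Icc 0 T, θ ≤ ‖w t‖) →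
        ∃ t ∈ Icc 0 T, θ ≤ ‖v t‖) := by
  have hK : 0 ≤ K := zero_le_one.trans hN.one_le
  obtain ⟨L, hL⟩ := hN.lip
  have hL0 : ∀ u, ‖N u‖ ≤ L * ‖u‖ := fun u => by simpa [hN.zero] using hL.norm_sub_le u 0
  have hex : ∀ n, ∃ w : ℝ → H, n₀ ≤ n → w 0 = v₀ ∧ S.IsGalerkin N n (T + 1) w := by
    intro n
    by_cases hn : n₀ ≤ n
    · obtain ⟨w, hw⟩ := S.exists_isGalerkin hN (n := n) (v₀ := v₀)
        (by rw [← h₀, S.P_P' _ hn]) (T + 1)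
      exact ⟨w, fun _ => hw⟩
    · exact ⟨0, fun h => absurd h hn⟩
  choose u hu using hex
  have hu0 : ∀ n, n₀ ≤ n → u n 0 = v₀ := fun n hn => (hu n hn).1
  have hG : ∀ n, n₀ ≤ n → S.IsGalerkin N n (T + 1) (u n) := fun n hn => (hu n hn).2
  have hG' : ∀ n, n₀ ≤ n → S.IsGalerkin N n T (u n) := fun n hn => (hG n hn).mono (by linarith)
  have hIco : ∀ {t}, t ∈ Icc 0 T → t ∈ Ico 0 (T + 1) := fun ht => ⟨ht.1, by linarith [ht.2]⟩
  have hexp : ∀ {t}, t ∈ Icc 0 T → Real.exp (K * t) ≤ Real.exp (K * T) := fun ht =>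
    Real.exp_le_exp.2 (by have := ht.2; gcongr)
  set E := Real.exp (K * T) with hE
  set B := (‖S.A n₀ v₀‖ + ‖N v₀‖ + L * ‖v₀‖) * E with hB
  have hnorm : ∀ n, n₀ ≤ n → ∀ t ∈ Icc 0 T, ‖u n t‖ ≤ ‖v₀‖ * E := fun n hn t ht => by
    have := (hG' n hn).norm_le hN ht
    rw [hu0 n hn] at this
    exact this.trans (by have := hexp ht; gcongr)
  have hA : ∀ n, n₀ ≤ n → ∀ t ∈ Icc 0 T, ‖S.A n (u n t)‖ ≤ B := fun n hn t ht => by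
    have := (hG n hn).norm_A_le hN hL hn (by rw [hu0 n hn, h₀]) (hIco ht)
    rw [hu0 n hn] at this
    exact this.trans (by have := hexp ht; rw [hB]; gcongr)
  obtain ⟨η, hη, htail⟩ := S.tail
  set R := L * (‖v₀‖ * E) * (‖v₀‖ * E + B) with hR
  have hRnn : 0 ≤ R := by positivity
  have hclose : ∀ m n, n₀ ≤ m → m ≤ n → ∀ t ∈ Icc 0 T,
      ‖u n t - u m t‖ ^ 2 ≤ (R * |η m|) * Real.exp (2 * K * T) := by
    intro m n hm hmn t ht
    have hn := hm.trans hmn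
    have := IsGalerkin.norm_sub_sq_le hN (hG' n hn) (hG' m hm) hmn (by rw [hu0 n hn, hu0 m hm])
      (ε := R * |η m|) (by positivity) (fun t ht => ?_) ht
    · refine this.trans ?_
      have : Real.exp (2 * K * t) ≤ Real.exp (2 * K * T) :=
        Real.exp_le_exp.2 (by have := ht.2; gcongr)
      gcongr
    have h1 := htail m n (u n t) hmn
    have h2 := hnorm n hn t ht
    have h3 := hA n hn t ht
    have h4 : ‖N (u m t)‖ ≤ L * (‖v₀‖ * E) :=
      (hL0 _).trans (by have := hnorm m hm t ht; gcongr)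
    have h5 : ‖S.P n (u n t) - S.P m (u n t)‖ ≤ |η m| * (‖v₀‖ * E + B) := by
      refine h1.trans ((mul_le_mul_of_nonneg_right (le_abs_self _) (by positivity)).trans ?_)
      gcongr
    calc _ ≤ (L * (‖v₀‖ * E)) * (|η m| * (‖v₀‖ * E + B)) := by gcongr
      _ = R * |η m| := by rw [hR]; ring
  have hzero : Tendsto (fun m => √((R * |η m|) * Real.exp (2 * K * T))) atTop (𝓝 0) := by
    have : Tendsto (fun m => √((R * |η m|) * Real.exp (2 * K * T))) atTop
        (𝓝 √((R * |0|) * Real.exp (2 * K * T))) :=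
      (((hη.abs.const_mul R).mul_const _).sqrt)
    simpa using this
  have hclose' : ∀ m n, n₀ ≤ m → m ≤ n → ∀ t ∈ Icc 0 T,
      ‖u n t - u m t‖ ≤ √((R * |η m|) * Real.exp (2 * K * T)) := fun m n hm hmn t ht =>
    Real.le_sqrt_of_sq_le (hclose m n hm hmn t ht)
  have hlim : ∀ t, ∃ x, t ∈ Icc 0 T → Tendsto (fun n => u n t) atTop (𝓝 x) := by
    intro t
    by_cases ht : t ∈ Icc 0 T
    · have hc : CauchySeq (fun n => u n t) := by
        rw [Metric.cauchySeq_iff']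
        intro ε hε
        obtain ⟨m, hm⟩ := ((hzero.eventually (gt_mem_nhds hε)).and (eventually_ge_atTop n₀)).exists
        exact ⟨m, fun n hn => by
          rw [dist_eq_norm]; exact (hclose' m n hm.2 hn t ht).trans_lt hm.1⟩
      obtain ⟨x, hx⟩ := cauchySeq_tendsto_of_complete hc
      exact ⟨x, fun _ => hx⟩
    · exact ⟨0, fun h => absurd h ht⟩
  choose v hv using hlim
  have hvm : ∀ m, n₀ ≤ m → ∀ t ∈ Icc 0 T,
      ‖v t - u m t‖ ≤ √((R * |η m|) * Real.exp (2 * K * T)) := by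
    intro m hm t ht
    refine le_of_tendsto ((hv t ht).sub_const (u m t)).norm ?_
    filter_upwards [eventually_ge_atTop m] with n hn using hclose' m n hm hn t ht
  have hunif : TendstoUniformlyOn u v atTop (Icc 0 T) := by
    rw [Metric.tendstoUniformlyOn_iff]
    intro ε hε
    filter_upwards [hzero.eventually (gt_mem_nhds hε), eventually_ge_atTop n₀] with m h1 h2 t ht
    rw [dist_eq_norm]
    exact (hvm m h2 t ht).trans_lt h1
  have hcont : ContinuousOn v (Icc 0 T) :=
    hunif.continuousOn (Eventually.frequently (by
      filter_upwards [eventually_ge_atTop n₀] with n hn t ht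
      exact ((hG' n hn).deriv t ht).continuousWithinAt))
  have hvnorm : ∀ t ∈ Icc 0 T, ‖v t‖ ≤ ‖v₀‖ * Real.exp (K * t) := by
    intro t ht
    refine le_of_tendsto (hv t ht).norm ?_
    filter_upwards [eventually_ge_atTop n₀] with n hn
    simpa [hu0 n hn] using (hG' n hn).norm_le hN ht
  have h00 : (0 : ℝ) ∈ Icc 0 T := ⟨le_rfl, hT⟩
  refine ⟨v, ?_, hcont, hvnorm, ?_, ⟨B, ?_⟩, ?_, ?_⟩
  · refine tendsto_nhds_unique (hv 0 h00) (tendsto_const_nhds.congr' ?_)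
    filter_upwards [eventually_ge_atTop n₀] with n hn using (hu0 n hn).symm
  · intro t ht m
    have h1 : Tendsto (fun n => inner ℝ (S.A m (u n t)) (u n t)) atTop
        (𝓝 (inner ℝ (S.A m (v t)) (v t))) :=
      (((S.A m).continuous.tendsto _).comp (hv t ht)).inner (hv t ht)
    refine le_of_tendsto h1 ?_
    filter_upwards [eventually_ge_atTop n₀, eventually_ge_atTop m] with n hn hm
    refine (S.A_mono _ hm).trans ?_
    have := (hG n hn).inner_A_le hN hn (by rw [hu0 n hn, h₀]) (hIco ht)
    rw [hu0 n hn] at this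
    exact this.trans (by have := hexp ht; gcongr)
  · intro t ht m
    refine le_of_tendsto (((S.A m).continuous.tendsto _).comp (hv t ht)).norm ?_
    filter_upwards [eventually_ge_atTop n₀, eventually_ge_atTop m] with n hn hm
    exact (S.norm_A_le hm _).trans (hA n hn t ht)
  · intro φ ψ hφ hψ t ht
    refine hasDerivWithinAt_of_tendstoUniformlyOn_of_convex (convex_Icc 0 T)
      (F := fun n τ => inner ℝ (u n τ) φ) (G := fun n τ => inner ℝ (S.field N n (u n τ)) φ)
      (g := fun τ => -inner ℝ (v τ) ψ + inner ℝ (N (v τ)) φ) ?_ ?_ ?_ ht ?_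
    · filter_upwards [eventually_ge_atTop n₀] with n hn x hx
      simpa using ((hG' n hn).deriv x hx).inner ℝ (hasDerivWithinAt_const x (Icc 0 T) φ)
    · exact fun x hx => (hv x hx).inner tendsto_const_nhds
    · have hlim0 : Tendsto (fun n => ‖v₀‖ * E * ‖S.A n φ - ψ‖ + L * (‖v₀‖ * E) * ‖S.P n φ - φ‖ +
          √((R * |η n|) * Real.exp (2 * K * T)) * (‖ψ‖ + L * ‖φ‖)) atTop (𝓝 0) := by
        have h1 := (tendsto_iff_norm_sub_tendsto_zero.1 hψ).const_mul (‖v₀‖ * E)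
        have h2 := (tendsto_iff_norm_sub_tendsto_zero.1 hφ).const_mul (L * (‖v₀‖ * E))
        have h3 := hzero.mul_const (‖ψ‖ + L * ‖φ‖)
        simpa using (h1.add h2).add h3
      rw [Metric.tendstoUniformlyOn_iff]
      intro ε hε
      filter_upwards [hlim0.eventually (gt_mem_nhds hε), eventually_ge_atTop n₀] with n h1 h2 x hx
      refine lt_of_le_of_lt ?_ h1
      have e : (-inner ℝ (v x) ψ + inner ℝ (N (v x)) φ) - inner ℝ (S.field N n (u n x)) φ =
          inner ℝ (u n x) (S.A n φ - ψ) - inner ℝ (N (u n x)) (S.P n φ - φ)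
            + (-inner ℝ (v x - u n x) ψ + inner ℝ (N (v x) - N (u n x)) φ) := by
        rw [field, inner_add_left, inner_neg_left, S.A_inner, S.P_inner]
        simp only [inner_sub_left, inner_sub_right]
        ring
      rw [Real.dist_eq, e]
      have b1 : |inner ℝ (u n x) (S.A n φ - ψ)| ≤ ‖v₀‖ * E * ‖S.A n φ - ψ‖ :=
        (abs_real_inner_le_norm _ _).trans (by have := hnorm n h2 x hx; gcongr)
      have b2 : |inner ℝ (N (u n x)) (S.P n φ - φ)| ≤ L * (‖v₀‖ * E) * ‖S.P n φ - φ‖ :=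
        (abs_real_inner_le_norm _ _).trans (by
          have h4 : ‖N (u n x)‖ ≤ L * (‖v₀‖ * E) :=
            (hL0 _).trans (by have := hnorm n h2 x hx; gcongr)
          gcongr)
      have b3 : |inner ℝ (v x - u n x) ψ| ≤ √((R * |η n|) * Real.exp (2 * K * T)) * ‖ψ‖ :=
        (abs_real_inner_le_norm _ _).trans (by have := hvm n h2 x hx; gcongr)
      have b4 : |inner ℝ (N (v x) - N (u n x)) φ| ≤
          L * √((R * |η n|) * Real.exp (2 * K * T)) * ‖φ‖ :=
        (abs_real_inner_le_norm _ _).trans (by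
          have h4 := hL.norm_sub_le (v x) (u n x)
          have h5 : (L : ℝ) * ‖v x - u n x‖ ≤ L * √((R * |η n|) * Real.exp (2 * K * T)) := by
            have := hvm n h2 x hx; gcongr
          have := h4.trans h5
          gcongr)
      rw [abs_le] at *
      constructor <;> linarith [b1.1, b1.2, b2.1, b2.2, b3.1, b3.2, b4.1, b4.2]
    · have h1 := hcont t ht
      exact (h1.inner continuousWithinAt_const).neg.add
        ((hL.continuous.continuousAt.comp_continuousWithinAt h1).inner continuousWithinAt_const)
  · intro θ h
    by_contra! hlt
    obtain ⟨t₁, ht₁, hmax⟩ := isCompact_Icc.exists_isMaxOn ⟨0, h00⟩ hcont.norm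
    have hgap : 0 < θ - ‖v t₁‖ := by linarith [hlt t₁ ht₁]
    obtain ⟨n, hn1, hn2⟩ := ((Metric.tendstoUniformlyOn_iff.1 hunif _ hgap).and
      (eventually_ge_atTop n₀)).exists
    obtain ⟨t, ht, hθ⟩ := h n hn2 (u n) (hG' n hn2) (hu0 n hn2)
    have h1 := hn1 t ht
    have h2 : ‖v t‖ ≤ ‖v t₁‖ := hmax ht
    have h3 := norm_sub_norm_le (u n t) (v t)
    rw [dist_comm, dist_eq_norm] at h1
    linarith

end SpectralScale

namespace SpectralScale

variable {H : Type*} [NormedAddCommGroup H] [InnerProductSpace ℝ H] {S : SpectralScale H}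
  {N : H → H} {K T : ℝ} {n : ℕ} {v : ℝ → H}

theorem IsGalerkin.ne_zero (hN : IsOneSidedLipschitz N K) (hv : S.IsGalerkin N n T v)
    (h0 : v 0 ≠ 0) {t : ℝ} (ht : t ∈ Icc 0 T) : v t ≠ 0 := by
  intro hzero
  obtain ⟨L, hL⟩ := S.lipschitz_field hN n
  have hv' := hv.mono ht.2
  have hc : ContinuousOn v (Icc 0 t) := fun τ hτ => (hv'.deriv τ hτ).continuousWithinAt
  have := ODE_solution_unique_of_mem_Icc_left (v := fun _ => S.field N n) (s := fun _ => univ)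
    (K := L) (f := v) (g := fun _ => 0) (a := 0) (b := t)
    (fun _ _ => hL.lipschitzOnWith) hc
    (fun τ hτ => (hv'.deriv τ ⟨hτ.1.le, hτ.2⟩).mono_of_mem_nhdsWithin (Icc_mem_nhdsLE_of_mem hτ))
    (fun _ _ => mem_univ _) continuousOn_const
    (fun τ _ => by simpa [field, hN.zero] using hasDerivWithinAt_const τ (Iic τ) (0 : H))
    (fun _ _ => mem_univ _) hzero
  exact h0 (this ⟨le_rfl, ht.1⟩)

/-- Galerkin solutions starting from a state of negative energy grow exponentially until they
reach a fixed size `θ`. -/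
theorem IsGalerkin.exists_norm_ge [CompleteSpace H] (hN : IsOneSidedLipschitz N K)
    (hv : S.IsGalerkin N n T v) {Ψ : H → ℝ} (hΨ : ∀ u, HasGradientAt Ψ (N u) u)
    (hΨle : ∀ u, Ψ u ≤ K / 2 * ‖u‖ ^ 2) {C ρ q θ : ℝ} (hC : 0 ≤ C) (hq : 0 < q)
    (herr : ∀ u, S.P n u = u → inner ℝ (S.A n u) u ≤ K * ‖u‖ ^ 2 → ‖u‖ ≤ ρ →
      |inner ℝ (N u) u - 2 * Ψ u| ≤ C * ‖u‖ ^ 3)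
    (hθ : 0 < θ) (hθρ : θ ≤ ρ) (hθq : 9 * C * θ < q) (h0 : v 0 ≠ 0)
    (hE : q * (‖v 0‖ ^ 2 / 2) ≤ -(inner ℝ (S.A n (v 0)) (v 0) / 2 - Ψ (v 0))) (hT : 0 ≤ T)
    (hlarge : θ ^ 2 ≤ ‖v 0‖ ^ 2 * Real.exp (q * T)) :
    ∃ t ∈ Icc 0 T, θ ≤ ‖v t‖ := by
  by_contra! hlt
  set F : ℝ → H := fun t => S.field N n (v t) with hF
  set M : ℝ → ℝ := fun t => ‖v t‖ ^ 2 / 2 with hM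
  set J : ℝ → ℝ := fun t => inner ℝ (S.A n (v t)) (v t) / 2 - Ψ (v t) with hJ
  have dM : ∀ t ∈ Icc 0 T, HasDerivWithinAt M (inner ℝ (v t) (F t)) (Icc 0 T) t := by
    intro t ht
    have := (hv.deriv t ht).norm_sq.div_const 2
    simpa using this
  have dJ : ∀ t ∈ Icc 0 T, HasDerivWithinAt J (-‖F t‖ ^ 2) (Icc 0 T) t := by
    intro t ht
    have h1 := ((S.A n).hasFDerivAt.comp_hasDerivWithinAt t (hv.deriv t ht)).inner ℝ (hv.deriv t ht)
    have h2 := (hΨ (v t)).hasFDerivAt.comp_hasDerivWithinAt t (hv.deriv t ht)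
    have h3 := (h1.div_const 2).sub h2
    have hPF : S.P n (F t) = F t := by
      simp [hF, field, S.P_A _ le_rfl, S.P_P _ le_rfl]
    have e : (inner ℝ (S.A n (v t)) (F t) + inner ℝ (S.A n (F t)) (v t)) / 2
        - inner ℝ (N (v t)) (F t) = -‖F t‖ ^ 2 := by
      have e1 : inner ℝ (S.A n (F t)) (v t) = inner ℝ (S.A n (v t)) (F t) := by
        rw [S.A_inner, real_inner_comm]
      have e2 : inner ℝ (N (v t)) (F t) = inner ℝ (S.P n (N (v t))) (F t) := by
        rw [S.P_inner, hPF]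
      have e3 : inner ℝ (F t) (F t) = -inner ℝ (S.A n (v t)) (F t)
          + inner ℝ (S.P n (N (v t))) (F t) := by
        conv_lhs => enter [2]; rw [hF]
        simp only [field, inner_add_left, inner_neg_left]
      rw [← real_inner_self_eq_norm_sq, e1, e2, e3]; ring
    rw [← e]
    simp only [InnerProductSpace.toDual_apply_apply] at h3
    exact h3
  have hJanti : ∀ t ∈ Icc 0 T, J t ≤ J 0 := by
    intro t ht
    have : AntitoneOn J (Icc 0 T) := by
      refine antitoneOn_of_deriv_nonpos (convex_Icc 0 T)
        (fun t ht => (dJ t ht).continuousWithinAt) (fun t ht => ?_) (fun t ht => ?_)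
      · rw [interior_Icc] at ht
        exact ((dJ t (Ioo_subset_Icc_self ht)).hasDerivAt
          (Icc_mem_nhds ht.1 ht.2)).differentiableAt.differentiableWithinAt
      · rw [interior_Icc] at ht
        rw [((dJ t (Ioo_subset_Icc_self ht)).hasDerivAt (Icc_mem_nhds ht.1 ht.2)).deriv]
        have := sq_nonneg ‖F t‖
        linarith
    exact this ⟨le_rfl, hT⟩ ht ht.1
  have hMpos : ∀ t ∈ Icc 0 T, 0 < M t := fun t ht => by
    have := norm_pos_iff.2 (hv.ne_zero hN h0 ht)
    simp only [hM]; positivity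
  have h00 : (0 : ℝ) ∈ Icc 0 T := ⟨le_rfl, hT⟩
  have hJ0 : q * M 0 ≤ -J 0 := hE
  have hJneg : ∀ t ∈ Icc 0 T, J t ≤ 0 := fun t ht => by
    have h1 := hJanti t ht
    have h2 := hMpos 0 h00
    nlinarith
  have grow := exp_growth_of_gradient_flow (M := M) (J := J) (T := T) (C := 3 * C) (q := q)
    (μ := θ ^ 2 / 2) (by positivity) hq
    (by
      have : √(θ ^ 2 / 2) ≤ θ := Real.sqrt_le_iff.2 ⟨hθ.le, by nlinarith⟩
      have : C * √(θ ^ 2 / 2) ≤ C * θ := by gcongr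
      linarith) dM dJ hMpos
    (fun t ht => by
      have h1 := hlt t ht
      have h2 := norm_nonneg (v t)
      simp only [hM]; nlinarith)
    (fun t ht => by
      have h1 := abs_real_inner_le_norm (v t) (F t)
      have h2 : inner ℝ (v t) (F t) ^ 2 ≤ (‖v t‖ * ‖F t‖) ^ 2 := sq_le_sq' (by
        linarith [(abs_le.1 h1).1]) (abs_le.1 h1).2
      simp only [hM]; nlinarith)
    (fun t ht => by
      have hle := hJneg t ht
      have hAle : inner ℝ (S.A n (v t)) (v t) ≤ K * ‖v t‖ ^ 2 := by
        have := hΨle (v t)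
        simp only [hJ] at hle
        linarith
      have h1 := herr (v t) (hv.proj t ht) hAle ((hlt t ht).le.trans hθρ)
      have e : inner ℝ (v t) (F t) + 2 * J t = inner ℝ (N (v t)) (v t) - 2 * Ψ (v t) := by
        simp only [hJ, hF, field, inner_add_right, inner_neg_right]
        rw [real_inner_comm (S.A n (v t)) (v t), ← S.P_inner, hv.proj t ht,
          real_inner_comm (v t) (N (v t))]
        ring
      rw [e]
      refine h1.trans ?_
      have h2 : ‖v t‖ ≤ 3 / 2 * √(M t) := by
        have : (2 / 3 * ‖v t‖) ≤ √(M t) := Real.le_sqrt_of_sq_le (by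
          simp only [hM]; nlinarith [sq_nonneg ‖v t‖])
        linarith
      have h3 : ‖v t‖ ^ 2 = 2 * M t := by simp only [hM]; ring
      calc C * ‖v t‖ ^ 3 = C * ‖v t‖ * ‖v t‖ ^ 2 := by ring
        _ ≤ C * (3 / 2 * √(M t)) * ‖v t‖ ^ 2 := by gcongr
        _ = 3 * C * √(M t) * M t := by rw [h3]; ring) hJ0 T ⟨hT, le_rfl⟩
  have h1 := hlt T ⟨hT, le_rfl⟩
  have h2 := norm_nonneg (v T)
  simp only [hM] at grow
  nlinarith

end SpectralScale

namespace GSH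

open SchwartzMap ComplexConjugate

/-- Real square integrable functions on the plane. -/
abbrev RL2 : Type := Lp ℝ 2 (volume : Measure Plane)

/-- Complex square integrable functions on the plane. -/
abbrev CL2 : Type := Lp ℂ 2 (volume : Measure Plane)

/-- Complex conjugation on `L²`. -/
def conjL2 : CL2 →L[ℝ] CL2 := (Complex.conjCLE : ℂ →L[ℝ] ℂ).compLpL 2 volume

/-- The reflection `f ↦ f ∘ (-·)` on `L²`. -/
def reflL2 : CL2 →+ CL2 :=
  Lp.compMeasurePreserving (fun ξ : Plane => -ξ) (Measure.measurePreserving_neg volume)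

theorem coeFn_conjL2 (f : CL2) : conjL2 f =ᵐ[volume] fun ξ => conj (f ξ) :=
  ContinuousLinearMap.coeFn_compLpL _ _

theorem coeFn_reflL2 (f : CL2) : reflL2 f =ᵐ[volume] fun ξ => f (-ξ) :=
  Lp.coeFn_compMeasurePreserving _ _

theorem continuous_reflL2 : Continuous reflL2 :=
  (Lp.isometry_compMeasurePreserving _).continuous

/-- Complex conjugation of Schwartz functions. -/
def conjSchwartz : 𝓢(Plane, ℂ) →L[ℝ] 𝓢(Plane, ℂ) :=
  bilinLeftCLM ((ContinuousLinearMap.lsmul ℝ ℝ (E := ℂ)).flip.comp (Complex.conjCLE : ℂ →L[ℝ] ℂ))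
    (g := fun _ : Plane => (1 : ℝ)) (Function.HasTemperateGrowth.const 1)

theorem conjSchwartz_apply (f : 𝓢(Plane, ℂ)) (x : Plane) : conjSchwartz f x = conj (f x) := by
  simp [conjSchwartz, bilinLeftCLM_apply]

theorem fourier_conjSchwartz (f : 𝓢(Plane, ℂ)) (ξ : Plane) :
    𝓕 (conjSchwartz f) ξ = conj (𝓕 f (-ξ)) := by
  rw [SchwartzMap.fourier_coe, SchwartzMap.fourier_coe, Real.fourier_eq', Real.fourier_eq', ← integral_conj]
  congr 1
  ext v
  rw [conjSchwartz_apply]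
  simp [← Complex.exp_conj, map_ofNat]

theorem fourier_conjL2 (f : CL2) : 𝓕 (conjL2 f) = reflL2 (conjL2 (𝓕 f)) := by
  refine DenseRange.induction_on (p := fun f : CL2 => 𝓕 (conjL2 f) = reflL2 (conjL2 (𝓕 f)))
    (SchwartzMap.denseRange_toLpCLM (p := 2) ENNReal.ofNat_ne_top) f ?_ ?_
  · exact isClosed_eq ((Lp.fourierTransformₗᵢ Plane ℂ).continuous.comp conjL2.continuous)
      (continuous_reflL2.comp (conjL2.continuous.comp (Lp.fourierTransformₗᵢ Plane ℂ).continuous))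
  · intro g
    have h1 : conjL2 (g.toLp 2 volume) = (conjSchwartz g).toLp 2 volume := by
      refine Lp.ext ?_
      filter_upwards [coeFn_conjL2 (g.toLp 2 volume), g.coeFn_toLp 2 volume,
        (conjSchwartz g).coeFn_toLp 2 volume] with x h1 h2 h3
      rw [h1, h2, h3, conjSchwartz_apply]
    simp only [toLpCLM_apply]
    rw [h1, SchwartzMap.toLp_fourier_eq, SchwartzMap.toLp_fourier_eq]
    refine Lp.ext ?_
    have hq : Measure.QuasiMeasurePreserving (fun ξ : Plane => -ξ) volume volume :=
      (Measure.measurePreserving_neg (volume : Measure Plane)).quasiMeasurePreserving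
    filter_upwards [coeFn_reflL2 (conjL2 ((𝓕 g).toLp 2 volume)),
      hq.ae (coeFn_conjL2 ((𝓕 g).toLp 2 volume)), hq.ae ((𝓕 g).coeFn_toLp 2 volume),
      (𝓕 (conjSchwartz g)).coeFn_toLp 2 volume] with ξ h1 h2 h3 h4
    rw [h1, h2, h3, h4, fourier_conjSchwartz]

/-- The inclusion of the real `L²` functions into the complex ones. -/
def complexify : RL2 →L[ℝ] CL2 := Complex.ofRealCLM.compLpL 2 volume

/-- The real part of `L²` functions. -/
def reL2 : CL2 →L[ℝ] RL2 := Complex.reCLM.compLpL 2 volume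

theorem coeFn_complexify (u : RL2) : complexify u =ᵐ[volume] fun p => (u p : ℂ) :=
  ContinuousLinearMap.coeFn_compLpL _ _

theorem coeFn_reL2 (f : CL2) : reL2 f =ᵐ[volume] fun p => (f p).re :=
  ContinuousLinearMap.coeFn_compLpL _ _

theorem conjL2_complexify (u : RL2) : conjL2 (complexify u) = complexify u := by
  refine Lp.ext ?_
  filter_upwards [coeFn_conjL2 (complexify u), coeFn_complexify u] with p h1 h2
  rw [h1, h2, Complex.conj_ofReal]

theorem complexify_reL2 {f : CL2} (hf : conjL2 f = f) : complexify (reL2 f) = f := by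
  refine Lp.ext ?_
  have h0 := coeFn_conjL2 f
  rw [hf] at h0
  filter_upwards [coeFn_complexify (reL2 f), coeFn_reL2 f, h0] with p h1 h2 h3
  rw [h1, h2]
  exact Complex.conj_eq_iff_re.1 h3.symm

theorem inner_complexify (u v : RL2) :
    (inner ℂ (complexify u) (complexify v) : ℂ) = ((inner ℝ u v : ℝ) : ℂ) := by
  rw [L2.inner_def, L2.inner_def, ← integral_complex_ofReal]
  refine integral_congr_ae ?_
  filter_upwards [coeFn_complexify u, coeFn_complexify v] with p h1 h2
  rw [h1, h2]
  simp [mul_comm]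

/-- The Fourier transform of a real `L²` function. -/
def hat (u : RL2) : CL2 := 𝓕 (complexify u)

theorem hat_add (u v : RL2) : hat (u + v) = hat u + hat v := by
  simp only [hat, map_add]; exact map_add (Lp.fourierTransformₗᵢ Plane ℂ) _ _

theorem inner_eq_re_inner_hat (u v : RL2) : inner ℝ u v = (inner ℂ (hat u) (hat v) : ℂ).re := by
  rw [hat, hat, Lp.inner_fourier_eq, inner_complexify, Complex.ofReal_re]

theorem inner_eq_integral_hat (u v : RL2) :
    inner ℝ u v = ∫ ξ, (hat v ξ * conj (hat u ξ)).re := by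
  rw [inner_eq_re_inner_hat, L2.inner_def]
  exact (integral_re (L2.integrable_inner (𝕜 := ℂ) (hat u) (hat v))).symm

theorem norm_hat (u : RL2) : ‖hat u‖ = ‖u‖ := by
  have h1 : ‖hat u‖ ^ 2 = ‖u‖ ^ 2 := by
    rw [← inner_self_eq_norm_sq (𝕜 := ℂ), ← real_inner_self_eq_norm_sq, inner_eq_re_inner_hat]
    rfl
  exact (pow_left_inj₀ (norm_nonneg _) (norm_nonneg _) two_ne_zero).1 h1

theorem hat_smul (c : ℝ) (u : RL2) : hat (c • u) = (c : ℂ) • hat u := by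
  have : complexify (c • u) = (c : ℂ) • complexify u := by
    rw [map_smul]; exact (Complex.coe_smul c _).symm
  rw [hat, this]
  exact map_smul (Lp.fourierTransformₗᵢ Plane ℂ) _ _

theorem hat_sub (u v : RL2) : hat (u - v) = hat u - hat v := by
  simp only [hat, map_sub]; exact map_sub (Lp.fourierTransformₗᵢ Plane ℂ) _ _

theorem hat_injective : Function.Injective hat := fun u v h => by
  rw [← sub_eq_zero, ← norm_eq_zero, ← norm_hat, hat_sub, h, sub_self, norm_zero]

theorem hat_neg_ae (u : RL2) : ∀ᵐ ξ, hat u (-ξ) = conj (hat u ξ) := by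
  have h : hat u = reflL2 (conjL2 (hat u)) := by
    conv_lhs => rw [hat, ← conjL2_complexify, fourier_conjL2]
    rfl
  have hq : Measure.QuasiMeasurePreserving (fun ξ : Plane => -ξ) volume volume :=
      (Measure.measurePreserving_neg (volume : Measure Plane)).quasiMeasurePreserving
  have h0 := coeFn_reflL2 (conjL2 (hat u))
  rw [← h] at h0
  filter_upwards [hq.ae h0, coeFn_conjL2 (hat u)] with ξ h1 h2
  rw [h1, neg_neg, h2]

/-- A square integrable function with Hermitian symmetry is the Fourier transform of a real
function. -/
theorem exists_hat_eq {g : CL2} (hg : ∀ᵐ ξ, g (-ξ) = conj (g ξ)) : ∃ u : RL2, hat u = g := by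
  have hF : 𝓕 (𝓕⁻ g : CL2) = g := FourierTransform.fourier_fourierInv_eq g
  have h1 : reflL2 (conjL2 g) = g := by
    refine Lp.ext ?_
    have hq : Measure.QuasiMeasurePreserving (fun ξ : Plane => -ξ) volume volume :=
      (Measure.measurePreserving_neg (volume : Measure Plane)).quasiMeasurePreserving
    filter_upwards [coeFn_reflL2 (conjL2 g), hq.ae (coeFn_conjL2 g), hg] with ξ h1 h2 h3
    rw [h1, h2, h3, Complex.conj_conj]
  have h2 : conjL2 (𝓕⁻ g : CL2) = 𝓕⁻ g := by
    have h3 : 𝓕 (conjL2 (𝓕⁻ g : CL2)) = 𝓕 (𝓕⁻ g : CL2) := by rw [fourier_conjL2, hF, h1]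
    exact (Lp.fourierTransformₗᵢ Plane ℂ).injective h3
  exact ⟨reL2 (𝓕⁻ g), by rw [hat, complexify_reL2 h2, hF]⟩

/-- A bounded, measurable, even real symbol. -/
structure EvenSymbol where
  toFun : Plane → ℝ
  measurable : Measurable toFun
  even : ∀ ξ, toFun (-ξ) = toFun ξ
  bdd : ∃ C, ∀ ξ, |toFun ξ| ≤ C

instance : CoeFun EvenSymbol (fun _ => Plane → ℝ) := ⟨EvenSymbol.toFun⟩

namespace EvenSymbol

theorem memLp (a : EvenSymbol) (g : CL2) : MemLp (fun ξ => (a ξ : ℂ) * g ξ) 2 volume := by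
  obtain ⟨C, hC⟩ := a.bdd
  refine MemLp.of_le_mul (Lp.memLp g) (c := C)
    ((Complex.measurable_ofReal.comp a.measurable).aestronglyMeasurable.mul
      (Lp.aestronglyMeasurable g)) (Eventually.of_forall fun ξ => ?_)
  rw [norm_mul, Complex.norm_real, Real.norm_eq_abs]
  exact mul_le_mul_of_nonneg_right (hC ξ) (norm_nonneg _)

theorem exists_hat (a : EvenSymbol) (u : RL2) :
    ∃ v : RL2, hat v =ᵐ[volume] fun ξ => (a ξ : ℂ) * hat u ξ := by
  have hq : Measure.QuasiMeasurePreserving (fun ξ : Plane => -ξ) volume volume :=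
      (Measure.measurePreserving_neg (volume : Measure Plane)).quasiMeasurePreserving
  obtain ⟨v, hv⟩ := exists_hat_eq (g := (a.memLp (hat u)).toLp _) (by
    filter_upwards [(a.memLp (hat u)).coeFn_toLp, hq.ae (a.memLp (hat u)).coeFn_toLp, hat_neg_ae u]
      with ξ h1 h2 h3
    rw [h1, h2, h3, a.even, map_mul, Complex.conj_ofReal])
  exact ⟨v, by rw [hv]; exact (a.memLp (hat u)).coeFn_toLp⟩

/-- The action of the Fourier multiplier with an even symbol. -/
def multFun (a : EvenSymbol) (u : RL2) : RL2 := (a.exists_hat u).choose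

theorem hat_multFun (a : EvenSymbol) (u : RL2) :
    hat (a.multFun u) =ᵐ[volume] fun ξ => (a ξ : ℂ) * hat u ξ := (a.exists_hat u).choose_spec

/-- The Fourier multiplier with an even symbol, as an operator on real `L²` functions. -/
def mult (a : EvenSymbol) : RL2 →L[ℝ] RL2 :=
  LinearMap.mkContinuousOfExistsBound
    { toFun := a.multFun
      map_add' := fun u v => hat_injective <| Lp.ext <| by
        rw [hat_add (a.multFun u)]
        filter_upwards [a.hat_multFun (u + v), a.hat_multFun u,
          a.hat_multFun v, Lp.coeFn_add (hat u) (hat v),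
          Lp.coeFn_add (hat (a.multFun u)) (hat (a.multFun v))] with ξ h1 h2 h3 h4 h5
        rw [h1, h5, Pi.add_apply, h2, h3, hat_add, h4, Pi.add_apply, mul_add]
      map_smul' := fun c u => hat_injective <| Lp.ext <| by
        rw [RingHom.id_apply, hat_smul c (a.multFun u)]
        filter_upwards [a.hat_multFun (c • u), a.hat_multFun u,
          Lp.coeFn_smul (c : ℂ) (hat u),
          Lp.coeFn_smul (c : ℂ) (hat (a.multFun u))] with ξ h1 h2 h3 h4
        rw [h1, h4, Pi.smul_apply, h2, hat_smul, h3, Pi.smul_apply, smul_eq_mul, smul_eq_mul]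
        ring }
    (by
      obtain ⟨C, hC⟩ := a.bdd
      refine ⟨C, fun u => ?_⟩
      rw [← norm_hat, ← norm_hat u]
      refine Lp.norm_le_mul_norm_of_ae_le_mul ?_
      filter_upwards [a.hat_multFun u] with ξ h
      simp only [LinearMap.coe_mk, AddHom.coe_mk]
      rw [h, norm_mul, Complex.norm_real, Real.norm_eq_abs]
      exact mul_le_mul_of_nonneg_right (hC ξ) (norm_nonneg _))

theorem hat_mult (a : EvenSymbol) (u : RL2) :
    hat (a.mult u) =ᵐ[volume] fun ξ => (a ξ : ℂ) * hat u ξ := a.hat_multFun u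

theorem mult_inner (a : EvenSymbol) (u v : RL2) :
    inner ℝ (a.mult u) v = ∫ ξ, a ξ * (hat v ξ * conj (hat u ξ)).re := by
  rw [inner_eq_integral_hat]
  refine integral_congr_ae ?_
  filter_upwards [a.hat_mult u] with ξ h
  rw [h, map_mul, Complex.conj_ofReal, mul_left_comm, Complex.re_ofReal_mul]

theorem mult_inner_comm (a : EvenSymbol) (u v : RL2) :
    inner ℝ (a.mult u) v = inner ℝ u (a.mult v) := by
  rw [real_inner_comm (a.mult v) u, mult_inner, mult_inner]
  congr 1; ext ξ
  congr 1
  simp only [Complex.mul_re, Complex.conj_re, Complex.conj_im]; ring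

theorem mult_inner_self (a : EvenSymbol) (u : RL2) :
    inner ℝ (a.mult u) u = ∫ ξ, a ξ * ‖hat u ξ‖ ^ 2 := by
  rw [mult_inner]
  congr 1; ext ξ
  rw [Complex.mul_conj, Complex.ofReal_re, Complex.normSq_eq_norm_sq]

theorem mult_mult {a b c : EvenSymbol} (h : ∀ ξ, a ξ * b ξ = c ξ) (u : RL2) :
    a.mult (b.mult u) = c.mult u := by
  refine hat_injective (Lp.ext ?_)
  filter_upwards [a.hat_mult (b.mult u), b.hat_mult u, c.hat_mult u] with ξ h1 h2 h3
  rw [h1, h2, h3, ← h, Complex.ofReal_mul, mul_assoc]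

theorem integrable_mul_norm_sq (a : EvenSymbol) (u : RL2) :
    Integrable (fun ξ => a ξ * ‖hat u ξ‖ ^ 2) := by
  obtain ⟨C, hC⟩ := a.bdd
  exact (((Lp.memLp (hat u)).integrable_norm_pow two_ne_zero)).bdd_mul
    a.measurable.aestronglyMeasurable (c := C) (Eventually.of_forall fun ξ => hC ξ)

theorem mult_inner_self_mono {a b : EvenSymbol} (h : ∀ ξ, a ξ ≤ b ξ) (u : RL2) :
    inner ℝ (a.mult u) u ≤ inner ℝ (b.mult u) u := by
  rw [mult_inner_self, mult_inner_self]
  refine integral_mono (a.integrable_mul_norm_sq u) (b.integrable_mul_norm_sq u) fun ξ => ?_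
  exact mul_le_mul_of_nonneg_right (h ξ) (by positivity)

theorem mult_inner_self_nonneg {a : EvenSymbol} (h : ∀ ξ, 0 ≤ a ξ) (u : RL2) :
    0 ≤ inner ℝ (a.mult u) u := by
  rw [mult_inner_self]
  exact integral_nonneg fun ξ => mul_nonneg (h ξ) (by positivity)

end EvenSymbol

end GSH

namespace GSH

open SchwartzMap ComplexConjugate

/-- The symbol of `1 + k ∂ₓ² + ∂ᵧ²`. -/
def swSymbol (k : ℝ) (ξ : Plane) : ℝ :=
  1 - k * (2 * Real.pi * ξ 0) ^ 2 - (2 * Real.pi * ξ 1) ^ 2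

/-- The weight `1 + |2πξ|²` of the Sobolev norms. -/
def sobWeight (ξ : Plane) : ℝ := 1 + (2 * Real.pi * ‖ξ‖) ^ 2

theorem continuous_swSymbol (k : ℝ) : Continuous (swSymbol k) := by
  unfold swSymbol; fun_prop

theorem one_le_sobWeight (ξ : Plane) : 1 ≤ sobWeight ξ := by
  unfold sobWeight; nlinarith [sq_nonneg (2 * Real.pi * ‖ξ‖)]

theorem continuous_sobWeight : Continuous sobWeight := by
  unfold sobWeight; fun_prop

/-- Ellipticity of the Swift-Hohenberg operator. -/
theorem sobWeight_sq_le {k : ℝ} (hk : 1 / 2 ≤ k) (ξ : Plane) :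
    sobWeight ξ ^ 2 ≤ 18 * (1 + swSymbol k ξ ^ 2) := by
  have h1 : sobWeight ξ = 1 + (2 * Real.pi * ξ 0) ^ 2 + (2 * Real.pi * ξ 1) ^ 2 := by
    rw [sobWeight, mul_pow, EuclideanSpace.norm_sq_eq]
    simp only [Fin.sum_univ_two, Real.norm_eq_abs, sq_abs]
    ring
  rw [h1, swSymbol]
  set x := (2 * Real.pi * ξ 0) ^ 2
  set y := (2 * Real.pi * ξ 1) ^ 2
  have hx : 0 ≤ x := sq_nonneg _
  have hy : 0 ≤ y := sq_nonneg _
  have h2 : (x + y) ^ 2 ≤ 4 * (k * x + y) ^ 2 := by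
    have h3 : x + y ≤ 2 * (k * x + y) := by nlinarith
    nlinarith
  nlinarith [sq_nonneg (1 - (x + y)), sq_nonneg (2 - (k * x + y))]

/-- The indicator function of the ball of radius `n` in frequency space. -/
def lowPass (n : ℕ) : EvenSymbol where
  toFun := fun ξ => if ‖ξ‖ ≤ n then 1 else 0
  measurable := Measurable.ite (measurableSet_le measurable_norm measurable_const)
    measurable_const measurable_const
  even := fun ξ => by simp
  bdd := ⟨1, fun ξ => by split_ifs <;> simp⟩

/-- The symbol of `(1 + k ∂ₓ² + ∂ᵧ²)²`, truncated to the ball of radius `n`. -/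
def swTrunc (k : ℝ) (n : ℕ) : EvenSymbol where
  toFun := fun ξ => if ‖ξ‖ ≤ n then swSymbol k ξ ^ 2 else 0
  measurable := Measurable.ite (measurableSet_le measurable_norm measurable_const)
    ((continuous_swSymbol k).measurable.pow_const 2) measurable_const
  even := fun ξ => by simp [swSymbol]
  bdd := by
    obtain ⟨C, hC⟩ := (isCompact_closedBall (0 : Plane) n).exists_bound_of_continuousOn
      ((continuous_swSymbol k).pow 2).continuousOn
    have hC0 : 0 ≤ C := (norm_nonneg _).trans (hC 0 (by simp))
    refine ⟨C, fun ξ => ?_⟩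
    split_ifs with h
    · exact hC ξ (by simpa using h)
    · simpa using hC0

theorem lowPass_apply (n : ℕ) (ξ : Plane) : lowPass n ξ = if ‖ξ‖ ≤ n then 1 else 0 := rfl

theorem swTrunc_apply (k : ℝ) (n : ℕ) (ξ : Plane) :
    swTrunc k n ξ = if ‖ξ‖ ≤ n then swSymbol k ξ ^ 2 else 0 := rfl

/-- The spectral truncations of the Swift-Hohenberg operator. -/
def swScale (k : ℝ) (hk : 1 / 2 ≤ k) : SpectralScale RL2 where
  P := fun n => (lowPass n).mult
  A := fun n => (swTrunc k n).mult
  P_inner := fun n u v => (lowPass n).mult_inner_comm u v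
  A_inner := fun n u v => (swTrunc k n).mult_inner_comm u v
  A_nonneg := fun n u => EvenSymbol.mult_inner_self_nonneg
    (fun ξ => by rw [swTrunc_apply]; split_ifs <;> positivity) u
  A_mono := fun {m n} u hmn => EvenSymbol.mult_inner_self_mono (fun ξ => by
    rw [swTrunc_apply, swTrunc_apply]
    have : (m : ℝ) ≤ n := by exact_mod_cast hmn
    split_ifs with h1 h2
    · rfl
    · exact absurd (h1.trans this) h2
    · positivity
    · rfl) u
  P_P := fun {m n} u hmn => EvenSymbol.mult_mult (fun ξ => by
    rw [lowPass_apply, lowPass_apply]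
    have : (m : ℝ) ≤ n := by exact_mod_cast hmn
    by_cases h : ‖ξ‖ ≤ m
    · rw [if_pos h, if_pos (h.trans this), one_mul]
    · rw [if_neg h, zero_mul]) u
  P_P' := fun {m n} u hmn => EvenSymbol.mult_mult (fun ξ => by
    rw [lowPass_apply, lowPass_apply]
    have : (m : ℝ) ≤ n := by exact_mod_cast hmn
    by_cases h : ‖ξ‖ ≤ m
    · rw [if_pos h, if_pos (h.trans this), one_mul]
    · rw [if_neg h, mul_zero]) u
  P_A := fun {m n} u hmn => EvenSymbol.mult_mult (fun ξ => by
    rw [lowPass_apply, swTrunc_apply, swTrunc_apply]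
    have : (m : ℝ) ≤ n := by exact_mod_cast hmn
    by_cases h : ‖ξ‖ ≤ m
    · rw [if_pos h, if_pos h, if_pos (h.trans this), one_mul]
    · rw [if_neg h, if_neg h, zero_mul]) u
  A_P := fun {m n} u hmn => EvenSymbol.mult_mult (fun ξ => by
    rw [lowPass_apply, swTrunc_apply, swTrunc_apply]
    have : (m : ℝ) ≤ n := by exact_mod_cast hmn
    by_cases h : ‖ξ‖ ≤ m
    · rw [if_pos h, if_pos h, if_pos (h.trans this), mul_one]
    · rw [if_neg h, if_neg h, mul_zero]) u
  tail := by
    refine ⟨fun m => 18 / (m + 1), ?_, fun m n u hmn => ?_⟩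
    · exact tendsto_const_nhds.div_atTop (tendsto_natCast_atTop_atTop.atTop_add tendsto_const_nhds)
    · have hmn' : (m : ℝ) ≤ n := by exact_mod_cast hmn
      refine le_trans ?_ (mul_le_mul_of_nonneg_left (norm_add_le u ((swTrunc k n).mult u))
        (by positivity))
      rw [← norm_hat, ← norm_hat (u + _)]
      refine Lp.norm_le_mul_norm_of_ae_le_mul ?_
      rw [hat_sub, hat_add]
      filter_upwards [(lowPass n).hat_mult u, (lowPass m).hat_mult u, (swTrunc k n).hat_mult u,
        Lp.coeFn_sub (hat ((lowPass n).mult u)) (hat ((lowPass m).mult u)),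
        Lp.coeFn_add (hat u) (hat ((swTrunc k n).mult u))] with ξ h1 h2 h3 h4 h5
      rw [h4, h5, Pi.sub_apply, Pi.add_apply, h1, h2, h3, ← sub_mul]
      have e : hat u ξ + (swTrunc k n ξ : ℂ) * hat u ξ = ((1 + swTrunc k n ξ : ℝ) : ℂ) * hat u ξ := by
        push_cast; ring
      rw [e, ← Complex.ofReal_sub, norm_mul, norm_mul, ← mul_assoc, Complex.norm_real,
        Complex.norm_real]
      refine mul_le_mul_of_nonneg_right ?_ (norm_nonneg _)
      rw [lowPass_apply, lowPass_apply, swTrunc_apply]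
      by_cases hm : ‖ξ‖ ≤ m
      · rw [if_pos hm, if_pos (hm.trans hmn'), sub_self, norm_zero]
        positivity
      · by_cases hn : ‖ξ‖ ≤ n
        · rw [if_neg hm, if_pos hn, if_pos hn, sub_zero, norm_one, Real.norm_of_nonneg (by positivity),
            div_mul_eq_mul_div, le_div_iff₀ (by positivity), one_mul]
          refine le_trans ?_ (sobWeight_sq_le hk ξ)
          have hw : (m : ℝ) + 1 ≤ sobWeight ξ := by
            rw [sobWeight]
            push Not at hm
            have h6 : (m : ℝ) ≤ m ^ 2 := by
              rcases Nat.eq_zero_or_pos m with h | h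
              · simp [h]
              · have : (1 : ℝ) ≤ m := by exact_mod_cast h
                nlinarith
            have h7 : (m : ℝ) ^ 2 ≤ ‖ξ‖ ^ 2 := by gcongr
            have h8 : ‖ξ‖ ^ 2 ≤ (2 * Real.pi * ‖ξ‖) ^ 2 := by
              have : ‖ξ‖ ≤ 2 * Real.pi * ‖ξ‖ := by nlinarith [norm_nonneg ξ, Real.pi_gt_three]
              gcongr
            linarith
          nlinarith [one_le_sobWeight ξ]
        · rw [if_neg hm, if_neg hn, sub_self, norm_zero]
          positivity

/-- Fatou's lemma for Fourier multipliers. -/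
theorem lintegral_le_of_tendsto_symbol {a : ℕ → EvenSymbol} {w : Plane → ℝ} {u : RL2} {B : ℝ}
    (ha : ∀ m ξ, 0 ≤ a m ξ) (hw : ∀ ξ, Tendsto (fun m => a m ξ) atTop (𝓝 (w ξ)))
    (hB : ∀ m, inner ℝ ((a m).mult u) u ≤ B) :
    ∫⁻ ξ, ENNReal.ofReal (w ξ) * ‖hat u ξ‖ₑ ^ 2 ≤ ENNReal.ofReal B := by
  have h1 : ∀ m, ∫⁻ ξ, ENNReal.ofReal (a m ξ) * ‖hat u ξ‖ₑ ^ 2 ≤ ENNReal.ofReal B := by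
    intro m
    refine le_trans (le_of_eq ?_) (ENNReal.ofReal_le_ofReal (hB m))
    rw [EvenSymbol.mult_inner_self, ofReal_integral_eq_lintegral_ofReal
      ((a m).integrable_mul_norm_sq u) (Eventually.of_forall fun ξ => mul_nonneg (ha m ξ) (by positivity))]
    refine lintegral_congr fun ξ => ?_
    rw [ENNReal.ofReal_mul (ha m ξ), ENNReal.ofReal_pow (norm_nonneg _), ofReal_norm]
  have h2 : ∀ ξ, ENNReal.ofReal (w ξ) * ‖hat u ξ‖ₑ ^ 2 =
      liminf (fun m => ENNReal.ofReal (a m ξ) * ‖hat u ξ‖ₑ ^ 2) atTop := fun ξ =>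
    ((ENNReal.Tendsto.mul_const ((ENNReal.continuous_ofReal.tendsto _).comp (hw ξ))
      (Or.inr (by simp))).liminf_eq).symm
  simp_rw [h2]
  refine (lintegral_liminf_le' fun m => ?_).trans ?_
  · exact (ENNReal.measurable_ofReal.comp (a m).measurable).aemeasurable.mul
      ((Lp.aestronglyMeasurable (hat u)).enorm.pow_const 2)
  · exact liminf_le_of_le (by isBoundedDefault) fun b hb => by
      obtain ⟨m, hm⟩ := hb.exists
      exact hm.trans (h1 m)

/-- The symbol `1 + a`. -/
def EvenSymbol.oneAdd (a : EvenSymbol) : EvenSymbol where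
  toFun := fun ξ => 1 + a ξ
  measurable := a.measurable.const_add 1
  even := fun ξ => by rw [a.even]
  bdd := by
    obtain ⟨C, hC⟩ := a.bdd
    exact ⟨1 + C, fun ξ => (abs_add_le _ _).trans (by rw [abs_one]; linarith [hC ξ])⟩

/-- The symbol `a²`. -/
def EvenSymbol.sq (a : EvenSymbol) : EvenSymbol where
  toFun := fun ξ => a ξ * a ξ
  measurable := a.measurable.mul a.measurable
  even := fun ξ => by rw [a.even]
  bdd := by
    obtain ⟨C, hC⟩ := a.bdd
    refine ⟨C * C, fun ξ => ?_⟩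
    rw [abs_mul]
    exact mul_le_mul (hC ξ) (hC ξ) (abs_nonneg _) ((abs_nonneg _).trans (hC ξ))

theorem EvenSymbol.mult_oneAdd (a : EvenSymbol) (u : RL2) : a.oneAdd.mult u = u + a.mult u := by
  refine hat_injective (Lp.ext ?_)
  rw [hat_add]
  filter_upwards [a.oneAdd.hat_mult u, a.hat_mult u, Lp.coeFn_add (hat u) (hat (a.mult u))]
    with ξ h1 h2 h3
  rw [h1, h3, Pi.add_apply, h2]
  change ((1 + a ξ : ℝ) : ℂ) * _ = _
  push_cast; ring

theorem EvenSymbol.mult_sq_inner (a : EvenSymbol) (u : RL2) :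
    inner ℝ (a.sq.mult u) u = ‖a.mult u‖ ^ 2 := by
  rw [← EvenSymbol.mult_mult (a := a) (b := a) (c := a.sq) (fun _ => rfl), mult_inner_comm,
    real_inner_self_eq_norm_sq]

theorem tendsto_swTrunc (k : ℝ) (ξ : Plane) :
    Tendsto (fun m => swTrunc k m ξ) atTop (𝓝 (swSymbol k ξ ^ 2)) := by
  refine tendsto_const_nhds.congr' ?_
  obtain ⟨N, hN⟩ := exists_nat_ge ‖ξ‖
  filter_upwards [eventually_ge_atTop N] with m hm
  rw [swTrunc_apply, if_pos (hN.trans (by exact_mod_cast hm))]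

theorem swTrunc_nonneg (k : ℝ) (m : ℕ) (ξ : Plane) : 0 ≤ swTrunc k m ξ := by
  rw [swTrunc_apply]; split_ifs <;> positivity

/-- The form bound controls the `H²` norm. -/
theorem lintegral_sobWeight_sq_le {k : ℝ} (hk : 1 / 2 ≤ k) {u : RL2} {B : ℝ}
    (hB : ∀ m, inner ℝ ((swTrunc k m).mult u) u ≤ B) :
    ∫⁻ ξ, ENNReal.ofReal (sobWeight ξ ^ 2) * ‖hat u ξ‖ₑ ^ 2 ≤ ENNReal.ofReal (18 * (‖u‖ ^ 2 + B)) := by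
  have h1 := lintegral_le_of_tendsto_symbol (a := fun m => (swTrunc k m).oneAdd)
    (w := fun ξ => 1 + swSymbol k ξ ^ 2) (u := u) (B := ‖u‖ ^ 2 + B)
    (fun m ξ => add_nonneg zero_le_one (swTrunc_nonneg k m ξ))
    (fun ξ => (tendsto_swTrunc k ξ).const_add 1)
    (fun m => by
      rw [EvenSymbol.mult_oneAdd, inner_add_left, real_inner_self_eq_norm_sq]
      linarith [hB m])
  rw [ENNReal.ofReal_mul (by norm_num)]
  refine le_trans ?_ (mul_le_mul_right h1 _)
  rw [← lintegral_const_mul' _ _ ENNReal.ofReal_ne_top]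
  refine lintegral_mono fun ξ => ?_
  rw [← mul_assoc, ← ENNReal.ofReal_mul (by norm_num)]
  gcongr
  exact sobWeight_sq_le hk ξ

/-- The graph norm controls the `H⁴` norm. -/
theorem lintegral_sobWeight_pow_four_le {k : ℝ} (hk : 1 / 2 ≤ k) {u : RL2} {B : ℝ}
    (hB : ∀ m, ‖(swTrunc k m).mult u‖ ≤ B) :
    ∫⁻ ξ, ENNReal.ofReal (sobWeight ξ ^ 4) * ‖hat u ξ‖ₑ ^ 2 ≤
      ENNReal.ofReal (18 ^ 2 * (‖u‖ + B) ^ 2) := by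
  have h1 := lintegral_le_of_tendsto_symbol (a := fun m => (swTrunc k m).oneAdd.sq)
    (w := fun ξ => (1 + swSymbol k ξ ^ 2) * (1 + swSymbol k ξ ^ 2)) (u := u) (B := (‖u‖ + B) ^ 2)
    (fun m ξ => mul_self_nonneg _)
    (fun ξ => ((tendsto_swTrunc k ξ).const_add 1).mul ((tendsto_swTrunc k ξ).const_add 1))
    (fun m => by
      rw [EvenSymbol.mult_sq_inner, EvenSymbol.mult_oneAdd]
      have := norm_add_le u ((swTrunc k m).mult u)
      have := hB m
      gcongr
      linarith)
  rw [ENNReal.ofReal_mul (by norm_num)]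
  refine le_trans ?_ (mul_le_mul_right h1 _)
  rw [← lintegral_const_mul' _ _ ENNReal.ofReal_ne_top]
  refine lintegral_mono fun ξ => ?_
  rw [← mul_assoc, ← ENNReal.ofReal_mul (by norm_num)]
  gcongr
  have := sobWeight_sq_le hk ξ
  calc sobWeight ξ ^ 4 = (sobWeight ξ ^ 2) ^ 2 := by ring
    _ ≤ (18 * (1 + swSymbol k ξ ^ 2)) ^ 2 := by gcongr
    _ = _ := by ring

theorem aemeasurable_hat (u : RL2) : AEMeasurable (fun ξ => ‖hat u ξ‖ₑ) volume :=
  (Lp.aestronglyMeasurable (hat u)).enorm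

/-- The `L²` norm of the reciprocal Sobolev weight, the constant in the Sobolev embedding. -/
def sobConst : ℝ≥0∞ := (∫⁻ ξ, ENNReal.ofReal ((sobWeight ξ)⁻¹) ^ (2 : ℝ)) ^ (1 / 2 : ℝ)

theorem sobConst_lt_top : sobConst < ∞ := by
  refine ENNReal.rpow_lt_top_of_nonneg (by norm_num) (ne_of_lt ?_)
  have h1 : Integrable (fun x : Plane => ((1 : ℝ) + ‖x‖ ^ 2) ^ (-(4 : ℝ) / 2)) :=
    integrable_rpow_neg_one_add_norm_sq (by simp; norm_num)
  refine lt_of_le_of_lt (lintegral_mono fun ξ => ?_) h1.lintegral_lt_top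
  rw [ENNReal.ofReal_rpow_of_nonneg (by have := one_le_sobWeight ξ; positivity) (by norm_num)]
  refine ENNReal.ofReal_le_ofReal ?_
  have h2 : (1 : ℝ) + ‖ξ‖ ^ 2 ≤ sobWeight ξ := by
    have : ‖ξ‖ ≤ 2 * Real.pi * ‖ξ‖ := by nlinarith [norm_nonneg ξ, Real.pi_gt_three]
    unfold sobWeight
    gcongr
  rw [Real.inv_rpow (by have := one_le_sobWeight ξ; positivity),
    show (-(4 : ℝ) / 2) = -2 by norm_num, Real.rpow_neg (by positivity)]
  gcongr

theorem lintegral_hat_le {u : RL2} {B : ℝ≥0∞}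
    (hB : ∫⁻ ξ, ENNReal.ofReal (sobWeight ξ ^ 2) * ‖hat u ξ‖ₑ ^ 2 ≤ B) :
    ∫⁻ ξ, ‖hat u ξ‖ₑ ≤ sobConst * B ^ (1 / 2 : ℝ) := by
  have h1 : ∀ ξ, ‖hat u ξ‖ₑ =
      ENNReal.ofReal ((sobWeight ξ)⁻¹) * (ENNReal.ofReal (sobWeight ξ) * ‖hat u ξ‖ₑ) := fun ξ => by
    have h0 := one_le_sobWeight ξ
    rw [← mul_assoc, ← ENNReal.ofReal_mul (by positivity), inv_mul_cancel₀ (by positivity),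
      ENNReal.ofReal_one, one_mul]
  rw [lintegral_congr h1]
  refine (ENNReal.lintegral_mul_le_Lp_mul_Lq volume Real.HolderConjugate.two_two ?_ ?_).trans ?_
  · have : Measurable fun ξ => (sobWeight ξ)⁻¹ := continuous_sobWeight.measurable.inv
    exact (ENNReal.measurable_ofReal.comp this).aemeasurable
  · exact (ENNReal.measurable_ofReal.comp continuous_sobWeight.measurable).aemeasurable.mul
      (aemeasurable_hat u)
  · refine mul_le_mul_right (ENNReal.rpow_le_rpow (le_trans (le_of_eq ?_) hB) (by norm_num)) _
    refine lintegral_congr fun ξ => ?_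
    have h0 := one_le_sobWeight ξ
    rw [ENNReal.mul_rpow_of_nonneg _ _ (by norm_num), ENNReal.ofReal_pow (by positivity)]
    norm_cast

/-- The `L²` inverse Fourier transform of an integrable function is given by the integral. -/
theorem fourierInv_ae_eq {g : CL2} (hg : Integrable g) :
    (𝓕⁻ g : CL2) =ᵐ[volume] 𝓕⁻ (g : Plane → ℂ) := by
  have hcont : Continuous (𝓕⁻ (g : Plane → ℂ)) := by
    have := (Real.Lp.fourierTransformInv (memLp_one_iff_integrable.2 hg).toLp).continuous
    rwa [Real.Lp.fourierTransformInv_toLp] at this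
  refine ae_eq_of_integral_contDiff_smul_eq ((Lp.memLp (𝓕⁻ g : CL2)).locallyIntegrable (by norm_num))
    hcont.locallyIntegrable fun h hh hc => ?_
  have hg₁ : HasCompactSupport (Complex.ofRealCLM ∘ h) := hc.comp_left rfl
  have hg₂ : ContDiff ℝ (⊤ : ℕ∞) (Complex.ofRealCLM ∘ h) := Complex.ofRealCLM.contDiff.comp hh
  set H : 𝓢(Plane, ℂ) := hg₁.toSchwartzMap hg₂ with hH
  have e1 : ∀ x, H x = (h x : ℂ) := fun x => rfl
  have e2 : ∫ x, H x • (𝓕⁻ g : CL2) x = ∫ x, (𝓕⁻ H) x • g x := by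
    have := congrArg (fun F => F H) (Lp.fourierInv_toTemperedDistribution_eq g)
    simp only [TemperedDistribution.fourierInv_apply, Lp.toTemperedDistribution_apply] at this
    exact this.symm
  have e3 : ∫ x, (𝓕⁻ H) x • g x = ∫ x, H x • 𝓕⁻ (g : Plane → ℂ) x := by
    have := VectorFourier.integral_fourierIntegral_smul_eq_flip (L := -innerₗ Plane)
      (μ := volume) (ν := volume) (e := Real.fourierChar)
      Real.continuous_fourierChar (f := H) (g := g)
      (by
        have : Continuous fun p : Plane × Plane => -(inner ℝ p.1 p.2 : ℝ) := by fun_prop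
        exact this) H.integrable hg
    have hflip : (-innerₗ Plane).flip = -innerₗ Plane := by
      ext x y; simp [real_inner_comm]
    rw [hflip] at this
    rw [SchwartzMap.fourierInv_coe]
    exact this
  calc ∫ x, h x • (𝓕⁻ g : CL2) x = ∫ x, H x • (𝓕⁻ g : CL2) x := by
        congr 1
    _ = ∫ x, H x • 𝓕⁻ (g : Plane → ℂ) x := e2.trans e3
    _ = _ := by congr 1

/-- The Sobolev embedding `H² ⊂ L^∞` in the plane. -/
theorem ae_enorm_le_of_lintegral_le {u : RL2} {B : ℝ≥0∞} (hBtop : B < ∞)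
    (hB : ∫⁻ ξ, ENNReal.ofReal (sobWeight ξ ^ 2) * ‖hat u ξ‖ₑ ^ 2 ≤ B) :
    ∀ᵐ p, ‖u p‖ₑ ≤ sobConst * B ^ (1 / 2 : ℝ) := by
  have h1 := lintegral_hat_le hB
  have hint : Integrable (hat u) := ⟨Lp.aestronglyMeasurable _, h1.trans_lt
    (ENNReal.mul_lt_top sobConst_lt_top (ENNReal.rpow_lt_top_of_nonneg (by norm_num) hBtop.ne))⟩
  have h2 := fourierInv_ae_eq hint
  have h3 : (𝓕⁻ (hat u) : CL2) = complexify u := FourierTransform.fourierInv_fourier_eq _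
  rw [h3] at h2
  filter_upwards [h2, coeFn_complexify u] with p h4 h5
  have h6 : ‖u p‖ₑ = ‖𝓕⁻ (hat u : Plane → ℂ) p‖ₑ := by
    rw [← h4, h5, ← ofReal_norm, ← ofReal_norm, Complex.norm_real]
  rw [h6]
  refine le_trans ?_ h1
  rw [Real.fourierInv_eq]
  refine (enorm_integral_le_lintegral_enorm _).trans (le_of_eq (lintegral_congr fun ξ => ?_))
  rw [← ofReal_norm, Circle.norm_smul, ofReal_norm]

/-- The Sobolev embedding, in terms of the form of the Swift-Hohenberg operator. -/
theorem ae_abs_le_of_form_le {k : ℝ} (hk : 1 / 2 ≤ k) {u : RL2} {B : ℝ}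
    (hB : ∀ m, inner ℝ ((swTrunc k m).mult u) u ≤ B) :
    ∀ᵐ p, |u p| ≤ sobConst.toReal * √(18 * (‖u‖ ^ 2 + B)) := by
  have hB0 : 0 ≤ B := (EvenSymbol.mult_inner_self_nonneg (swTrunc_nonneg k 0) u).trans (hB 0)
  filter_upwards [ae_enorm_le_of_lintegral_le ENNReal.ofReal_lt_top
    (lintegral_sobWeight_sq_le hk hB)] with p hp
  have h1 := ENNReal.toReal_mono (ENNReal.mul_ne_top sobConst_lt_top.ne
    (ENNReal.rpow_ne_top_of_nonneg (by norm_num) ENNReal.ofReal_ne_top)) hp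
  rw [ENNReal.toReal_mul, toReal_enorm, Real.norm_eq_abs, ← ENNReal.toReal_rpow,
    ENNReal.toReal_ofReal (by positivity)] at h1
  rwa [Real.sqrt_eq_rpow]

theorem sobolevENorm_eq (k : ℕ) (u : RL2) {f : Plane → ℝ} (hf : f =ᵐ[volume] u) :
    sobolevENorm k f =
      (∫⁻ ξ, ENNReal.ofReal (sobWeight ξ ^ k) * ‖hat u ξ‖ₑ ^ 2) ^ (1 / 2 : ℝ) := by
  have hu : complexify u =ᵐ[volume] fun p => (f p : ℂ) := by
    filter_upwards [coeFn_complexify u, hf] with p h1 h2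
    rw [h1, h2]
  refine le_antisymm ?_ ?_
  · exact iInf₂_le (complexify u) hu
  · refine le_iInf₂ fun F hF => ?_
    have : F = complexify u := Lp.ext (hF.trans hu.symm)
    rw [this]
    rfl

/-- Interpolation of `H²` between `L²` and `H⁴`. -/
theorem lintegral_sobWeight_sq_interpolation (u : RL2) :
    ∫⁻ ξ, ENNReal.ofReal (sobWeight ξ ^ 2) * ‖hat u ξ‖ₑ ^ 2 ≤
      ENNReal.ofReal ‖u‖ *
        (∫⁻ ξ, ENNReal.ofReal (sobWeight ξ ^ 4) * ‖hat u ξ‖ₑ ^ 2) ^ (1 / 2 : ℝ) := by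
  have h1 : ∀ ξ, ENNReal.ofReal (sobWeight ξ ^ 2) * ‖hat u ξ‖ₑ ^ 2 =
      ‖hat u ξ‖ₑ * (ENNReal.ofReal (sobWeight ξ ^ 2) * ‖hat u ξ‖ₑ) := fun ξ => by ring
  simp_rw [h1]
  refine (ENNReal.lintegral_mul_le_Lp_mul_Lq volume Real.HolderConjugate.two_two
    (aemeasurable_hat u) ?_).trans ?_
  · exact (ENNReal.measurable_ofReal.comp
      (continuous_sobWeight.pow 2).measurable).aemeasurable.mul (aemeasurable_hat u)
  · refine mul_le_mul' (le_of_eq ?_) (le_of_eq ?_)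
    · rw [← norm_hat, ofReal_norm, Lp.enorm_def,
        eLpNorm_eq_lintegral_rpow_enorm_toReal two_ne_zero ENNReal.ofNat_ne_top]
      simp
    · congr 1
      refine lintegral_congr fun ξ => ?_
      have h0 := one_le_sobWeight ξ
      rw [ENNReal.mul_rpow_of_nonneg _ _ (by norm_num), ENNReal.ofReal_rpow_of_nonneg
        (by positivity) (by norm_num)]
      norm_cast
      rw [← pow_mul]

end GSH

namespace GSH

/-- A continuous, uniformly Lipschitz family of scalar nonlinearities vanishing at `0`. -/
structure IsNemytskii (g : Plane → ℝ → ℝ) (L : NNReal) : Prop where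
  continuous : Continuous (Function.uncurry g)
  lip : ∀ p, LipschitzWith L (g p)
  zero : ∀ p, g p 0 = 0

namespace IsNemytskii

variable {g : Plane → ℝ → ℝ} {L : NNReal}

theorem abs_sub_le (hg : IsNemytskii g L) (p : Plane) (x y : ℝ) : |g p x - g p y| ≤ L * |x - y| := by
  simpa [Real.dist_eq] using (hg.lip p).dist_le_mul x y

theorem abs_le (hg : IsNemytskii g L) (p : Plane) (x : ℝ) : |g p x| ≤ L * |x| := by
  simpa [hg.zero] using hg.abs_sub_le p x 0

theorem continuous_apply (hg : IsNemytskii g L) (p : Plane) : Continuous (g p) :=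
  (hg.lip p).continuous

theorem aestronglyMeasurable (hg : IsNemytskii g L) (u : RL2) :
    AEStronglyMeasurable (fun p => g p (u p)) volume :=
  hg.continuous.comp_aestronglyMeasurable
    (continuous_id.aestronglyMeasurable.prodMk (Lp.aestronglyMeasurable u))

theorem memLp (hg : IsNemytskii g L) (u : RL2) : MemLp (fun p => g p (u p)) 2 volume :=
  MemLp.of_le_mul (Lp.memLp u) (hg.aestronglyMeasurable u)
    (Eventually.of_forall fun p => hg.abs_le p _)

/-- The superposition operator `u ↦ g(·, u)` on `L²`. -/
def op (hg : IsNemytskii g L) (u : RL2) : RL2 := (hg.memLp u).toLp _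

theorem coeFn_op (hg : IsNemytskii g L) (u : RL2) : hg.op u =ᵐ[volume] fun p => g p (u p) :=
  (hg.memLp u).coeFn_toLp

theorem lipschitz_op (hg : IsNemytskii g L) : LipschitzWith L hg.op := by
  refine LipschitzWith.of_dist_le_mul fun u v => ?_
  rw [dist_eq_norm, dist_eq_norm]
  refine Lp.norm_le_mul_norm_of_ae_le_mul ?_
  filter_upwards [hg.coeFn_op u, hg.coeFn_op v, Lp.coeFn_sub (hg.op u) (hg.op v), Lp.coeFn_sub u v]
    with p h1 h2 h3 h4
  rw [h3, h4, Pi.sub_apply, Pi.sub_apply, h1, h2]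
  exact hg.abs_sub_le p _ _

theorem op_zero (hg : IsNemytskii g L) : hg.op 0 = 0 := by
  refine Lp.ext ?_
  filter_upwards [hg.coeFn_op 0, Lp.coeFn_zero ℝ 2 (volume : Measure Plane)] with p h1 h2
  rw [h1, h2, Pi.zero_apply, hg.zero]

theorem isOneSidedLipschitz (hg : IsNemytskii g L) {K : ℝ} (hK : 1 ≤ K)
    (h : ∀ p x y, (g p x - g p y) * (x - y) ≤ K * (x - y) ^ 2) : IsOneSidedLipschitz hg.op K where
  lip := ⟨L, hg.lipschitz_op⟩
  zero := hg.op_zero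
  one_le := hK
  inner_le := fun u v => by
    rw [← real_inner_self_eq_norm_sq, L2.inner_def, L2.inner_def, ← integral_const_mul]
    refine integral_mono_ae (L2.integrable_inner _ _) ((L2.integrable_inner _ _).const_mul _) ?_
    filter_upwards [hg.coeFn_op u, hg.coeFn_op v, Lp.coeFn_sub (hg.op u) (hg.op v),
      Lp.coeFn_sub u v] with p h1 h2 h3 h4
    simp only [h3, h4, Pi.sub_apply, h1, h2, RCLike.inner_apply, conj_trivial]
    have := h p (u p) (v p)
    nlinarith

/-- The primitive of `g p`. -/
def prim (_ : IsNemytskii g L) (p : Plane) (w : ℝ) : ℝ := ∫ t in 0..w, g p t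

theorem prim_eq (hg : IsNemytskii g L) (p : Plane) (w : ℝ) :
    hg.prim p w = w * ∫ t in (0 : ℝ)..1, g p (t * w) := by
  rw [intervalIntegral.mul_integral_comp_mul_right, zero_mul, one_mul, prim]

theorem prim_sub (hg : IsNemytskii g L) (p : Plane) (x y : ℝ) :
    hg.prim p x - hg.prim p y = (x - y) * ∫ t in (0 : ℝ)..1, g p (t * (x - y) + y) := by
  have hc := hg.continuous_apply p
  have h1 : hg.prim p x - hg.prim p y = ∫ t in y..x, g p t :=
    intervalIntegral.integral_interval_sub_left (hc.intervalIntegrable _ _)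
      (hc.intervalIntegrable _ _)
  simp_rw [mul_comm _ (x - y)]
  rw [h1, intervalIntegral.mul_integral_comp_mul_add, mul_zero, mul_one, zero_add, sub_add_cancel]

theorem abs_prim_sub_le (hg : IsNemytskii g L) (p : Plane) (x y : ℝ) :
    |hg.prim p x - hg.prim p y - g p y * (x - y)| ≤ L * (x - y) ^ 2 := by
  have hc := hg.continuous_apply p
  have h1 : hg.prim p x - hg.prim p y - g p y * (x - y) =
      (x - y) * ∫ t in (0 : ℝ)..1, (g p (t * (x - y) + y) - g p y) := by
    rw [hg.prim_sub, intervalIntegral.integral_sub]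
    · simp; ring
    · exact Continuous.intervalIntegrable (by fun_prop) _ _
    · exact continuous_const.intervalIntegrable _ _
  have h2 : ‖∫ t in (0 : ℝ)..1, (g p (t * (x - y) + y) - g p y)‖ ≤ L * |x - y| * |1 - 0| := by
    refine intervalIntegral.norm_integral_le_of_norm_le_const fun t ht => ?_
    rw [uIoc_of_le zero_le_one] at ht
    refine (hg.abs_sub_le p _ _).trans ?_
    rw [add_sub_cancel_right, abs_mul, abs_of_pos ht.1]
    have := abs_nonneg (x - y)
    have : t * |x - y| ≤ |x - y| := mul_le_of_le_one_left this ht.2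
    gcongr
  rw [h1, abs_mul, ← sq_abs]
  rw [Real.norm_eq_abs, sub_zero, abs_one, mul_one] at h2
  have := mul_le_mul_of_nonneg_left h2 (abs_nonneg (x - y))
  linarith

theorem prim_zero (hg : IsNemytskii g L) (p : Plane) : hg.prim p 0 = 0 := by simp [prim]

theorem continuous_prim (hg : IsNemytskii g L) : Continuous (Function.uncurry hg.prim) := by
  have h : Function.uncurry hg.prim = fun q : Plane × ℝ => q.2 * ∫ t in (0 : ℝ)..1, g q.1 (t * q.2) :=
    funext fun q => hg.prim_eq q.1 q.2
  rw [h]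
  refine continuous_snd.mul ?_
  have hc := hg.continuous
  exact intervalIntegral.continuous_parametric_intervalIntegral_of_continuous'
    (f := fun (q : Plane × ℝ) t => g q.1 (t * q.2)) (by
      have : Continuous fun x : (Plane × ℝ) × ℝ => Function.uncurry g (x.1.1, x.2 * x.1.2) := by
        fun_prop
      exact this) 0 1

theorem integrable_prim (hg : IsNemytskii g L) (u : RL2) : Integrable fun p => hg.prim p (u p) := by
  have h1 : AEStronglyMeasurable (fun p => hg.prim p (u p)) volume :=
    hg.continuous_prim.comp_aestronglyMeasurable
      (continuous_id.aestronglyMeasurable.prodMk (Lp.aestronglyMeasurable u))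
  refine Integrable.mono' (((Lp.memLp u).integrable_sq).const_mul L) h1
    (Eventually.of_forall fun p => ?_)
  simpa [hg.zero, hg.prim_zero] using hg.abs_prim_sub_le p (u p) 0

/-- The potential of the superposition operator. -/
def potential (hg : IsNemytskii g L) (u : RL2) : ℝ := ∫ p, hg.prim p (u p)

theorem inner_op (hg : IsNemytskii g L) (u v : RL2) :
    inner ℝ (hg.op u) v = ∫ p, g p (u p) * v p := by
  rw [L2.inner_def]
  refine integral_congr_ae ?_
  filter_upwards [hg.coeFn_op u] with p h
  simp [h, mul_comm]

theorem integrable_op_mul (hg : IsNemytskii g L) (u v : RL2) :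
    Integrable fun p => g p (u p) * v p := by
  refine (L2.integrable_inner (𝕜 := ℝ) (hg.op u) v).congr ?_
  filter_upwards [hg.coeFn_op u] with p h
  simp [h, mul_comm]

theorem norm_sq_eq_integral (u : RL2) : ‖u‖ ^ 2 = ∫ p, u p ^ 2 := by
  rw [← real_inner_self_eq_norm_sq, L2.inner_def]
  congr 1; ext p
  simp [sq]

theorem hasGradientAt_potential (hg : IsNemytskii g L) (u : RL2) :
    HasGradientAt hg.potential (hg.op u) u := by
  have key : ∀ v, |hg.potential v - hg.potential u - inner ℝ (hg.op u) (v - u)| ≤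
      L * ‖v - u‖ ^ 2 := by
    intro v
    have e : hg.potential v - hg.potential u - inner ℝ (hg.op u) (v - u) =
        ∫ p, (hg.prim p (v p) - hg.prim p (u p) - g p (u p) * (v - u) p) := by
      have e1 := integral_sub (hg.integrable_prim v) (hg.integrable_prim u)
      have e2 := integral_sub ((hg.integrable_prim v).sub (hg.integrable_prim u))
        (hg.integrable_op_mul u (v - u))
      simp only [Pi.sub_apply] at e2
      rw [hg.inner_op, potential, potential, e2, e1]
    rw [e, norm_sq_eq_integral, ← integral_const_mul, ← Real.norm_eq_abs]
    refine norm_integral_le_of_norm_le (((Lp.memLp (v - u)).integrable_sq).const_mul L) ?_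
    filter_upwards [Lp.coeFn_sub v u] with p h
    rw [h, Pi.sub_apply]
    exact hg.abs_prim_sub_le p _ _
  rw [hasGradientAt_iff_isLittleO, isLittleO_iff]
  intro c hc
  have hnear : ∀ᶠ v in 𝓝 u, (L : ℝ) * ‖v - u‖ < c := by
    have : Tendsto (fun v : RL2 => (L : ℝ) * ‖v - u‖) (𝓝 u) (𝓝 (L * ‖u - u‖)) :=
      (continuous_const.mul (continuous_id.sub continuous_const).norm).tendsto u
    rw [sub_self, norm_zero, mul_zero] at this
    exact this.eventually (gt_mem_nhds hc)
  filter_upwards [hnear] with v hv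
  refine (key v).trans ?_
  have := norm_nonneg (v - u)
  nlinarith

theorem potential_le (hg : IsNemytskii g L) {K : ℝ} (h : ∀ p x, g p x * x ≤ K * x ^ 2) (u : RL2) :
    hg.potential u ≤ K / 2 * ‖u‖ ^ 2 := by
  rw [norm_sq_eq_integral, ← integral_const_mul]
  refine integral_mono (hg.integrable_prim u) (((Lp.memLp u).integrable_sq).const_mul _) fun p => ?_
  simp only
  set w := u p
  have hc := hg.continuous_apply p
  rw [hg.prim_eq, ← intervalIntegral.integral_const_mul]
  have h1 : ∫ t in (0 : ℝ)..1, w * g p (t * w) ≤ ∫ t in (0 : ℝ)..1, K * w ^ 2 * t := by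
    refine intervalIntegral.integral_mono_on zero_le_one
      (Continuous.intervalIntegrable (by fun_prop) _ _)
      (Continuous.intervalIntegrable (by fun_prop) _ _) fun t ht => ?_
    rcases ht.1.eq_or_lt with h0 | h0
    · rw [← h0]; simp [hg.zero]
    · have := h p (t * w)
      refine le_of_mul_le_mul_left ?_ h0
      nlinarith
  refine h1.trans (le_of_eq ?_)
  rw [intervalIntegral.integral_const_mul, integral_id]
  ring

end IsNemytskii

/-- Truncation of `w` to `[-R, R]`. -/
def clamp (R w : ℝ) : ℝ := max (-R) (min R w)

theorem continuous_clamp (R : ℝ) : Continuous (clamp R) := by unfold clamp; fun_prop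

theorem clamp_eq {R w : ℝ} (h : |w| ≤ R) : clamp R w = w := by
  rw [abs_le] at h
  rw [clamp, min_eq_right h.2, max_eq_right h.1]

theorem abs_clamp_le {R : ℝ} (hR : 0 ≤ R) (w : ℝ) : |clamp R w| ≤ R := by
  unfold clamp
  exact abs_le.2 ⟨le_max_left _ _, max_le (by linarith) (min_le_left _ _)⟩

theorem clamp_sub_mul (R x y : ℝ) :
    0 ≤ (clamp R x - clamp R y) * (x - y) ∧
      (clamp R x - clamp R y) * (x - y) ≤ (x - y) ^ 2 ∧ |clamp R x - clamp R y| ≤ |x - y| := by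
  have mono : ∀ {x y : ℝ}, y ≤ x → 0 ≤ clamp R x - clamp R y ∧ clamp R x - clamp R y ≤ x - y := by
    intro x y h
    unfold clamp
    rcases max_cases (-R) (min R x) with h1 | h1 <;> rcases max_cases (-R) (min R y) with h2 | h2 <;>
      rcases min_cases R x with h3 | h3 <;> rcases min_cases R y with h4 | h4 <;>
      constructor <;> linarith
  rcases le_total y x with h | h
  · obtain ⟨h1, h2⟩ := mono h
    refine ⟨mul_nonneg h1 (by linarith), by nlinarith, ?_⟩
    rw [abs_of_nonneg h1, abs_of_nonneg (by linarith)]; exact h2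
  · obtain ⟨h1, h2⟩ := mono h
    refine ⟨by nlinarith, by nlinarith, ?_⟩
    rw [abs_sub_comm, abs_sub_comm x, abs_of_nonneg h1, abs_of_nonneg (by linarith)]; exact h2

/-- The one-sided Lipschitz constant of the reaction term. -/
def reactionConst (b s ε : ℝ) : ℝ := 1 + ε ^ 2 + b ^ 2 / (3 * s)

theorem one_le_reactionConst {b s ε : ℝ} (hs : 0 < s) : 1 ≤ reactionConst b s ε := by
  unfold reactionConst
  have : 0 ≤ b ^ 2 / (3 * s) := by positivity
  nlinarith [sq_nonneg ε]

/-- The difference quotient of the reaction term. -/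
theorem reaction_sub (b s ε x y : ℝ) : reaction b s ε x - reaction b s ε y =
    (ε ^ 2 + b * (x + y) - s * (x ^ 2 + x * y + y ^ 2)) * (x - y) := by
  unfold reaction; ring

theorem reaction_quotient_le {b s : ℝ} (ε : ℝ) (hs : 0 < s) (x y : ℝ) :
    ε ^ 2 + b * (x + y) - s * (x ^ 2 + x * y + y ^ 2) ≤ reactionConst b s ε := by
  unfold reactionConst
  have h1 : b * (x + y) ≤ b ^ 2 / (3 * s) + 3 / 4 * s * (x + y) ^ 2 := by
    have : b ^ 2 / (3 * s) + 3 / 4 * s * (x + y) ^ 2 - b * (x + y) =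
        (b - 3 / 2 * s * (x + y)) ^ 2 / (3 * s) := by
      field_simp; ring
    have : 0 ≤ (b - 3 / 2 * s * (x + y)) ^ 2 / (3 * s) := by positivity
    linarith
  nlinarith [mul_nonneg hs.le (sq_nonneg (x - y))]

/-- The truncated nonlinearity `r(U + w) - r(U)`. -/
def truncReaction (b s ε R : ℝ) (U : Plane → ℝ) (p : Plane) (w : ℝ) : ℝ :=
  reaction b s ε (U p + clamp R w) - reaction b s ε (U p)

theorem truncReaction_mul_le {b s : ℝ} (ε R : ℝ) (hs : 0 < s) (U : Plane → ℝ) (p : Plane) (x y : ℝ) :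
    (truncReaction b s ε R U p x - truncReaction b s ε R U p y) * (x - y) ≤
      reactionConst b s ε * (x - y) ^ 2 := by
  have e : truncReaction b s ε R U p x - truncReaction b s ε R U p y =
      reaction b s ε (U p + clamp R x) - reaction b s ε (U p + clamp R y) := by
    unfold truncReaction; ring
  obtain ⟨h1, h2, -⟩ := clamp_sub_mul R x y
  have h3 := reaction_quotient_le (b := b) ε hs (U p + clamp R x) (U p + clamp R y)
  have h4 := one_le_reactionConst (b := b) (ε := ε) hs
  rw [e, reaction_sub, add_sub_add_left_eq_sub, mul_assoc]
  refine (mul_le_mul_of_nonneg_right h3 h1).trans ?_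
  gcongr

theorem isNemytskii_truncReaction (b s ε : ℝ) {R : ℝ} (hR : 0 ≤ R) {U : Plane → ℝ}
    (hU : Continuous U) {U₀ : ℝ} (hU₀ : ∀ p, |U p| ≤ U₀) :
    ∃ L, IsNemytskii (truncReaction b s ε R U) L := by
  have hU0 : 0 ≤ U₀ := (abs_nonneg _).trans (hU₀ 0)
  set L : ℝ := ε ^ 2 + |b| * (2 * (U₀ + R)) + |s| * (3 * (U₀ + R) ^ 2) with hL
  have hLnn : 0 ≤ L := by positivity
  refine ⟨⟨L, hLnn⟩, ?_, fun p => LipschitzWith.of_dist_le_mul fun x y => ?_, fun p => ?_⟩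
  · have := continuous_clamp R
    unfold truncReaction reaction Function.uncurry
    fun_prop
  · have e : truncReaction b s ε R U p x - truncReaction b s ε R U p y =
        reaction b s ε (U p + clamp R x) - reaction b s ε (U p + clamp R y) := by
      unfold truncReaction; ring
    rw [Real.dist_eq, Real.dist_eq, e, reaction_sub, add_sub_add_left_eq_sub, abs_mul]
    refine mul_le_mul ?_ (clamp_sub_mul R x y).2.2 (abs_nonneg _) hLnn
    have hx : |U p + clamp R x| ≤ U₀ + R :=
      (abs_add_le _ _).trans (add_le_add (hU₀ p) (abs_clamp_le hR x))
    have hy : |U p + clamp R y| ≤ U₀ + R :=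
      (abs_add_le _ _).trans (add_le_add (hU₀ p) (abs_clamp_le hR y))
    generalize U p + clamp R x = X at hx
    generalize U p + clamp R y = Y at hy
    have h1 : |b * (X + Y)| ≤ |b| * (2 * (U₀ + R)) := by
      rw [abs_mul]
      have := abs_add_le X Y
      gcongr
      linarith
    have h2 : |s * (X ^ 2 + X * Y + Y ^ 2)| ≤ |s| * (3 * (U₀ + R) ^ 2) := by
      rw [abs_mul]
      have hx2 : |X ^ 2| ≤ (U₀ + R) ^ 2 := by rw [abs_pow]; gcongr
      have hy2 : |Y ^ 2| ≤ (U₀ + R) ^ 2 := by rw [abs_pow]; gcongr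
      have hxy : |X * Y| ≤ (U₀ + R) ^ 2 := by
        rw [abs_mul, sq]; gcongr
      have := abs_add_three (X ^ 2) (X * Y) (Y ^ 2)
      gcongr
      linarith
    change |ε ^ 2 + b * (X + Y) - s * (X ^ 2 + X * Y + Y ^ 2)| ≤ L
    have h3 := abs_sub (ε ^ 2 + b * (X + Y)) (s * (X ^ 2 + X * Y + Y ^ 2))
    have h4 := abs_add_le (ε ^ 2) (b * (X + Y))
    have h5 : |ε ^ 2| = ε ^ 2 := abs_of_nonneg (sq_nonneg _)
    linarith
  · have : clamp R 0 = 0 := clamp_eq (by simpa using hR)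
    simp [truncReaction, this]

/-- The linearization `r'` of the reaction term. -/
def reactionDeriv (b s ε y : ℝ) : ℝ := ε ^ 2 + 2 * b * y - 3 * s * y ^ 2

theorem truncReaction_eq {b s ε R : ℝ} {U : Plane → ℝ} {p : Plane} {w : ℝ} (hw : |w| ≤ R) :
    truncReaction b s ε R U p w =
      reactionDeriv b s ε (U p) * w + (b - 3 * s * U p) * w ^ 2 - s * w ^ 3 := by
  rw [truncReaction, clamp_eq hw]
  unfold reaction reactionDeriv; ring

theorem prim_truncReaction_eq {b s ε R : ℝ} {U : Plane → ℝ} {L : NNReal}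
    (hg : IsNemytskii (truncReaction b s ε R U) L) {p : Plane} {w : ℝ} (hw : |w| ≤ R) :
    hg.prim p w = reactionDeriv b s ε (U p) * w ^ 2 / 2 + (b - 3 * s * U p) * w ^ 3 / 3
      - s * w ^ 4 / 4 := by
  have h : hg.prim p w = ∫ t in (0 : ℝ)..w,
      (reactionDeriv b s ε (U p) * t + (b - 3 * s * U p) * t ^ 2 - s * t ^ 3) := by
    refine intervalIntegral.integral_congr fun t ht => truncReaction_eq ?_
    refine le_trans ?_ hw
    rcases le_total 0 w with h0 | h0
    · rw [uIcc_of_le h0] at ht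
      rw [abs_of_nonneg ht.1, abs_of_nonneg h0]; exact ht.2
    · rw [uIcc_of_ge h0] at ht
      rw [abs_of_nonpos ht.2, abs_of_nonpos h0]; linarith [ht.1]
  rw [h, intervalIntegral.integral_sub, intervalIntegral.integral_add,
    intervalIntegral.integral_const_mul, intervalIntegral.integral_const_mul,
    intervalIntegral.integral_const_mul, integral_id, integral_pow, integral_pow]
  · norm_num; ring
  all_goals exact Continuous.intervalIntegrable (by fun_prop) _ _

/-- Size of the terms of higher order of the reaction term. -/
def cubicConst (b s U₀ : ℝ) : ℝ := |b| + 3 * |s| * U₀ + |s|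

theorem abs_truncReaction_mul_sub_le {b s ε R U₀ : ℝ} {U : Plane → ℝ} {L : NNReal}
    (hU₀ : ∀ p, |U p| ≤ U₀) (hg : IsNemytskii (truncReaction b s ε R U) L) {p : Plane} {w : ℝ}
    (hw : |w| ≤ R) (hw1 : |w| ≤ 1) :
    |truncReaction b s ε R U p w * w - 2 * hg.prim p w| ≤ cubicConst b s U₀ * |w| ^ 3 ∧
    |2 * hg.prim p w - reactionDeriv b s ε (U p) * w ^ 2| ≤ cubicConst b s U₀ * |w| ^ 3 := by
  have hd : |b - 3 * s * U p| ≤ |b| + 3 * |s| * U₀ := by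
    have h1 := abs_sub b (3 * s * U p)
    have h2 : |3 * s * U p| = 3 * |s| * |U p| := by
      rw [abs_mul, abs_mul, abs_of_pos (by norm_num : (0 : ℝ) < 3)]
    have h3 : 3 * |s| * |U p| ≤ 3 * |s| * U₀ := by have := hU₀ p; gcongr
    linarith
  have h4 : |w| ^ 4 ≤ |w| ^ 3 := pow_le_pow_of_le_one (abs_nonneg _) hw1 (by norm_num)
  have aux : ∀ α β : ℝ, |α| ≤ 1 → |β| ≤ 1 →
      |α * ((b - 3 * s * U p) * w ^ 3) + β * (s * w ^ 4)| ≤ cubicConst b s U₀ * |w| ^ 3 := by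
    intro α β hα hβ
    refine (abs_add_le _ _).trans ?_
    rw [abs_mul α, abs_mul β, abs_mul (b - 3 * s * U p), abs_mul s, abs_pow, abs_pow]
    have e1 : |α| * (|b - 3 * s * U p| * |w| ^ 3) ≤ 1 * ((|b| + 3 * |s| * U₀) * |w| ^ 3) := by gcongr
    have e2 : |β| * (|s| * |w| ^ 4) ≤ 1 * (|s| * |w| ^ 3) := by gcongr
    unfold cubicConst
    linarith
  rw [truncReaction_eq hw, prim_truncReaction_eq hg hw]
  constructor
  · convert aux (1 / 3) (-(1 / 2)) (by norm_num [abs_le]) (by norm_num [abs_le]) using 2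
    ring
  · convert aux (2 / 3) (-(1 / 2)) (by norm_num [abs_le]) (by norm_num [abs_le]) using 2
    ring

end GSH

namespace GSH

open SchwartzMap LineDeriv

/-- Smooth, compactly supported functions on the plane. -/
structure IsTest (φ : Plane → ℝ) : Prop where
  smooth : ContDiff ℝ (⊤ : ℕ∞) φ
  compact : HasCompactSupport φ

namespace IsTest

variable {φ : Plane → ℝ}

theorem partialDeriv (hφ : IsTest φ) (i : Fin 2) : IsTest (GSH.partialDeriv i φ) where
  smooth := (hφ.smooth.fderiv_right (m := (⊤ : ℕ∞)) (by norm_cast)).clm_apply contDiff_const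
  compact := hφ.compact.fderiv_apply (𝕜 := ℝ) _

theorem opA (hφ : IsTest φ) (ε ω : ℝ) : IsTest (GSH.opA ε ω φ) where
  smooth := (hφ.smooth.add (contDiff_const.mul ((hφ.partialDeriv 0).partialDeriv 0).smooth)).add
    ((hφ.partialDeriv 1).partialDeriv 1).smooth
  compact := (hφ.compact.add (((hφ.partialDeriv 0).partialDeriv 0).compact.mul_left)).add
    ((hφ.partialDeriv 1).partialDeriv 1).compact

theorem memLp (hφ : IsTest φ) : MemLp φ 2 volume :=
  hφ.smooth.continuous.memLp_of_hasCompactSupport hφ.compact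

/-- The class of a test function in `L²`. -/
def toL2 (hφ : IsTest φ) : RL2 := hφ.memLp.toLp φ

theorem coeFn_toL2 (hφ : IsTest φ) : hφ.toL2 =ᵐ[volume] φ := hφ.memLp.coeFn_toLp

/-- A test function as a complex Schwartz function. -/
def schwartz (hφ : IsTest φ) : 𝓢(Plane, ℂ) :=
  HasCompactSupport.toSchwartzMap (f := Complex.ofRealCLM ∘ φ) (hφ.compact.comp_left rfl)
    (Complex.ofRealCLM.contDiff.comp hφ.smooth)

theorem schwartz_apply (hφ : IsTest φ) (p : Plane) : hφ.schwartz p = (φ p : ℂ) := rfl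

theorem hat_toL2 (hφ : IsTest φ) : hat hφ.toL2 =ᵐ[volume] ⇑(𝓕 hφ.schwartz : 𝓢(Plane, ℂ)) := by
  have h : complexify hφ.toL2 = hφ.schwartz.toLp 2 volume := by
    refine Lp.ext ?_
    filter_upwards [coeFn_complexify hφ.toL2, hφ.coeFn_toL2, hφ.schwartz.coeFn_toLp 2 volume]
      with p h1 h2 h3
    rw [h1, h2, h3, schwartz_apply]
  rw [hat, h, SchwartzMap.toLp_fourier_eq]
  exact SchwartzMap.coeFn_toLp (𝓕 hφ.schwartz : 𝓢(Plane, ℂ)) 2 volume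

theorem schwartz_partialDeriv (hφ : IsTest φ) (i : Fin 2) :
    (hφ.partialDeriv i).schwartz = ∂_{(EuclideanSpace.single i 1 : Plane)} hφ.schwartz := by
  ext p
  rw [lineDerivOp_apply_eq_fderiv, schwartz_apply]
  have h1 : HasFDerivAt (Complex.ofRealCLM ∘ φ) (Complex.ofRealCLM.comp (fderiv ℝ φ p)) p :=
    Complex.ofRealCLM.hasFDerivAt.comp p
      ((hφ.smooth.differentiable (by simp)).differentiableAt.hasFDerivAt)
  have h2 : fderiv ℝ hφ.schwartz p = Complex.ofRealCLM.comp (fderiv ℝ φ p) := h1.fderiv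
  rw [h2]
  rfl

theorem fourier_schwartz_partialDeriv (hφ : IsTest φ) (i : Fin 2) (ξ : Plane) :
    𝓕 (hφ.partialDeriv i).schwartz ξ = 2 * Real.pi * Complex.I * (ξ i : ℂ) * 𝓕 hφ.schwartz ξ := by
  have hg : Function.HasTemperateGrowth fun ξ : Plane =>
      (inner ℝ ξ (EuclideanSpace.single i 1 : Plane) : ℝ) := by fun_prop
  rw [schwartz_partialDeriv hφ i, SchwartzMap.fourier_lineDerivOp_eq, smul_apply,
    smulLeftCLM_apply_apply hg]
  simp only [EuclideanSpace.inner_single_right, smul_eq_mul, Complex.real_smul]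
  simp
  ring

theorem fourier_schwartz_opA (hφ : IsTest φ) (ε ω : ℝ) (ξ : Plane) :
    𝓕 (hφ.opA ε ω).schwartz ξ = (swSymbol (1 + 2 * ε * ω) ξ : ℂ) * 𝓕 hφ.schwartz ξ := by
  have h : (hφ.opA ε ω).schwartz = hφ.schwartz +
      ((1 + 2 * ε * ω : ℝ) : ℂ) • ((hφ.partialDeriv 0).partialDeriv 0).schwartz +
      ((hφ.partialDeriv 1).partialDeriv 1).schwartz := by
    ext p
    simp only [add_apply, smul_apply, schwartz_apply, GSH.opA, smul_eq_mul]
    push_cast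
    ring
  rw [h, FourierTransform.fourier_add, FourierTransform.fourier_add, FourierTransform.fourier_smul,
    add_apply, add_apply, smul_apply,
    fourier_schwartz_partialDeriv (hφ.partialDeriv 0), fourier_schwartz_partialDeriv hφ,
    fourier_schwartz_partialDeriv (hφ.partialDeriv 1), fourier_schwartz_partialDeriv hφ, swSymbol, smul_eq_mul]
  push_cast
  have hI : Complex.I * Complex.I = -1 := Complex.I_mul_I
  linear_combination (4 * (Real.pi : ℂ) ^ 2 * (1 + 2 * ε * ω) * (ξ 0 : ℂ) ^ 2 * 𝓕 hφ.schwartz ξ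
    + 4 * (Real.pi : ℂ) ^ 2 * (ξ 1 : ℂ) ^ 2 * 𝓕 hφ.schwartz ξ) * hI

theorem hat_opA (hφ : IsTest φ) (ε ω : ℝ) :
    hat (hφ.opA ε ω).toL2 =ᵐ[volume] fun ξ => (swSymbol (1 + 2 * ε * ω) ξ : ℂ) * hat hφ.toL2 ξ := by
  filter_upwards [(hφ.opA ε ω).hat_toL2, hφ.hat_toL2] with ξ h1 h2
  rw [h1, h2, fourier_schwartz_opA hφ]

theorem swTrunc_mult (hφ : IsTest φ) (ε ω : ℝ) (n : ℕ) :
    (swTrunc (1 + 2 * ε * ω) n).mult hφ.toL2 = (lowPass n).mult ((hφ.opA ε ω).opA ε ω).toL2 := by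
  refine hat_injective (Lp.ext ?_)
  filter_upwards [(swTrunc (1 + 2 * ε * ω) n).hat_mult hφ.toL2,
    (lowPass n).hat_mult ((hφ.opA ε ω).opA ε ω).toL2, (hφ.opA ε ω).hat_opA ε ω, hφ.hat_opA ε ω]
    with ξ h1 h2 h3 h4
  rw [h1, h2, h3, h4, swTrunc_apply, lowPass_apply]
  split_ifs <;> push_cast <;> ring

theorem norm_toL2_sq (hφ : IsTest φ) : ‖hφ.toL2‖ ^ 2 = ∫ p, φ p ^ 2 := by
  rw [IsNemytskii.norm_sq_eq_integral]
  refine integral_congr_ae ?_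
  filter_upwards [hφ.coeFn_toL2] with p h
  rw [h]

theorem swTrunc_inner_le (hφ : IsTest φ) (ε ω : ℝ) (n : ℕ) :
    inner ℝ ((swTrunc (1 + 2 * ε * ω) n).mult hφ.toL2) hφ.toL2 ≤ ∫ p, GSH.opA ε ω φ p ^ 2 := by
  rw [← norm_toL2_sq (hφ.opA ε ω), EvenSymbol.mult_inner_self, ← norm_hat,
    ← inner_self_eq_norm_sq (𝕜 := ℂ), L2.inner_def]
  have hint := L2.integrable_inner (𝕜 := ℂ) (hat (hφ.opA ε ω).toL2) (hat (hφ.opA ε ω).toL2)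
  rw [← integral_re hint]
  refine integral_mono_ae ((swTrunc _ n).integrable_mul_norm_sq _) hint.re ?_
  filter_upwards [hφ.hat_opA ε ω] with ξ h
  rw [inner_self_eq_norm_sq, h, norm_mul, mul_pow, Complex.norm_real, Real.norm_eq_abs, sq_abs,
    swTrunc_apply]
  split_ifs
  · rfl
  · rw [zero_mul]; positivity

end IsTest

theorem tendsto_lowPass (u : RL2) : Tendsto (fun n => (lowPass n).mult u) atTop (𝓝 u) := by
  have h1 : Tendsto (fun n => inner ℝ ((lowPass n).mult u) u) atTop (𝓝 (‖u‖ ^ 2)) := by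
    have e : ‖u‖ ^ 2 = ∫ ξ, ‖hat u ξ‖ ^ 2 := by
      rw [← real_inner_self_eq_norm_sq, inner_eq_integral_hat]
      congr 1; ext ξ
      rw [Complex.mul_conj, Complex.ofReal_re, Complex.normSq_eq_norm_sq]
    simp_rw [EvenSymbol.mult_inner_self]
    rw [e]
    refine tendsto_integral_of_dominated_convergence (fun ξ => ‖hat u ξ‖ ^ 2)
      (fun n => ((lowPass n).integrable_mul_norm_sq u).aestronglyMeasurable)
      ((Lp.memLp (hat u)).integrable_norm_pow two_ne_zero) (fun n => Eventually.of_forall fun ξ => ?_)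
      (Eventually.of_forall fun ξ => ?_)
    · rw [lowPass_apply]
      split_ifs
      · simp
      · simp
    · refine tendsto_const_nhds.congr' ?_
      obtain ⟨N, hN⟩ := exists_nat_ge ‖ξ‖
      filter_upwards [eventually_ge_atTop N] with m hm
      rw [lowPass_apply, if_pos (hN.trans (by exact_mod_cast hm)), one_mul]
  have h2 : ∀ n, ‖(lowPass n).mult u - u‖ ^ 2 = ‖u‖ ^ 2 - inner ℝ ((lowPass n).mult u) u := by
    intro n
    have : inner ℝ ((lowPass n).mult u) ((lowPass n).mult u) = inner ℝ ((lowPass n).mult u) u := by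
      rw [EvenSymbol.mult_inner_comm, EvenSymbol.mult_mult (c := lowPass n), real_inner_comm]
      intro ξ; rw [lowPass_apply]; split_ifs <;> simp
    rw [norm_sub_sq_real, ← real_inner_self_eq_norm_sq, this]
    ring
  rw [tendsto_iff_norm_sub_tendsto_zero]
  have h3 : Tendsto (fun n => ‖(lowPass n).mult u - u‖ ^ 2) atTop (𝓝 0) := by
    simp_rw [h2]
    have := h1.const_sub (‖u‖ ^ 2)
    rwa [sub_self] at this
  have h4 := h3.sqrt
  simpa [Real.sqrt_sq (norm_nonneg _)] using h4

theorem IsTest.tendsto_swTrunc {φ : Plane → ℝ} (hφ : IsTest φ) (ε ω : ℝ) :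
    Tendsto (fun n => (swTrunc (1 + 2 * ε * ω) n).mult hφ.toL2) atTop
      (𝓝 ((hφ.opA ε ω).opA ε ω).toL2) := by
  simp_rw [hφ.swTrunc_mult]
  exact tendsto_lowPass _

end GSH

/-- A periodic function of mean zero has a bounded primitive, so its integral against a slowly
varying cutoff stays bounded. -/
theorem Function.Periodic.exists_abs_integral_mul_comp_div_le {f : ℝ → ℝ} {T : ℝ}
    (hf : Function.Periodic f T) (hfc : Continuous f) (hT : 0 < T)
    (hmean : ∫ x in 0..T, f x = 0) {g : ℝ → ℝ} (hg : ContDiff ℝ 1 g) (hgs : HasCompactSupport g) :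
    ∃ C, ∀ N : ℝ, 0 < N → |∫ x, f x * g (x / N)| ≤ C := by
  have hi : ∀ a b, IntervalIntegrable f volume a b := fun a b => hfc.intervalIntegrable a b
  set F : ℝ → ℝ := fun x => ∫ y in 0..x, f y with hF
  have hFd : ∀ x, HasDerivAt F (f x) x := fun x => hfc.integral_hasStrictDerivAt 0 x |>.hasDerivAt
  have hFc : Continuous F := continuous_iff_continuousAt.2 fun x => (hFd x).continuousAt
  have hFp : Function.Periodic F T := by
    intro x
    have := intervalIntegral.integral_add_adjacent_intervals (hi 0 x) (hi x (x + T))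
    rw [hf.intervalIntegral_add_eq x 0, zero_add, hmean, add_zero] at this
    exact this.symm
  obtain ⟨B, hB⟩ : ∃ B, ∀ x, |F x| ≤ B := by
    obtain ⟨B, hB⟩ := (isCompact_Icc (a := (0 : ℝ)) (b := T)).exists_bound_of_continuousOn
      hFc.continuousOn
    refine ⟨B, fun x => ?_⟩
    obtain ⟨y, hy, hxy⟩ := hFp.exists_mem_Ico₀ hT x
    rw [hxy]
    exact hB y (Ico_subset_Icc_self hy)
  have hB0 : 0 ≤ B := (abs_nonneg _).trans (hB 0)
  have hg'c : Continuous (deriv g) := hg.continuous_deriv_one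
  have hg's : HasCompactSupport (deriv g) := hgs.deriv
  refine ⟨B * ∫ x, |deriv g x|, fun N hN => ?_⟩
  have hcs : ∀ {h : ℝ → ℝ}, HasCompactSupport h → HasCompactSupport fun x => h (x / N) := by
    intro h hh
    have := hh.comp_homeomorph (Homeomorph.mulRight₀ N⁻¹ (inv_ne_zero hN.ne'))
    simpa [Function.comp_def, div_eq_mul_inv] using this
  have hgd : ∀ x, HasDerivAt (fun x => g (x / N)) (deriv g (x / N) * (1 / N)) x := fun x =>
    ((hg.differentiable one_ne_zero) (x / N)).hasDerivAt.comp x ((hasDerivAt_id x).div_const N)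
  have hgN : Continuous fun x => g (x / N) := hg.continuous.comp (continuous_id.div_const N)
  have hg'N : Continuous fun x => deriv g (x / N) := hg'c.comp (continuous_id.div_const N)
  have key := integral_mul_deriv_eq_deriv_mul_of_integrable (u := F) (u' := f)
    (v := fun x => g (x / N)) (v' := fun x => deriv g (x / N) * (1 / N))
    (fun x _ => hFd x) (fun x _ => hgd x)
    ((hFc.mul (hg'N.mul_const _)).integrable_of_hasCompactSupport ((hcs hg's).mul_right.mul_left))
    ((hfc.mul hgN).integrable_of_hasCompactSupport (hcs hgs).mul_left)
    ((hFc.mul hgN).integrable_of_hasCompactSupport (hcs hgs).mul_left)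
  rw [eq_neg_iff_add_eq_zero, add_comm, ← eq_neg_iff_add_eq_zero] at key
  rw [key, abs_neg]
  calc |∫ x, F x * (deriv g (x / N) * (1 / N))|
      ≤ ∫ x, B * (1 / N) * |deriv g (x / N)| := by
        refine (abs_integral_le_integral_abs).trans (integral_mono_of_nonneg
          (Eventually.of_forall fun _ => abs_nonneg _)
          (((hg'N.abs).integrable_of_hasCompactSupport (hcs hg's).abs).const_mul _)
          (Eventually.of_forall fun x => ?_))
        simp only [abs_mul, abs_of_pos (one_div_pos.2 hN)]
        have := mul_le_mul_of_nonneg_right (hB x)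
          (mul_nonneg (abs_nonneg (deriv g (x / N))) (one_div_pos.2 hN).le)
        linarith
    _ = B * ∫ x, |deriv g x| := by
        rw [integral_const_mul, Measure.integral_comp_div (fun x => |deriv g x|) N,
          abs_of_pos hN, smul_eq_mul]
        field_simp

/-- A periodic function converges weakly to its mean. -/
theorem Function.Periodic.tendsto_integral_mul_comp_div {f : ℝ → ℝ} {T : ℝ}
    (hf : Function.Periodic f T) (hfc : Continuous f) (hT : 0 < T)
    {g : ℝ → ℝ} (hg : ContDiff ℝ 1 g) (hgs : HasCompactSupport g) :
    Tendsto (fun N : ℝ => (∫ x, f x * g (x / N)) / N) atTop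
      (𝓝 ((∫ x in 0..T, f x) / T * ∫ x, g x)) := by
  set m := (∫ x in 0..T, f x) / T with hm
  have hp : Function.Periodic (fun x => f x - m) T := fun x => by simp [hf x]
  have hmean : ∫ x in 0..T, (f x - m) = 0 := by
    rw [intervalIntegral.integral_sub (hfc.intervalIntegrable _ _) (by simp)]
    simp [hm]; field_simp; ring
  obtain ⟨C, hC⟩ := hp.exists_abs_integral_mul_comp_div_le (hfc.sub continuous_const) hT hmean hg hgs
  rw [tendsto_iff_dist_tendsto_zero]
  refine squeeze_zero' (Eventually.of_forall fun _ => dist_nonneg) ?_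
    (tendsto_const_nhds.div_atTop tendsto_id : Tendsto (fun N : ℝ => C / N) atTop (𝓝 0))
  filter_upwards [eventually_gt_atTop 0] with N hN
  have hgN : Continuous fun x => g (x / N) := hg.continuous.comp (continuous_id.div_const N)
  have hcs : HasCompactSupport fun x => g (x / N) := by
    have := hgs.comp_homeomorph (Homeomorph.mulRight₀ N⁻¹ (inv_ne_zero hN.ne'))
    simpa [Function.comp_def, div_eq_mul_inv] using this
  have h1 : ∫ x, (f x - m) * g (x / N) = (∫ x, f x * g (x / N)) - m * (N * ∫ x, g x) := by
    simp_rw [sub_mul]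
    rw [integral_sub (f := fun x => f x * g (x / N)) (g := fun x => m * g (x / N))
      ((hfc.mul hgN).integrable_of_hasCompactSupport hcs.mul_left)
      ((hgN.integrable_of_hasCompactSupport hcs).const_mul m), integral_const_mul,
      Measure.integral_comp_div g N, abs_of_pos hN, smul_eq_mul]
  have h2 := hC N hN
  rw [h1] at h2
  rw [Real.dist_eq, show (∫ x, f x * g (x / N)) / N - m * ∫ x, g x =
    ((∫ x, f x * g (x / N)) - m * (N * ∫ x, g x)) / N by field_simp, abs_div, abs_of_pos hN]
  exact div_le_div_of_nonneg_right h2 hN.le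

namespace GSH

/-- A smooth cutoff function on the line. -/
def cutoff : ContDiffBump (0 : ℝ) := ⟨1, 2, one_pos, one_lt_two⟩

/-- The solution `h` of `h'' = -μ h`, localized at the scale `N`. -/
def packet (h : ℝ → ℝ) (N : ℝ) : ℝ → ℝ := fun x => cutoff (x / N) * h x

theorem contDiff_cutoff {n : ℕ∞} : ContDiff ℝ n (cutoff : ℝ → ℝ) := cutoff.contDiff

theorem contDiff_packet {h : ℝ → ℝ} (hh : ContDiff ℝ (⊤ : ℕ∞) h) (N : ℝ) :
    ContDiff ℝ (⊤ : ℕ∞) (packet h N) :=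
  (contDiff_cutoff.comp (contDiff_id.div_const N)).mul hh

theorem hasCompactSupport_comp_div {g : ℝ → ℝ} (hg : HasCompactSupport g) {N : ℝ} (hN : 0 < N) :
    HasCompactSupport fun x => g (x / N) := by
  have := hg.comp_homeomorph (Homeomorph.mulRight₀ N⁻¹ (inv_ne_zero hN.ne'))
  simpa [Function.comp_def, div_eq_mul_inv] using this

theorem hasDerivAt_comp_div {g : ℝ → ℝ} (hg : Differentiable ℝ g) (N x : ℝ) :
    HasDerivAt (fun x => g (x / N)) (deriv g (x / N) * (1 / N)) x :=
  (hg (x / N)).hasDerivAt.comp x ((hasDerivAt_id x).div_const N)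

theorem hasCompactSupport_packet (h : ℝ → ℝ) {N : ℝ} (hN : 0 < N) :
    HasCompactSupport (packet h N) :=
  (hasCompactSupport_comp_div cutoff.hasCompactSupport hN).mul_right

theorem integral_cutoff_sq_pos : 0 < ∫ x, cutoff x ^ 2 := by
  have hc : Continuous fun x => cutoff x ^ 2 := cutoff.continuous.pow 2
  refine hc.integral_pos_of_hasCompactSupport_nonneg_nonzero ?_ (fun x => sq_nonneg _) (x := 0) ?_
  · exact cutoff.hasCompactSupport.comp_left (g := fun y : ℝ => y ^ 2) (by simp)
  · have : cutoff (0 : ℝ) = 1 := cutoff.one_of_mem_closedBall (by simp [cutoff])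
    simp [this]

theorem tendsto_integral_mul_packet_sq {h p : ℝ → ℝ} {T : ℝ} (hh : Continuous h) (hp : Continuous p)
    (hT : 0 < T) (hper : Function.Periodic (fun x => p x * h x ^ 2) T) :
    Tendsto (fun N : ℝ => (∫ x, p x * packet h N x ^ 2) / N) atTop
      (𝓝 ((∫ x in 0..T, p x * h x ^ 2) / T * ∫ x, cutoff x ^ 2)) := by
  have := hper.tendsto_integral_mul_comp_div (hp.mul (hh.pow 2)) hT
    (g := fun x => cutoff x ^ 2) ((contDiff_cutoff (n := 1)).pow 2)
    (cutoff.hasCompactSupport.comp_left (g := fun y : ℝ => y ^ 2) (by simp))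
  refine this.congr fun N => ?_
  congr 2; ext x; simp only [packet]; ring

/-- The error made by a localized solution of `h'' = -μ h`. -/
theorem exists_integral_packet_residual_le {h h' : ℝ → ℝ} {μ : ℝ} (hd : ∀ x, HasDerivAt h (h' x) x)
    (hd' : ∀ x, HasDerivAt h' (-μ * h x) x) (hb : ∀ x, |h x| ≤ 1) (hb' : ∀ x, |h' x| ≤ 1) :
    ∃ C, ∀ N : ℝ, 1 ≤ N → ∫ x, (deriv (deriv (packet h N)) x + μ * packet h N x) ^ 2 ≤ C / N := by
  set g : ℝ → ℝ := fun x => (|deriv (deriv cutoff) x| + 2 * |deriv cutoff x|) ^ 2 with hg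
  have c1 : ContDiff ℝ 1 (deriv (cutoff : ℝ → ℝ)) :=
    (contDiff_cutoff (n := 2)).deriv' 
  have hgc : Continuous g := by
    have := c1.continuous_deriv_one
    have := c1.continuous
    fun_prop
  have hgs : HasCompactSupport g := by
    have h1 : HasCompactSupport (deriv (cutoff : ℝ → ℝ)) := cutoff.hasCompactSupport.deriv
    exact ((h1.deriv.abs).add (h1.abs.mul_left (f := fun _ => (2 : ℝ)))).comp_left
      (g := fun y : ℝ => y ^ 2) (by simp)
  refine ⟨∫ x, g x, fun N hN => ?_⟩
  have hN0 : 0 < N := by linarith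
  have d0 : ∀ x, HasDerivAt (fun x => cutoff (x / N)) (deriv cutoff (x / N) * (1 / N)) x :=
    hasDerivAt_comp_div ((contDiff_cutoff (n := 1)).differentiable one_ne_zero) N
  have d1 : ∀ x, HasDerivAt (fun x => deriv cutoff (x / N))
      (deriv (deriv cutoff) (x / N) * (1 / N)) x :=
    hasDerivAt_comp_div (c1.differentiable one_ne_zero) N
  have e1 : deriv (packet h N) = fun x =>
      deriv cutoff (x / N) * (1 / N) * h x + cutoff (x / N) * h' x :=
    funext fun x => ((d0 x).mul (hd x)).deriv
  have e2 : ∀ x, deriv (deriv (packet h N)) x + μ * packet h N x =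
      deriv (deriv cutoff) (x / N) * (1 / N) * (1 / N) * h x
        + 2 * (deriv cutoff (x / N) * (1 / N) * h' x) := by
    intro x
    have d2 : HasDerivAt (fun x => deriv cutoff (x / N) * (1 / N) * h x + cutoff (x / N) * h' x)
      _ x := (((d1 x).mul_const (1 / N)).mul (hd x)).add ((d0 x).mul (hd' x))
    rw [e1, d2.deriv, packet]
    ring
  have hle : ∀ x, (deriv (deriv (packet h N)) x + μ * packet h N x) ^ 2 ≤
      (1 / N) ^ 2 * g (x / N) := by
    intro x
    rw [e2, hg, ← mul_pow]
    refine sq_le_sq' ?_ ?_ <;>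
    · have hi : 1 / N ≤ 1 := by rw [div_le_one hN0]; exact hN
      have hi0 : 0 < 1 / N := by positivity
      have a1 : |deriv (deriv cutoff) (x / N) * (1 / N) * (1 / N) * h x| ≤
          1 / N * |deriv (deriv cutoff) (x / N)| := by
        rw [abs_mul, abs_mul, abs_mul, abs_of_pos hi0]
        calc |deriv (deriv cutoff) (x / N)| * (1 / N) * (1 / N) * |h x|
            ≤ |deriv (deriv cutoff) (x / N)| * (1 / N) * 1 * 1 := by
              gcongr; exact hb x
          _ = _ := by ring
      have a2 : |deriv cutoff (x / N) * (1 / N) * h' x| ≤ 1 / N * |deriv cutoff (x / N)| := by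
        rw [abs_mul, abs_mul, abs_of_pos hi0]
        calc |deriv cutoff (x / N)| * (1 / N) * |h' x|
            ≤ |deriv cutoff (x / N)| * (1 / N) * 1 := by gcongr; exact hb' x
          _ = _ := by ring
      have b1 := abs_le.1 a1
      have b2 := abs_le.1 a2
      linarith
  calc ∫ x, (deriv (deriv (packet h N)) x + μ * packet h N x) ^ 2
      ≤ ∫ x, (1 / N) ^ 2 * g (x / N) := by
        refine integral_mono_of_nonneg (Eventually.of_forall fun _ => sq_nonneg _) ?_
          (Eventually.of_forall hle)
        exact ((hgc.comp (continuous_id.div_const N)).integrable_of_hasCompactSupport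
          (hasCompactSupport_comp_div hgs hN0)).const_mul _
    _ = (∫ x, g x) / N := by
        rw [integral_const_mul, Measure.integral_comp_div g N, abs_of_pos hN0, smul_eq_mul]
        field_simp

theorem integral_mul_coord (f g : ℝ → ℝ) :
    ∫ p : Plane, f (p 0) * g (p 1) = (∫ x, f x) * ∫ y, g y := by
  have h := (EuclideanSpace.volume_preserving_symm_measurableEquiv_toLp (Fin 2)).integral_comp
    (MeasurableEquiv.measurableEmbedding _) (fun q : Fin 2 → ℝ => f (q 0) * g (q 1))
  have h2 := integral_fintype_prod_volume_eq_prod (ι := Fin 2) (𝕜 := ℝ) (E := fun _ => ℝ) (![f, g])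
  simp only [Fin.prod_univ_two, Matrix.cons_val_zero, Matrix.cons_val_one] at h2
  rw [← h2, ← h]
  rfl

theorem hasFDerivAt_coord (i : Fin 2) (p : Plane) :
    HasFDerivAt (fun p : Plane => p i) (EuclideanSpace.proj i : Plane →L[ℝ] ℝ) p :=
  (EuclideanSpace.proj i : Plane →L[ℝ] ℝ).hasFDerivAt

theorem partialDeriv_mul_coord {X Y : ℝ → ℝ} (hX : Differentiable ℝ X) (hY : Differentiable ℝ Y) :
    partialDeriv 0 (fun p : Plane => X (p 0) * Y (p 1)) = (fun p => deriv X (p 0) * Y (p 1)) ∧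
    partialDeriv 1 (fun p : Plane => X (p 0) * Y (p 1)) = (fun p => X (p 0) * deriv Y (p 1)) := by
  have h : ∀ p : Plane, HasFDerivAt (fun p : Plane => X (p 0) * Y (p 1)) _ p := fun p =>
    ((hX (p 0)).hasDerivAt.comp_hasFDerivAt p (hasFDerivAt_coord 0 p)).mul
      ((hY (p 1)).hasDerivAt.comp_hasFDerivAt p (hasFDerivAt_coord 1 p))
  constructor <;> ext p <;> rw [partialDeriv, (h p).fderiv] <;> simp [mul_comm]

theorem hasCompactSupport_mul_coord {f g : ℝ → ℝ} (hf : HasCompactSupport f)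
    (hg : HasCompactSupport g) : HasCompactSupport fun p : Plane => f (p 0) * g (p 1) := by
  have hc : Continuous fun q : ℝ × ℝ => (!₂[q.1, q.2] : Plane) := by
    refine (PiLp.continuous_toLp 2 _).comp (continuous_pi fun i => ?_)
    fin_cases i
    · exact continuous_fst
    · exact continuous_snd
  refine HasCompactSupport.intro ((hf.isCompact.prod hg.isCompact).image hc) fun p hp => ?_
  by_contra h
  refine hp ⟨(p 0, p 1), ⟨subset_tsupport _ (left_ne_zero_of_mul h),
    subset_tsupport _ (right_ne_zero_of_mul h)⟩, ?_⟩
  ext i; fin_cases i <;> rfl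

theorem continuous_coord (i : Fin 2) : Continuous fun p : Plane => p i :=
  (EuclideanSpace.proj i : Plane →L[ℝ] ℝ).continuous

theorem integrable_mul_coord {f g : ℝ → ℝ} (hf : Continuous f) (hg : Continuous g)
    (hf' : HasCompactSupport f) (hg' : HasCompactSupport g) :
    Integrable fun p : Plane => f (p 0) * g (p 1) :=
  ((hf.comp (continuous_coord 0)).mul (hg.comp (continuous_coord 1))).integrable_of_hasCompactSupport
    (hasCompactSupport_mul_coord hf' hg')

/-- A periodic potential `c` of `x` which has a positive mean against the square of a solution of
`h'' = -h / 4` makes the quadratic form `∫ c φ² - ∫ (A φ)²` positive on some test function. -/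
theorem exists_isTest_integral_opA_sq_lt {c h h' : ℝ → ℝ} {ε ω : ℝ} (hk : 0 ≤ 1 + 2 * ε * ω)
    (hk4 : 1 + 2 * ε * ω < 4) (hc : Continuous c) (hcp : Function.Periodic c (2 * Real.pi))
    (hh : ContDiff ℝ (⊤ : ℕ∞) h) (hhp : Function.Periodic (fun x => h x ^ 2) (2 * Real.pi))
    (hd : ∀ x, HasDerivAt h (h' x) x) (hd' : ∀ x, HasDerivAt h' (-(1 / 4) * h x) x)
    (hb : ∀ x, |h x| ≤ 1) (hb' : ∀ x, |h' x| ≤ 1)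
    (hpos : 0 < ∫ x in 0..2 * Real.pi, c x * h x ^ 2) :
    ∃ φ : Plane → ℝ, IsTest φ ∧ ∫ p, opA ε ω φ p ^ 2 < ∫ p, c (p 0) * φ p ^ 2 := by
  set k := 1 + 2 * ε * ω with hkdef
  set l := √(1 - k / 4) with hl
  have hl0 : 0 < l := Real.sqrt_pos.2 (by linarith)
  have hl2 : l ^ 2 = 1 - k / 4 := Real.sq_sqrt (by linarith)
  have hl1 : l ≤ 1 := by nlinarith
  set g : ℝ → ℝ := fun y => Real.cos (l * y) with hg
  set g' : ℝ → ℝ := fun y => -(l * Real.sin (l * y)) with hg'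
  have hgs : ContDiff ℝ (⊤ : ℕ∞) g := Real.contDiff_cos.comp (contDiff_const.mul contDiff_id)
  have gd : ∀ y, HasDerivAt g (g' y) y := fun y => by
    have : HasDerivAt g _ y := (Real.hasDerivAt_cos (l * y)).comp y ((hasDerivAt_id y).const_mul l)
    refine this.congr_deriv ?_
    change -Real.sin (l * y) * (l * 1) = -(l * Real.sin (l * y))
    ring
  have gd' : ∀ y, HasDerivAt g' (-(l ^ 2) * g y) y := fun y => by
    have : HasDerivAt g' _ y :=
      (((Real.hasDerivAt_sin (l * y)).comp y ((hasDerivAt_id y).const_mul l)).const_mul l).neg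
    refine this.congr_deriv ?_
    change -(l * (Real.cos (l * y) * (l * 1))) = -(l ^ 2) * Real.cos (l * y)
    ring
  have gb : ∀ y, |g y| ≤ 1 := fun y => Real.abs_cos_le_one _
  have gb' : ∀ y, |g' y| ≤ 1 := fun y => by
    rw [hg', abs_neg, abs_mul, abs_of_pos hl0]
    exact mul_le_one₀ hl1 (abs_nonneg _) (Real.abs_sin_le_one _)
  have gp : Function.Periodic (fun y => g y ^ 2) (Real.pi / l) := fun y => by
    simp only [hg, mul_add]
    rw [mul_div_cancel₀ _ hl0.ne', Real.cos_add_pi, neg_sq]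
  obtain ⟨C₁, hC₁⟩ := exists_integral_packet_residual_le hd hd' hb hb'
  obtain ⟨C₂, hC₂⟩ := exists_integral_packet_residual_le gd gd' gb gb'
  set X := packet h with hX
  set Y := packet g with hY
  have l1 := tendsto_integral_mul_packet_sq hh.continuous hc Real.two_pi_pos
    (fun x => by simp only [hcp x, hhp x] : Function.Periodic (fun x => c x * h x ^ 2) (2 * Real.pi))
  have l2 := tendsto_integral_mul_packet_sq (p := fun _ => 1) hh.continuous continuous_const
    Real.two_pi_pos (by simpa only [one_mul] using hhp)
  have l3 := tendsto_integral_mul_packet_sq (p := fun _ => 1) hgs.continuous continuous_const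
    (div_pos Real.pi_pos hl0) (by simpa only [one_mul] using gp)
  simp only [one_mul] at l2 l3
  have gpos : 0 < ∫ y in 0..Real.pi / l, g y ^ 2 := by
    refine intervalIntegral.integral_pos (div_pos Real.pi_pos hl0) (hgs.continuous.pow 2).continuousOn
      (fun _ _ => sq_nonneg _) ⟨0, ⟨le_rfl, (div_pos Real.pi_pos hl0).le⟩, ?_⟩
    simp [hg]
  have hI := integral_cutoff_sq_pos
  have lim1 := l1.mul l3
  have lim2 : Tendsto (fun N : ℝ => 2 * k ^ 2 * (C₁ / N / N) * ((∫ y, Y N y ^ 2) / N) +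
      2 * ((∫ x, X N x ^ 2) / N) * (C₂ / N / N)) atTop (𝓝 0) := by
    have t : ∀ C : ℝ, Tendsto (fun N : ℝ => C / N / N) atTop (𝓝 0) := fun C =>
      (tendsto_const_nhds.div_atTop tendsto_id).div_atTop tendsto_id
    simpa using (((t C₁).const_mul (2 * k ^ 2)).mul l3).add ((l2.const_mul 2).mul (t C₂))
  have hlim : (0 : ℝ) < (∫ x in 0..2 * Real.pi, c x * h x ^ 2) / (2 * Real.pi) *
      (∫ x, cutoff x ^ 2) * ((∫ x in 0..Real.pi / l, g x ^ 2) / (Real.pi / l) *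
      ∫ x, cutoff x ^ 2) := by
    have := Real.pi_pos
    positivity
  obtain ⟨N, hN, hN1⟩ := ((lim2.eventually_lt lim1 hlim).and (eventually_ge_atTop 1)).exists
  have hN0 : 0 < N := by linarith
  have sX : ContDiff ℝ (⊤ : ℕ∞) (X N) := contDiff_packet hh N
  have sY : ContDiff ℝ (⊤ : ℕ∞) (Y N) := contDiff_packet hgs N
  have kX : HasCompactSupport (X N) := hasCompactSupport_packet h hN0
  have kY : HasCompactSupport (Y N) := hasCompactSupport_packet g hN0
  have sX' : ContDiff ℝ (⊤ : ℕ∞) (deriv (X N)) := (contDiff_infty_iff_deriv.1 sX).2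
  have sY' : ContDiff ℝ (⊤ : ℕ∞) (deriv (Y N)) := (contDiff_infty_iff_deriv.1 sY).2
  have cX'' : Continuous (deriv (deriv (X N))) := (contDiff_infty_iff_deriv.1 sX').2.continuous
  have cY'' : Continuous (deriv (deriv (Y N))) := (contDiff_infty_iff_deriv.1 sY').2.continuous
  have ksq : ∀ {f : ℝ → ℝ}, HasCompactSupport f → HasCompactSupport fun x => f x ^ 2 :=
    fun hf => hf.comp_left (g := fun y : ℝ => y ^ 2) (by simp)
  have dX := sX.differentiable (by simp)
  have dY := sY.differentiable (by simp)
  have dX' := sX'.differentiable (by simp)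
  have dY' := sY'.differentiable (by simp)
  set r₁ : ℝ → ℝ := fun x => deriv (deriv (X N)) x + 1 / 4 * X N x with hr₁
  set r₂ : ℝ → ℝ := fun y => deriv (deriv (Y N)) y + l ^ 2 * Y N y with hr₂
  have kr₁ : HasCompactSupport r₁ := kX.deriv.deriv.add kX.mul_left
  have kr₂ : HasCompactSupport r₂ := kY.deriv.deriv.add kY.mul_left
  have cr₁ : Continuous r₁ := cX''.add (continuous_const.mul sX.continuous)
  have cr₂ : Continuous r₂ := cY''.add (continuous_const.mul sY.continuous)
  have hA : ∀ p, opA ε ω (fun p : Plane => X N (p 0) * Y N (p 1)) p =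
      k * r₁ (p 0) * Y N (p 1) + X N (p 0) * r₂ (p 1) := by
    intro p
    rw [opA, (partialDeriv_mul_coord dX dY).1, (partialDeriv_mul_coord dX dY).2,
      (partialDeriv_mul_coord dX' dY).1, (partialDeriv_mul_coord dX dY').2]
    simp only [hr₁, hr₂, hl2, ← hkdef]
    ring
  refine ⟨fun p => X N (p 0) * Y N (p 1), ⟨?_, hasCompactSupport_mul_coord kX kY⟩, ?_⟩
  · exact (sX.comp (EuclideanSpace.proj 0 : Plane →L[ℝ] ℝ).contDiff).mul
      (sY.comp (EuclideanSpace.proj 1 : Plane →L[ℝ] ℝ).contDiff)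
  · have i1 : Integrable fun p : Plane => 2 * k ^ 2 * (r₁ (p 0) ^ 2 * Y N (p 1) ^ 2) :=
      (integrable_mul_coord (cr₁.pow 2) (sY.continuous.pow 2) (ksq kr₁) (ksq kY)).const_mul _
    have i2 : Integrable fun p : Plane => 2 * (X N (p 0) ^ 2 * r₂ (p 1) ^ 2) :=
      (integrable_mul_coord (sX.continuous.pow 2) (cr₂.pow 2) (ksq kX) (ksq kr₂)).const_mul _
    calc ∫ p, opA ε ω (fun p : Plane => X N (p 0) * Y N (p 1)) p ^ 2
        ≤ ∫ p : Plane, (2 * k ^ 2 * (r₁ (p 0) ^ 2 * Y N (p 1) ^ 2)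
            + 2 * (X N (p 0) ^ 2 * r₂ (p 1) ^ 2)) := by
          refine integral_mono_of_nonneg (Eventually.of_forall fun _ => sq_nonneg _) (i1.add i2)
            (Eventually.of_forall fun p => ?_)
          simp only [hA]
          nlinarith [sq_nonneg (k * r₁ (p 0) * Y N (p 1) - X N (p 0) * r₂ (p 1))]
      _ = 2 * k ^ 2 * ((∫ x, r₁ x ^ 2) * ∫ y, Y N y ^ 2)
            + 2 * ((∫ x, X N x ^ 2) * ∫ y, r₂ y ^ 2) := by
          rw [integral_add i1 i2, integral_const_mul, integral_const_mul,
            integral_mul_coord (fun x => r₁ x ^ 2) (fun y => Y N y ^ 2),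
            integral_mul_coord (fun x => X N x ^ 2) (fun y => r₂ y ^ 2)]
      _ ≤ 2 * k ^ 2 * ((C₁ / N) * ∫ y, Y N y ^ 2) + 2 * ((∫ x, X N x ^ 2) * (C₂ / N)) := by
          have y0 : 0 ≤ ∫ y, Y N y ^ 2 := integral_nonneg fun _ => sq_nonneg _
          have x0 : 0 ≤ ∫ x, X N x ^ 2 := integral_nonneg fun _ => sq_nonneg _
          have := hC₁ N hN1
          have := hC₂ N hN1
          gcongr
      _ = (2 * k ^ 2 * (C₁ / N / N) * ((∫ y, Y N y ^ 2) / N) +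
            2 * ((∫ x, X N x ^ 2) / N) * (C₂ / N / N)) * N ^ 2 := by
          field_simp
      _ < ((∫ x, c x * X N x ^ 2) / N * ((∫ y, Y N y ^ 2) / N)) * N ^ 2 :=
          mul_lt_mul_of_pos_right hN (by positivity)
      _ = ∫ p : Plane, (c (p 0) * X N (p 0) ^ 2) * Y N (p 1) ^ 2 := by
          rw [integral_mul_coord (fun x => c x * X N x ^ 2) (fun y => Y N y ^ 2)]
          field_simp
      _ = _ := by congr 1; ext p; ring

end GSH

namespace GSH

theorem le_integral_reactionDeriv_mul {b s ε τ a r : ℝ} {u : ℝ → ℝ} (hs : 0 ≤ s) (hτ : |τ| = 1)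
    (hu : Continuous u) (hur : ∀ x, |u x - a * Real.cos x| ≤ r) :
    Real.pi * (ε ^ 2 + b * τ * a - 2 * |b| * r - 6 * s * (a ^ 2 + r ^ 2)) ≤
      ∫ x in 0..2 * Real.pi, reactionDeriv b s ε (u x) * ((1 + τ * Real.cos x) / 2) := by
  have hτ2 : τ ^ 2 = 1 := by rw [← sq_abs, hτ, one_pow]
  have hI : ∫ x in 0..2 * Real.pi, ((ε ^ 2 + 2 * b * (a * Real.cos x) - 2 * |b| * r
      - 6 * s * (a ^ 2 + r ^ 2)) * ((1 + τ * Real.cos x) / 2)) =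
      Real.pi * (ε ^ 2 + b * τ * a - 2 * |b| * r - 6 * s * (a ^ 2 + r ^ 2)) := by
    have e : ∀ x, (ε ^ 2 + 2 * b * (a * Real.cos x) - 2 * |b| * r
      - 6 * s * (a ^ 2 + r ^ 2)) * ((1 + τ * Real.cos x) / 2) =
      (ε ^ 2 - 2 * |b| * r - 6 * s * (a ^ 2 + r ^ 2)) / 2 +
      (b * a + τ * (ε ^ 2 - 2 * |b| * r - 6 * s * (a ^ 2 + r ^ 2)) / 2) * Real.cos x +
      (b * a * τ) * Real.cos x ^ 2 := fun x => by ring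
    have c1 : Continuous fun x => Real.cos x := Real.continuous_cos
    have c2 : Continuous fun x => Real.cos x ^ 2 := by fun_prop
    simp_rw [e]
    rw [intervalIntegral.integral_add, intervalIntegral.integral_add,
      intervalIntegral.integral_const_mul, intervalIntegral.integral_const_mul, integral_cos,
      integral_cos_sq]
    · simp; ring
    all_goals exact Continuous.intervalIntegrable (by fun_prop) _ _
  rw [← hI]
  refine intervalIntegral.integral_mono_on Real.two_pi_pos.le
    (Continuous.intervalIntegrable (by fun_prop) _ _)
    (Continuous.intervalIntegrable (by unfold reactionDeriv; fun_prop) _ _) fun x _ => ?_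
  have hc := Real.abs_cos_le_one x
  have hw : 0 ≤ (1 + τ * Real.cos x) / 2 := by
    have : |τ * Real.cos x| ≤ 1 := by rw [abs_mul, hτ, one_mul]; exact hc
    have := (abs_le.1 this).1
    linarith
  refine mul_le_mul_of_nonneg_right ?_ hw
  have h1 : -(2 * |b| * r) ≤ 2 * b * (u x - a * Real.cos x) := by
    have : |2 * b * (u x - a * Real.cos x)| ≤ 2 * |b| * r := by
      rw [abs_mul, abs_mul, abs_two]; gcongr; exact hur x
    exact (abs_le.1 this).1
  have h2 : u x ^ 2 ≤ 2 * (a ^ 2 + r ^ 2) := by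
    have e1 : (u x - a * Real.cos x) ^ 2 ≤ r ^ 2 := sq_le_sq' (by linarith [(abs_le.1 (hur x)).1])
      (abs_le.1 (hur x)).2
    have e2 : (a * Real.cos x) ^ 2 ≤ a ^ 2 := by
      rw [mul_pow]; nlinarith [sq_nonneg a, Real.cos_sq_le_one x]
    nlinarith [sq_nonneg (u x - a * Real.cos x - a * Real.cos x)]
  unfold reactionDeriv
  nlinarith [mul_le_mul_of_nonneg_left h2 hs]

theorem mean_pos_of_small {ε m s β A K : ℝ} (hε0 : 0 < ε) (hε1 : ε ≤ 1) (hm0 : 0 < m) (hm1 : m ≤ 1)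
    (hs0 : 0 ≤ s)
    (h1 : ε * (2 * β * K + 6 * s * A ^ 2 + 12 * s * K ^ 2 + 1) < 1)
    (h2 : ε * (2 * β * K + 6 * s * A ^ 2 + 12 * s * K ^ 2 + 1) < β * A) :
    0 < ε ^ 2 + β * (ε * A * m) - 2 * β * (K * (ε ^ 2 * m + ε ^ 3))
      - 6 * s * ((ε * A * m) ^ 2 + (K * (ε ^ 2 * m + ε ^ 3)) ^ 2) := by
  have hm2 : m ^ 2 ≤ m := by nlinarith
  have q4 : ε ^ 2 * m ^ 2 ≤ ε ^ 2 * m := by gcongr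
  set r := ε ^ 2 * m + ε ^ 3 with hr
  have hr0 : 0 < r := by positivity
  have hr2 : r ≤ 2 := by
    have : ε ^ 2 ≤ 1 := pow_le_one₀ hε0.le hε1
    have : ε ^ 3 ≤ 1 := pow_le_one₀ hε0.le hε1
    nlinarith
  have q5 : (K * r) ^ 2 ≤ 2 * K ^ 2 * r := by
    have : 0 ≤ K ^ 2 * (r * (2 - r)) := mul_nonneg (sq_nonneg K) (mul_nonneg hr0.le (by linarith))
    linear_combination this
  have q6 : (ε * A * m) ^ 2 ≤ A ^ 2 * r := by
    have h : 0 ≤ A ^ 2 * ε ^ 3 := by positivity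
    have h' := mul_le_mul_of_nonneg_left q4 (sq_nonneg A)
    rw [hr]; linear_combination h + h'
  have q7 := mul_le_mul_of_nonneg_left (add_le_add q6 q5) (by positivity : 0 ≤ 6 * s)
  have g1 := mul_lt_mul_of_pos_right h1 (pow_pos hε0 2)
  have g2 := mul_lt_mul_of_pos_right h2 (mul_pos hε0 hm0)
  have q8 : (2 * β * K + 6 * s * A ^ 2 + 12 * s * K ^ 2 + 1) * r < ε ^ 2 + β * (ε * A * m) := by
    rw [hr]; linear_combination g1 + g2
  linear_combination q8 + q7 + hr0

/-- The linearization at a small roll has a positive mean against one of the functions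
`(1 ± cos x) / 2`, the sign being that of `b`. -/
theorem IsRollFamily.exists_integral_reactionDeriv_mul_pos {b s ε₀ τ : ℝ} {u : ℝ → ℝ → ℝ → ℝ}
    (hu : IsRollFamily b s ε₀ u) (hb : b ≠ 0) (hs : 0 < 27 * s - 38 * b ^ 2) (hτ : |τ| = 1)
    (hbτ : b * τ = |b|) :
    ∃ ε₁ ∈ Ioc 0 ε₀, ε₁ ≤ 1 ∧ ∀ ε ∈ Ioo 0 ε₁, ∀ ω ∈ Ioo (-(1 / 2) : ℝ) (1 / 2),
      0 < ∫ x in 0..2 * Real.pi, reactionDeriv b s ε (u ε ω x) * ((1 + τ * Real.cos x) / 2) := by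
  obtain ⟨C, hC⟩ := hu.expansion
  set D := 27 * s - 38 * b ^ 2 with hD
  have hs0 : 0 < s := by nlinarith [sq_nonneg b]
  have hb0 : 0 < |b| := abs_pos.2 hb
  have hsD : 0 < √D := Real.sqrt_pos.2 hs
  set A := 6 / √D with hA
  have hA0 : 0 < A := by positivity
  set K := |C| + 20 * |b| / D + 16 * b ^ 2 / (D * √D) with hK
  have hK0 : 0 ≤ K := by positivity
  set Q := 2 * |b| * K + 6 * s * A ^ 2 + 12 * s * K ^ 2 + 1 with hQ
  have hQ0 : 0 < Q := by positivity
  have hu0 := hu.pos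
  refine ⟨min ε₀ (min 1 (min 1 (|b| * A) / Q)), ⟨by positivity, min_le_left _ _⟩,
    (min_le_right _ _).trans (min_le_left _ _), fun ε hε ω hω => ?_⟩
  have hε0 : 0 < ε := hε.1
  have h1 := hε.2
  simp only [lt_min_iff] at h1
  obtain ⟨hεε, hε1, hεQ⟩ := h1
  rw [lt_div_iff₀ hQ0, lt_min_iff] at hεQ
  have hω2 : ω ^ 2 < 1 / 4 := by nlinarith [hω.1, hω.2]
  set m := √(1 - 4 * ω ^ 2) with hm
  have hm0 : 0 < m := Real.sqrt_pos.2 (by linarith)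
  have hm2 : m ^ 2 = 1 - 4 * ω ^ 2 := Real.sq_sqrt (by linarith)
  have hm1 : m ≤ 1 := by nlinarith [sq_nonneg ω]
  have hω1 : |ω| ≤ 1 / 2 := abs_le.2 ⟨by linarith [hω.1], hω.2.le⟩
  have hωI : ω ∈ Icc (-(1 / 2) : ℝ) (1 / 2) := ⟨hω.1.le, hω.2.le⟩
  have hεI : ε ∈ Ioc 0 ε₀ := ⟨hε0, hεε.le⟩
  have huc : Continuous (u ε ω) := (hu.solution ε hεI ω hωI).contDiff.continuous
  have hur : ∀ x, |u ε ω x - (ε * A * m) * Real.cos x| ≤ K * (ε ^ 2 * m + ε ^ 3) := by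
    intro x
    have e0 := hC ε hεI ω hωI x
    have c1 := Real.abs_cos_le_one x
    have c2 := Real.abs_cos_le_one (2 * x)
    have hmm : m ^ 2 ≤ m := by nlinarith
    have e : u ε ω x - (ε * A * m) * Real.cos x = (u ε ω x - rollExpansion b s ε ω x) +
        ε ^ 2 * (18 * b * m ^ 2 / D - 32 * b ^ 2 * ω * m / (D * √D) * Real.cos x
          + 2 * b * m ^ 2 / D * Real.cos (2 * x)) := by
      rw [rollExpansion, ← hm2, ← hD, Real.sqrt_sq hm0.le, hA]; ring
    have t1 : |18 * b * m ^ 2 / D| ≤ 18 * |b| / D * m := by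
      rw [abs_div, abs_mul, abs_mul, abs_of_pos hs, abs_of_nonneg (sq_nonneg m),
        abs_of_pos (by norm_num : (0 : ℝ) < 18)]
      calc 18 * |b| * m ^ 2 / D ≤ 18 * |b| * m / D := by gcongr
        _ = _ := by ring
    have t2 : |32 * b ^ 2 * ω * m / (D * √D) * Real.cos x| ≤ 16 * b ^ 2 / (D * √D) * m := by
      rw [abs_mul, abs_div, abs_mul, abs_mul, abs_mul, abs_of_pos (mul_pos hs hsD),
        abs_of_nonneg (sq_nonneg b), abs_of_pos hm0, abs_of_pos (by norm_num : (0 : ℝ) < 32)]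
      calc 32 * b ^ 2 * |ω| * m / (D * √D) * |Real.cos x|
          ≤ 32 * b ^ 2 * (1 / 2) * m / (D * √D) * 1 := by gcongr
        _ = _ := by ring
    have t3 : |2 * b * m ^ 2 / D * Real.cos (2 * x)| ≤ 2 * |b| / D * m := by
      rw [abs_mul, abs_div, abs_mul, abs_mul, abs_of_pos hs, abs_of_nonneg (sq_nonneg m), abs_two]
      calc 2 * |b| * m ^ 2 / D * |Real.cos (2 * x)| ≤ 2 * |b| * m / D * 1 := by gcongr
        _ = _ := by ring
    rw [e]
    refine (abs_add_le _ _).trans ?_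
    rw [abs_mul, abs_of_nonneg (sq_nonneg ε)]
    have t4 := (abs_add_le (18 * b * m ^ 2 / D - 32 * b ^ 2 * ω * m / (D * √D) * Real.cos x)
      (2 * b * m ^ 2 / D * Real.cos (2 * x))).trans (add_le_add_left (abs_sub _ _) _)
    have t5 : C * ε ^ 3 ≤ |C| * ε ^ 3 := by gcongr; exact le_abs_self C
    have t6 : ε ^ 2 * |18 * b * m ^ 2 / D - 32 * b ^ 2 * ω * m / (D * √D) * Real.cos x +
        2 * b * m ^ 2 / D * Real.cos (2 * x)| ≤ ε ^ 2 * ((K - |C|) * m) := by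
      gcongr
      refine t4.trans ((add_le_add (add_le_add t1 t2) t3).trans (le_of_eq ?_))
      rw [hK]; ring
    have t7 : 0 ≤ K - |C| := by rw [hK]; ring_nf; positivity
    have t8 : 0 ≤ |C| * (ε ^ 2 * m) := by positivity
    have t9 : 0 ≤ (K - |C|) * ε ^ 3 := mul_nonneg t7 (by positivity)
    calc _ ≤ |C| * ε ^ 3 + ε ^ 2 * ((K - |C|) * m) := add_le_add (e0.trans t5) t6
      _ ≤ |C| * ε ^ 3 + ε ^ 2 * ((K - |C|) * m) + (|C| * (ε ^ 2 * m) + (K - |C|) * ε ^ 3) :=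
        le_add_of_nonneg_right (add_nonneg t8 t9)
      _ = _ := by ring
  refine lt_of_lt_of_le (mul_pos Real.pi_pos ?_)
    (le_integral_reactionDeriv_mul hs0.le hτ huc hur)
  rw [hbτ]
  exact mean_pos_of_small hε0 hε1.le hm0 hm1 hs0.le hεQ.1 hεQ.2

/-- For all small rolls, the quadratic form of the linearization is positive on some test
function. -/
theorem IsRollFamily.exists_isTest {b s ε₀ : ℝ} {u : ℝ → ℝ → ℝ → ℝ}
    (hu : IsRollFamily b s ε₀ u) (hb : b ≠ 0) (hs : 0 < 27 * s - 38 * b ^ 2) :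
    ∃ ε₁ ∈ Ioc 0 ε₀, ε₁ ≤ 1 / 2 ∧ ∀ ε ∈ Ioo 0 ε₁, ∀ ω ∈ Ioo (-(1 / 2) : ℝ) (1 / 2),
      ∃ φ : Plane → ℝ, IsTest φ ∧
        ∫ p, opA ε ω φ p ^ 2 < ∫ p, reactionDeriv b s ε (u ε ω (p 0)) * φ p ^ 2 := by
  obtain ⟨τ, h, h', hτ, hbτ, hh, hsq, hd, hd', hb1, hb1'⟩ : ∃ (τ : ℝ) (h h' : ℝ → ℝ), |τ| = 1 ∧
      b * τ = |b| ∧ ContDiff ℝ (⊤ : ℕ∞) h ∧ (∀ x, h x ^ 2 = (1 + τ * Real.cos x) / 2) ∧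
      (∀ x, HasDerivAt h (h' x) x) ∧ (∀ x, HasDerivAt h' (-(1 / 4) * h x) x) ∧
      (∀ x, |h x| ≤ 1) ∧ ∀ x, |h' x| ≤ 1 := by
    have dc : ∀ x : ℝ, HasDerivAt (fun x : ℝ => Real.cos (x / 2)) (-(1 / 2) * Real.sin (x / 2)) x :=
      fun x => (hasDerivAt_comp_div Real.differentiable_cos 2 x).congr_deriv
        (by rw [Real.deriv_cos]; ring)
    have ds : ∀ x : ℝ, HasDerivAt (fun x : ℝ => Real.sin (x / 2)) (1 / 2 * Real.cos (x / 2)) x :=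
      fun x => (hasDerivAt_comp_div Real.differentiable_sin 2 x).congr_deriv
        (by rw [Real.deriv_sin]; ring)
    have hx : ∀ x : ℝ, Real.cos x = 2 * Real.cos (x / 2) ^ 2 - 1 := fun x => by
      rw [← Real.cos_two_mul]; ring_nf
    rcases hb.lt_or_gt with h0 | h0
    · refine ⟨-1, fun x => Real.sin (x / 2), fun x => 1 / 2 * Real.cos (x / 2), by simp,
        by rw [abs_of_neg h0]; ring, by fun_prop, fun x => ?_, ds, fun x => ?_,
        fun x => Real.abs_sin_le_one _, fun x => ?_⟩
      · simp only [Real.sin_sq, hx x]; ring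
      · exact ((dc x).const_mul (1 / 2)).congr_deriv (by ring)
      · rw [abs_mul]
        have := Real.abs_cos_le_one (x / 2)
        rw [abs_of_pos (by norm_num : (0 : ℝ) < 1 / 2)]; linarith
    · refine ⟨1, fun x => Real.cos (x / 2), fun x => -(1 / 2) * Real.sin (x / 2), by simp,
        by rw [abs_of_pos h0]; ring, by fun_prop, fun x => ?_, dc, fun x => ?_,
        fun x => Real.abs_cos_le_one _, fun x => ?_⟩
      · simp only [hx x]; ring
      · exact ((ds x).const_mul (-(1 / 2))).congr_deriv (by ring)
      · rw [abs_mul]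
        have := Real.abs_sin_le_one (x / 2)
        rw [abs_neg, abs_of_pos (by norm_num : (0 : ℝ) < 1 / 2)]; linarith
  obtain ⟨ε₁, hε₁, h1, hpos⟩ := hu.exists_integral_reactionDeriv_mul_pos hb hs hτ hbτ
  refine ⟨min ε₁ (1 / 2), ⟨lt_min hε₁.1 (by norm_num), (min_le_left _ _).trans hε₁.2⟩,
    min_le_right _ _, fun ε hε ω hω => ?_⟩
  have hε' : ε ∈ Ioo 0 ε₁ := ⟨hε.1, hε.2.trans_le (min_le_left _ _)⟩
  have hε2 : ε < 1 / 2 := hε.2.trans_le (min_le_right _ _)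
  have hsol := hu.solution ε ⟨hε.1, hε'.2.le.trans hε₁.2⟩ ω ⟨hω.1.le, hω.2.le⟩
  refine exists_isTest_integral_opA_sq_lt (h := h) (h' := h')
    (c := fun x => reactionDeriv b s ε (u ε ω x)) ?_ ?_ ?_ ?_ hh ?_ hd hd' hb1 hb1' ?_
  · nlinarith [hε.1, hω.1]
  · nlinarith [hε.1, hω.2]
  · have := hsol.contDiff.continuous
    unfold reactionDeriv
    fun_prop
  · intro x; simp only [hsol.periodic x]
  · intro x; simp only [hsq, Real.cos_add_two_pi]
  · simp_rw [hsq]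
    exact hpos ε hε' ω hω

end GSH

namespace GSH

theorem contDiff_partialDeriv {f : Plane → ℝ} {n : ℕ} (hf : ContDiff ℝ (n + 1 : ℕ) f) (i : Fin 2) :
    ContDiff ℝ n (partialDeriv i f) :=
  (hf.fderiv_right (m := n) (by norm_cast)).clm_apply contDiff_const

theorem contDiff_opA {f : Plane → ℝ} {n : ℕ} (hf : ContDiff ℝ (n + 2 : ℕ) f) (ε ω : ℝ) :
    ContDiff ℝ n (opA ε ω f) := by
  have h : ∀ i, ContDiff ℝ n (partialDeriv i (partialDeriv i f)) := fun i =>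
    contDiff_partialDeriv (contDiff_partialDeriv (n := n + 1) hf i) i
  exact ((hf.of_le (by norm_cast; omega)).add (contDiff_const.mul (h 0))).add (h 1)

theorem integral_add_const_mul_add {f g h : Plane → ℝ} (hf : Integrable f) (hg : Integrable g)
    (hh : Integrable h) (c : ℝ) :
    ∫ p, (f p + c * g p + h p) = (∫ p, f p) + c * (∫ p, g p) + ∫ p, h p := by
  rw [integral_add (f := fun p => f p + c * g p) (hf.add (hg.const_mul c)) hh,
    integral_add hf (hg.const_mul c), integral_const_mul]

namespace IsTest

variable {φ f : Plane → ℝ}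

theorem integrable_mul (hφ : IsTest φ) (hf : Continuous f) : Integrable fun p => f p * φ p :=
  (hf.mul hφ.smooth.continuous).integrable_of_hasCompactSupport hφ.compact.mul_left

theorem integral_mul_partialDeriv (hφ : IsTest φ) (hf : ContDiff ℝ 1 f) (i : Fin 2) :
    ∫ p, f p * GSH.partialDeriv i φ p = -∫ p, GSH.partialDeriv i f p * φ p := by
  refine integral_mul_fderiv_eq_neg_fderiv_mul_of_integrable ?_ ?_ ?_ ?_ ?_
  · exact hφ.integrable_mul (contDiff_partialDeriv (n := 0) hf i).continuous
  · exact (hφ.partialDeriv i).integrable_mul hf.continuous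
  · exact hφ.integrable_mul hf.continuous
  · exact fun x _ => hf.differentiable one_ne_zero x
  · exact fun x _ => hφ.smooth.differentiable (by simp) x

theorem integral_mul_partialDeriv_partialDeriv (hφ : IsTest φ) (hf : ContDiff ℝ 2 f) (i : Fin 2) :
    ∫ p, f p * GSH.partialDeriv i (GSH.partialDeriv i φ) p =
      ∫ p, GSH.partialDeriv i (GSH.partialDeriv i f) p * φ p := by
  rw [(hφ.partialDeriv i).integral_mul_partialDeriv (hf.of_le (by norm_num)),
    hφ.integral_mul_partialDeriv (contDiff_partialDeriv (n := 1) hf i), neg_neg]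

theorem integral_mul_opA (hφ : IsTest φ) (hf : ContDiff ℝ 2 f) (ε ω : ℝ) :
    ∫ p, f p * GSH.opA ε ω φ p = ∫ p, GSH.opA ε ω f p * φ p := by
  have hc : ∀ i, Continuous (GSH.partialDeriv i (GSH.partialDeriv i f)) := fun i =>
    (contDiff_partialDeriv (n := 0) (contDiff_partialDeriv (n := 1) hf i) i).continuous
  have hfc := hf.continuous
  have h0 := (hφ.partialDeriv 0).partialDeriv 0
  have h1 := (hφ.partialDeriv 1).partialDeriv 1
  have e1 : ∀ p, f p * GSH.opA ε ω φ p = f p * φ p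
      + (1 + 2 * ε * ω) * (f p * GSH.partialDeriv 0 (GSH.partialDeriv 0 φ) p)
      + f p * GSH.partialDeriv 1 (GSH.partialDeriv 1 φ) p := fun p => by rw [GSH.opA]; ring
  have e2 : ∀ p, GSH.opA ε ω f p * φ p = f p * φ p
      + (1 + 2 * ε * ω) * (GSH.partialDeriv 0 (GSH.partialDeriv 0 f) p * φ p)
      + GSH.partialDeriv 1 (GSH.partialDeriv 1 f) p * φ p := fun p => by rw [GSH.opA]; ring
  simp_rw [e1, e2]
  rw [integral_add_const_mul_add (hφ.integrable_mul hfc) (h0.integrable_mul hfc)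
      (h1.integrable_mul hfc), integral_add_const_mul_add (hφ.integrable_mul hfc)
      (hφ.integrable_mul (hc 0)) (hφ.integrable_mul (hc 1)),
    hφ.integral_mul_partialDeriv_partialDeriv hf, hφ.integral_mul_partialDeriv_partialDeriv hf]

end IsTest

theorem lintegral_sobWeight_sq_le_of_norm_le {k : ℝ} (hk : 1 / 2 ≤ k) {u : RL2} {M B : ℝ}
    (hM : ‖u‖ ≤ M) (hB : ∀ m, ‖(swTrunc k m).mult u‖ ≤ B) :
    ∫⁻ ξ, ENNReal.ofReal (sobWeight ξ ^ 2) * ‖hat u ξ‖ₑ ^ 2 ≤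
      ENNReal.ofReal ‖u‖ * (ENNReal.ofReal (18 ^ 2 * (M + B) ^ 2)) ^ (1 / 2 : ℝ) := by
  have hB0 : 0 ≤ B := (norm_nonneg _).trans (hB 0)
  refine (lintegral_sobWeight_sq_interpolation u).trans ?_
  gcongr
  refine (lintegral_sobWeight_pow_four_le hk hB).trans (ENNReal.ofReal_le_ofReal ?_)
  gcongr

/-- A bounded weak solution of the equation for the perturbation gives a solution around the
stationary state. -/
theorem isSolution_of_weak {b s ε ω T R B : ℝ} {U : Plane → ℝ} (hk : 1 / 2 ≤ 1 + 2 * ε * ω)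
    (hU : ContDiff ℝ 4 U)
    (hstat : ∀ p, -(opA ε ω (opA ε ω U) p) + reaction b s ε (U p) = 0) {L : NNReal}
    (hg : IsNemytskii (truncReaction b s ε R U) L) {v : ℝ → RL2} (hv : ContinuousOn v (Icc 0 T))
    (hB : ∀ t ∈ Icc 0 T, ∀ m, ‖(swTrunc (1 + 2 * ε * ω) m).mult (v t)‖ ≤ B)
    (hR : ∀ t ∈ Icc 0 T, ∀ᵐ p, |v t p| ≤ R)
    (hweak : ∀ φ ψ : RL2, Tendsto (fun n => (lowPass n).mult φ) atTop (𝓝 φ) →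
      Tendsto (fun n => (swTrunc (1 + 2 * ε * ω) n).mult φ) atTop (𝓝 ψ) → ∀ t ∈ Icc 0 T,
      HasDerivWithinAt (fun τ => inner ℝ (v τ) φ) (-inner ℝ (v t) ψ + inner ℝ (hg.op (v t)) φ)
        (Icc 0 T) t) :
    IsSolution b s ε ω U T fun t p => U p + v t p := by
  obtain ⟨M, hM⟩ := isCompact_Icc.exists_bound_of_continuousOn hv
  have hUc : Continuous U := hU.continuous
  refine ⟨fun t ht => ?_, fun t₀ ht₀ => ?_, fun φ hφs hφc t ht => ?_⟩
  · rw [sobolevENorm_eq 2 (v t) (Eventually.of_forall fun p => by simp)]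
    refine ENNReal.rpow_lt_top_of_nonneg (by norm_num) (ne_of_lt ?_)
    refine (lintegral_sobWeight_sq_le_of_norm_le hk (hM t ht) (hB t ht)).trans_lt ?_
    exact ENNReal.mul_lt_top ENNReal.ofReal_lt_top
      (ENNReal.rpow_lt_top_of_nonneg (by norm_num) ENNReal.ofReal_ne_top)
  · set D : ℝ≥0∞ := (ENNReal.ofReal (18 ^ 2 * ((M + M) + (B + B)) ^ 2)) ^ (1 / 2 : ℝ) with hD
    have hDtop : D ≠ ∞ := ENNReal.rpow_ne_top_of_nonneg (by norm_num) ENNReal.ofReal_ne_top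
    have hlim : Tendsto (fun t => (ENNReal.ofReal ‖v t - v t₀‖ * D) ^ (1 / 2 : ℝ))
        (𝓝[Icc 0 T] t₀) (𝓝 0) := by
      have h1 : Tendsto (fun t => ‖v t - v t₀‖) (𝓝[Icc 0 T] t₀) (𝓝 0) :=
        tendsto_iff_norm_sub_tendsto_zero.1 (hv t₀ ht₀)
      have h2 := ENNReal.Tendsto.mul_const (b := D) (ENNReal.tendsto_ofReal h1) (Or.inr hDtop)
      have h3 := (ENNReal.continuous_rpow_const (y := (1 / 2 : ℝ))).tendsto _ |>.comp h2
      simpa [Function.comp_def] using h3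
    refine tendsto_of_tendsto_of_tendsto_of_le_of_le' tendsto_const_nhds hlim
      (Eventually.of_forall fun _ => zero_le) ?_
    filter_upwards [self_mem_nhdsWithin] with t ht
    rw [sobolevENorm_eq 2 (v t - v t₀) (by
      filter_upwards [Lp.coeFn_sub (v t) (v t₀)] with p hp
      simp only [Pi.sub_apply, add_sub_add_left_eq_sub]
      exact hp.symm)]
    refine ENNReal.rpow_le_rpow ?_ (by norm_num)
    refine lintegral_sobWeight_sq_le_of_norm_le hk
      ((norm_sub_le _ _).trans (add_le_add (hM t ht) (hM t₀ ht₀))) fun m => ?_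
    rw [map_sub]
    exact (norm_sub_le _ _).trans (add_le_add (hB t ht m) (hB t₀ ht₀ m))
  · have hφ : IsTest φ := ⟨hφs, hφc⟩
    set χ := opA ε ω (opA ε ω φ) with hχ
    have hχt : IsTest χ := (hφ.opA ε ω).opA ε ω
    have hin : ∀ (w : RL2) {ψ : Plane → ℝ} (hψ : IsTest ψ), inner ℝ w hψ.toL2 = ∫ p, w p * ψ p := by
      intro w ψ hψ
      rw [L2.inner_def]
      refine integral_congr_ae ?_
      filter_upwards [hψ.coeFn_toL2] with p hp
      simp [hp, mul_comm]
    have hint : ∀ (w : RL2) {ψ : Plane → ℝ} (hψ : IsTest ψ), Integrable fun p => w p * ψ p := by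
      intro w ψ hψ
      refine (L2.integrable_inner (𝕜 := ℝ) w hψ.toL2).congr ?_
      filter_upwards [hψ.coeFn_toL2] with p hp
      simp [hp, mul_comm]
    have h := (hweak hφ.toL2 hχt.toL2 (tendsto_lowPass _) (hφ.tendsto_swTrunc ε ω) t ht).const_add
      (∫ p, U p * φ p)
    have e1 : ∀ τ, ∫ p, (U p + v τ p) * φ p = (∫ p, U p * φ p) + inner ℝ (v τ) hφ.toL2 := by
      intro τ
      simp_rw [add_mul]
      rw [integral_add (hφ.integrable_mul hUc) (hint _ hφ), hin]
    simp_rw [e1]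
    refine h.congr_deriv ?_
    have hrc : Continuous fun p => reaction b s ε (U p) := by unfold reaction; fun_prop
    have e2 : ∫ p, U p * χ p = ∫ p, reaction b s ε (U p) * φ p := by
      rw [hχ, (hφ.opA ε ω).integral_mul_opA (hU.of_le (by norm_num)),
        hφ.integral_mul_opA (contDiff_opA (n := 2) hU ε ω)]
      congr 1; ext p
      have := hstat p
      rw [show opA ε ω (opA ε ω U) p = reaction b s ε (U p) by linarith]
    have e3 : ∀ᵐ p, -((U p + v t p) * χ p) + reaction b s ε (U p + v t p) * φ p =
        -(U p * χ p) + reaction b s ε (U p) * φ p + (-(v t p * χ p) + hg.op (v t) p * φ p) := by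
      filter_upwards [hR t ht, hg.coeFn_op (v t)] with p h1 h2
      rw [h2, truncReaction, clamp_eq h1]
      ring
    have i1 := hχt.integrable_mul hUc
    have i2 := hφ.integrable_mul hrc
    have i3 := hint (v t) hχt
    have i4 := hint (hg.op (v t)) hφ
    rw [integral_congr_ae e3, integral_add
      (f := fun p => -(U p * χ p) + reaction b s ε (U p) * φ p)
      (g := fun p => -(v t p * χ p) + hg.op (v t) p * φ p) (i1.neg.add i2) (i3.neg.add i4),
      integral_add (f := fun p => -(U p * χ p)) i1.neg i2,
      integral_add (f := fun p => -(v t p * χ p)) i3.neg i4, integral_neg, integral_neg, e2, hin, hin]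
    ring

end GSH

namespace SpectralScale

variable {H : Type*} [NormedAddCommGroup H] [InnerProductSpace ℝ H]

theorem A_P_eq (S : SpectralScale H) (m n : ℕ) (u : H) : S.A m (S.P n u) = S.A (min m n) u := by
  rcases le_total m n with h | h
  · rw [min_eq_left h, ← S.A_P (S.P n u) le_rfl, S.P_P u h, S.A_P u le_rfl]
  · rw [min_eq_right h, S.A_P u h]

theorem inner_A_P (S : SpectralScale H) (m n : ℕ) (u : H) :
    inner ℝ (S.A m (S.P n u)) (S.P n u) = inner ℝ (S.A (min m n) u) u := by
  rw [S.A_P_eq, ← S.P_inner, ← S.P_A u le_rfl, S.P_P' _ (min_le_right m n), S.P_A u le_rfl]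

end SpectralScale

namespace GSH

/-- The spectral truncations of a test function. -/
theorem IsTest.exists_lowPass {φ₀ c : Plane → ℝ} {ε ω c₀ : ℝ} (hφ₀ : IsTest φ₀)
    (hk : 1 / 2 ≤ 1 + 2 * ε * ω) (hc : Continuous c) (hc₀ : ∀ p, |c p| ≤ c₀)
    (hlt : ∫ p, GSH.opA ε ω φ₀ p ^ 2 < ∫ p, c p * φ₀ p ^ 2) :
    ∃ (n : ℕ) (φ : RL2) (B E : ℝ), (lowPass n).mult φ = φ ∧
      (∀ m, ‖(swTrunc (1 + 2 * ε * ω) m).mult φ‖ ≤ B) ∧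
      (∀ m, inner ℝ ((swTrunc (1 + 2 * ε * ω) m).mult φ) φ ≤ E) ∧ E < ∫ p, c p * φ p ^ 2 := by
  have hc0 : 0 ≤ c₀ := (abs_nonneg _).trans (hc₀ 0)
  have hg : IsNemytskii (fun p w => c p * w) ⟨c₀, hc0⟩ :=
    { continuous := by unfold Function.uncurry; fun_prop
      lip := fun p => LipschitzWith.of_dist_le_mul fun x y => by
        rw [Real.dist_eq, Real.dist_eq, ← mul_sub, abs_mul]
        exact mul_le_mul_of_nonneg_right (hc₀ p) (abs_nonneg _)
      zero := fun p => mul_zero _ }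
  have hG : ∀ u : RL2, inner ℝ (hg.op u) u = ∫ p, c p * u p ^ 2 := fun u => by
    rw [hg.inner_op]; congr 1; ext p; ring
  have hcont : Continuous fun u : RL2 => ∫ p, c p * u p ^ 2 := by
    simp_rw [← hG]
    exact hg.lipschitz_op.continuous.inner continuous_id
  have hlim := (hcont.tendsto hφ₀.toL2).comp (tendsto_lowPass hφ₀.toL2)
  have e : ∫ p, c p * hφ₀.toL2 p ^ 2 = ∫ p, c p * φ₀ p ^ 2 := by
    refine integral_congr_ae ?_
    filter_upwards [hφ₀.coeFn_toL2] with p hp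
    rw [hp]
  rw [e] at hlim
  obtain ⟨n, hn⟩ := (hlim.eventually (lt_mem_nhds hlt)).exists
  set S := swScale _ hk with hS
  refine ⟨n, (lowPass n).mult hφ₀.toL2, ‖((hφ₀.opA ε ω).opA ε ω).toL2‖, _, S.P_P _ le_rfl,
    fun m => ?_, fun m => ?_, hn⟩
  · have h : (swTrunc (1 + 2 * ε * ω) m).mult ((lowPass n).mult hφ₀.toL2) =
        (swTrunc (1 + 2 * ε * ω) (min m n)).mult hφ₀.toL2 := S.A_P_eq m n _
    rw [h, hφ₀.swTrunc_mult]
    exact S.norm_P_le _ _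
  · have h : inner ℝ ((swTrunc (1 + 2 * ε * ω) m).mult ((lowPass n).mult hφ₀.toL2))
        ((lowPass n).mult hφ₀.toL2) =
        inner ℝ ((swTrunc (1 + 2 * ε * ω) (min m n)).mult hφ₀.toL2) hφ₀.toL2 := S.inner_A_P m n _
    rw [h]
    exact hφ₀.swTrunc_inner_le ε ω _

theorem cubicConst_nonneg {b s U₀ : ℝ} (hU₀ : 0 ≤ U₀) : 0 ≤ cubicConst b s U₀ := by
  unfold cubicConst; positivity

/-- The cubic remainder of the potential at small amplitudes. -/
theorem abs_potential_sub_le {b s ε R U₀ a : ℝ} {U : Plane → ℝ} {L : NNReal} (hUc : Continuous U)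
    (hU₀ : ∀ p, |U p| ≤ U₀) (hg : IsNemytskii (truncReaction b s ε R U) L) {u : RL2}
    (hu : ∀ᵐ p, |u p| ≤ a) (ha : a ≤ 1) (hR : 1 ≤ R) :
    |inner ℝ (hg.op u) u - 2 * hg.potential u| ≤ cubicConst b s U₀ * a * ‖u‖ ^ 2 ∧
    |2 * hg.potential u - ∫ p, reactionDeriv b s ε (U p) * u p ^ 2| ≤
      cubicConst b s U₀ * a * ‖u‖ ^ 2 := by
  have hU0 : 0 ≤ U₀ := (abs_nonneg _).trans (hU₀ 0)
  have hcub := cubicConst_nonneg (b := b) (s := s) hU0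
  have hsq := (Lp.memLp u).integrable_sq
  have hbd : ∀ᵐ p, |truncReaction b s ε R U p (u p) * u p - 2 * hg.prim p (u p)| ≤
      cubicConst b s U₀ * a * u p ^ 2 ∧
      |2 * hg.prim p (u p) - reactionDeriv b s ε (U p) * u p ^ 2| ≤
        cubicConst b s U₀ * a * u p ^ 2 := by
    filter_upwards [hu] with p hp
    have h := abs_truncReaction_mul_sub_le hU₀ hg (p := p) (hp.trans (ha.trans hR)) (hp.trans ha)
    have h3 : cubicConst b s U₀ * |u p| ^ 3 ≤ cubicConst b s U₀ * a * u p ^ 2 := by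
      rw [mul_assoc, ← sq_abs (u p), pow_succ' |u p| 2]; gcongr
    exact ⟨h.1.trans h3, h.2.trans h3⟩
  have hder : Integrable fun p => reactionDeriv b s ε (U p) * u p ^ 2 := by
    refine hsq.bdd_mul (c := ε ^ 2 + 2 * |b| * U₀ + 3 * |s| * U₀ ^ 2) ?_
      (Eventually.of_forall fun p => ?_)
    · have : Continuous fun p => reactionDeriv b s ε (U p) := by unfold reactionDeriv; fun_prop
      exact this.aestronglyMeasurable
    · unfold reactionDeriv
      have h1 := hU₀ p
      have h2 : |2 * b * U p| ≤ 2 * |b| * U₀ := by rw [abs_mul, abs_mul, abs_two]; gcongr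
      have h3 : |3 * s * U p ^ 2| ≤ 3 * |s| * U₀ ^ 2 := by
        rw [abs_mul, abs_mul, abs_of_pos (by norm_num : (0 : ℝ) < 3), abs_pow]; gcongr
      rw [Real.norm_eq_abs]
      refine (abs_sub _ _).trans (add_le_add ((abs_add_le _ _).trans (add_le_add ?_ h2)) h3)
      rw [abs_of_nonneg (sq_nonneg ε)]
  have hp := (hg.integrable_prim u).const_mul 2
  rw [IsNemytskii.potential, ← integral_const_mul, hg.inner_op, IsNemytskii.norm_sq_eq_integral,
    ← integral_const_mul, ← integral_sub (hg.integrable_op_mul u u) hp, ← integral_sub hp hder]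
  constructor
  · exact (abs_integral_le_integral_abs).trans (integral_mono_ae
      ((hg.integrable_op_mul u u).sub hp).abs (hsq.const_mul _) (hbd.mono fun _ h => h.1))
  · exact (abs_integral_le_integral_abs).trans (integral_mono_ae
      (hp.sub hder).abs (hsq.const_mul _) (hbd.mono fun _ h => h.2))

/-- The amplitude bound for functions whose quadratic form is controlled by the `L²` norm. -/
theorem ae_abs_le_mul_norm {k K : ℝ} (hk : 1 / 2 ≤ k) (hK : 0 ≤ K) {n : ℕ} {u : RL2}
    (hP : (lowPass n).mult u = u) (h : inner ℝ ((swTrunc k n).mult u) u ≤ K * ‖u‖ ^ 2) :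
    ∀ᵐ p, |u p| ≤ (sobConst.toReal * √(18 * (1 + K)) + 1) * ‖u‖ := by
  have hB : ∀ m, inner ℝ ((swTrunc k m).mult u) u ≤ K * ‖u‖ ^ 2 := by
    intro m
    have h1 := (swScale k hk).inner_A_P m n u
    have h2 := (swScale k hk).A_mono u (min_le_right m n)
    change inner ℝ ((swTrunc k m).mult ((lowPass n).mult u)) ((lowPass n).mult u) = _ at h1
    rw [hP] at h1
    rw [h1]
    exact h2.trans h
  filter_upwards [ae_abs_le_of_form_le hk hB] with p hp
  refine hp.trans ?_
  rw [show 18 * (‖u‖ ^ 2 + K * ‖u‖ ^ 2) = 18 * (1 + K) * ‖u‖ ^ 2 by ring,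
    Real.sqrt_mul (by positivity), Real.sqrt_sq (norm_nonneg u), ← mul_assoc]
  gcongr
  linarith

theorem sobolevENorm_smul_le {k : ℕ} {φ : RL2} {c M : ℝ} (hc : 0 ≤ c) {f : Plane → ℝ}
    (hf : f =ᵐ[volume] (c • φ : RL2)) (hM : 0 ≤ M)
    (h : ∫⁻ ξ, ENNReal.ofReal (sobWeight ξ ^ k) * ‖hat φ ξ‖ₑ ^ 2 ≤ ENNReal.ofReal (M ^ 2)) :
    sobolevENorm k f ≤ ENNReal.ofReal (c * M) := by
  rw [sobolevENorm_eq k _ hf]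
  have e : ∫⁻ ξ, ENNReal.ofReal (sobWeight ξ ^ k) * ‖hat (c • φ) ξ‖ₑ ^ 2 =
      ENNReal.ofReal (c ^ 2) * ∫⁻ ξ, ENNReal.ofReal (sobWeight ξ ^ k) * ‖hat φ ξ‖ₑ ^ 2 := by
    rw [← lintegral_const_mul' _ _ ENNReal.ofReal_ne_top, hat_smul]
    refine lintegral_congr_ae ?_
    filter_upwards [Lp.coeFn_smul (c : ℂ) (hat φ)] with ξ hξ
    rw [hξ, Pi.smul_apply, enorm_smul, mul_pow, ENNReal.ofReal_pow hc,
      show ‖(c : ℂ)‖ₑ = ENNReal.ofReal c by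
        rw [← ofReal_norm, Complex.norm_real, Real.norm_of_nonneg hc]]
    ring
  rw [e]
  calc _ ≤ (ENNReal.ofReal (c ^ 2) * ENNReal.ofReal (M ^ 2)) ^ (1 / 2 : ℝ) := by gcongr
    _ = ENNReal.ofReal (c * M) := by
      rw [← ENNReal.ofReal_mul (sq_nonneg c), ← mul_pow,
        ENNReal.ofReal_rpow_of_nonneg (by positivity) (by norm_num), ← Real.sqrt_eq_rpow,
        Real.sqrt_sq (by positivity)]

/-- The solutions which grow out of small multiples of a fixed perturbation of the stationary state
`U`, on which the quadratic form of the linearization is positive. -/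
theorem exists_growing_solutions {b s ε ω U₀ : ℝ} {U φ₀ : Plane → ℝ} (hs : 0 < s)
    (hk : 1 / 2 ≤ 1 + 2 * ε * ω) (hU : ContDiff ℝ 4 U) (hU₀ : ∀ p, |U p| ≤ U₀)
    (hstat : ∀ p, -(opA ε ω (opA ε ω U) p) + reaction b s ε (U p) = 0) (hφ₀ : IsTest φ₀)
    (hlt : ∫ p, opA ε ω φ₀ p ^ 2 < ∫ p, reactionDeriv b s ε (U p) * φ₀ p ^ 2) :
    ∃ θ > 0, ∃ M > 0, ∃ a > 0, ∃ K > 0, ∃ K' > 0, ∃ η₀ > 0, ∀ η ∈ Ioc 0 η₀, η * a < θ ∧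
      ∃ T, 1 / K * Real.log (θ / (η * a)) ≤ T ∧ T ≤ K' * Real.log (θ / (η * a)) ∧
        ∃ V : ℝ → Plane → ℝ, IsSolution b s ε ω U T V ∧
          sobolevENorm 4 (V 0 - U) ≤ ENNReal.ofReal (η * M) ∧
          ENNReal.ofReal θ ≤ eLpNorm (V T - U) 2 volume := by
  have hUc := hU.continuous
  have hU0 : 0 ≤ U₀ := (abs_nonneg _).trans (hU₀ 0)
  have hcc : Continuous fun p => reactionDeriv b s ε (U p) := by unfold reactionDeriv; fun_prop
  have hcb : ∀ p, |reactionDeriv b s ε (U p)| ≤ ε ^ 2 + 2 * |b| * U₀ + 3 * |s| * U₀ ^ 2 := by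
    intro p
    have h1 := hU₀ p
    have h2 : |2 * b * U p| ≤ 2 * |b| * U₀ := by rw [abs_mul, abs_mul, abs_two]; gcongr
    have h3 : |3 * s * U p ^ 2| ≤ 3 * |s| * U₀ ^ 2 := by
      rw [abs_mul, abs_mul, abs_of_pos (by norm_num : (0 : ℝ) < 3), abs_pow]; gcongr
    unfold reactionDeriv
    refine (abs_sub _ _).trans (add_le_add ((abs_add_le _ _).trans (add_le_add ?_ h2)) h3)
    rw [abs_of_nonneg (sq_nonneg ε)]
  obtain ⟨n₀, φ, B, E, hPφ, hBφ, hEφ, hE⟩ := hφ₀.exists_lowPass hk hcc hcb hlt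
  set k := 1 + 2 * ε * ω with hkdef
  set S := swScale k hk with hS
  set I := ∫ p, reactionDeriv b s ε (U p) * φ p ^ 2 with hI
  have hB0 : 0 ≤ B := (norm_nonneg _).trans (hBφ 0)
  have hE0 : 0 ≤ E := (S.A_nonneg 0 φ).trans (hEφ 0)
  have hφ : φ ≠ 0 := by
    rintro rfl
    have : I = 0 := by
      rw [hI, integral_eq_zero_of_ae]
      filter_upwards [Lp.coeFn_zero ℝ 2 (volume : Measure Plane)] with p hp
      rw [hp]; simp
    linarith
  have ha : 0 < ‖φ‖ := norm_pos_iff.2 hφ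
  set mφ := sobConst.toReal * √(18 * (‖φ‖ ^ 2 + E)) with hmφ
  have hmφ0 : 0 ≤ mφ := by positivity
  have hφm : ∀ᵐ p, |φ p| ≤ mφ := ae_abs_le_of_form_le hk hEφ
  set cub := cubicConst b s U₀ with hcub
  have hcub0 : 0 ≤ cub := cubicConst_nonneg hU0
  set K := reactionConst b s ε with hKdef
  have hK1 : 1 ≤ K := one_le_reactionConst hs
  have hK0 : 0 < K := by linarith
  set κ := I - E with hκ
  have hκ0 : 0 < κ := by rw [hκ]; linarith
  set q := κ / (2 * ‖φ‖ ^ 2) with hq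
  have hq0 : 0 < q := by positivity
  set CS := sobConst.toReal * √(18 * (1 + K)) + 1 with hCS
  have hCS0 : 0 < CS := by positivity
  set C := cub * CS with hC
  have hC0 : 0 ≤ C := by positivity
  set θ := min (1 / CS) (q / (9 * C + 9)) with hθ
  have hθ0 : 0 < θ := by positivity
  have hθq : 9 * C * θ < q := by
    have h1 : θ * (9 * C + 9) ≤ q := (le_div_iff₀ (by positivity)).1 (min_le_right _ _)
    nlinarith
  set η₀ := min (1 / (mφ + 1)) (min (κ / (2 * (cub * mφ * ‖φ‖ ^ 2 + 1))) (θ / (2 * ‖φ‖))) with hη₀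
  refine ⟨θ, hθ0, 18 * (‖φ‖ + B), by positivity, ‖φ‖, ha, K, hK0, 2 / q, by positivity, η₀,
    by positivity, fun η hη => ?_⟩
  have hη0 : 0 < η := hη.1
  have hη1 : η * mφ ≤ 1 := by
    have := (le_div_iff₀ (by positivity)).1 (hη.2.trans (min_le_left _ _))
    nlinarith
  have hη2 : η * (cub * mφ * ‖φ‖ ^ 2) ≤ κ / 2 := by
    have := (le_div_iff₀ (by positivity)).1
      (hη.2.trans ((min_le_right _ _).trans (min_le_left _ _)))
    nlinarith
  have hη3 : η * ‖φ‖ < θ := by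
    have := (le_div_iff₀ (by positivity)).1
      (hη.2.trans ((min_le_right _ _).trans (min_le_right _ _)))
    nlinarith
  refine ⟨hη3, ?_⟩
  have hηa : 0 < η * ‖φ‖ := by positivity
  set v₀ : RL2 := η • φ with hv₀
  have hv₀n : ‖v₀‖ = η * ‖φ‖ := by rw [hv₀, norm_smul, Real.norm_of_nonneg hη0.le]
  have hv₀m : ∀ᵐ p, |v₀ p| ≤ η * mφ := by
    filter_upwards [hφm, Lp.coeFn_smul η φ] with p h1 h2
    rw [h2, Pi.smul_apply, smul_eq_mul, abs_mul, abs_of_pos hη0]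
    gcongr
  set Λ := Real.log (θ / (η * ‖φ‖)) with hΛ
  have hΛ0 : 0 < Λ := Real.log_pos ((one_lt_div hηa).2 hη3)
  set T' := 2 / q * Λ with hT'
  have hT'0 : 0 ≤ T' := by positivity
  have hPv₀ : S.P n₀ v₀ = v₀ := by rw [hv₀, map_smul]; exact congrArg _ hPφ
  obtain ⟨L₁, hg₁⟩ := isNemytskii_truncReaction b s ε zero_le_one hUc hU₀
  set B₁ := (‖S.A n₀ v₀‖ + ‖hg₁.op v₀‖ + K * ‖v₀‖) * ‖v₀‖ * Real.exp (K * T') ^ 2 with hB₁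
  set R := max 1 (sobConst.toReal * √(18 * ((‖v₀‖ * Real.exp (K * T')) ^ 2 + B₁))) with hR
  have hR1 : 1 ≤ R := le_max_left _ _
  obtain ⟨L, hg⟩ := isNemytskii_truncReaction b s ε (zero_le_one.trans hR1) hUc hU₀
  have hop : hg.op v₀ = hg₁.op v₀ := by
    refine Lp.ext ?_
    filter_upwards [hg.coeFn_op v₀, hg₁.coeFn_op v₀, hv₀m] with p h1 h2 h3
    rw [h1, h2, truncReaction, truncReaction, clamp_eq ((h3.trans hη1).trans hR1),
      clamp_eq (h3.trans hη1)]
  have hN : IsOneSidedLipschitz hg.op K :=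
    hg.isOneSidedLipschitz hK1 fun p x y => truncReaction_mul_le ε R hs U p x y
  obtain ⟨v, hv0, hvc, hvK, hvE, ⟨Bv, hvB⟩, hvw, hvθ⟩ := S.exists_weak_solution hN hPv₀ hT'0
  rw [hop] at hvE
  obtain ⟨T, hT, hθT⟩ := hvθ θ fun n hn w hw hw0 => by
    have hw0' : ‖w 0‖ = η * ‖φ‖ := by rw [hw0, hv₀n]
    refine hw.exists_norm_ge hN (Ψ := hg.potential) (C := C) (ρ := 1 / CS) (q := q)
      hg.hasGradientAt_potential (hg.potential_le fun p x => ?_) hC0 hq0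
      (fun u hPu hAu hu => ?_) hθ0 (min_le_left _ _) hθq ?_ ?_ hT'0 ?_
    · have := truncReaction_mul_le (b := b) ε R hs U p x 0
      simpa [hg.zero] using this
    · have h1 := ae_abs_le_mul_norm hk hK0.le hPu hAu
      have h2 := (abs_potential_sub_le hUc hU₀ hg h1 (by
        rw [le_div_iff₀ hCS0] at hu; linarith) hR1).1
      refine h2.trans (le_of_eq ?_)
      rw [hC]; ring
    · rw [← norm_pos_iff, hw0']; exact hηa
    · rw [hw0, hv₀n]
      have h1 := (abs_potential_sub_le hUc hU₀ hg hv₀m hη1 hR1).2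
      have h2 : ∫ p, reactionDeriv b s ε (U p) * v₀ p ^ 2 = η ^ 2 * I := by
        rw [hI, ← integral_const_mul]
        refine integral_congr_ae ?_
        filter_upwards [Lp.coeFn_smul η φ] with p hp
        rw [hv₀, hp, Pi.smul_apply, smul_eq_mul]; ring
      have h3 : inner ℝ (S.A n v₀) v₀ ≤ η ^ 2 * E := by
        rw [hv₀, map_smul, inner_smul_left, inner_smul_right]
        have := mul_le_mul_of_nonneg_left (hEφ n) (sq_nonneg η)
        calc _ = η ^ 2 * inner ℝ ((swTrunc k n).mult φ) φ := by
              rw [conj_trivial, sq, mul_assoc]; rfl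
          _ ≤ _ := this
      rw [h2, hv₀n] at h1
      have h4 := (abs_le.1 h1).1
      have h5 : q * (η * ‖φ‖) ^ 2 = η ^ 2 * κ / 2 := by rw [hq]; field_simp
      have h6 := mul_le_mul_of_nonneg_left hη2 (sq_nonneg η)
      have h7 : cub * (η * mφ) * (η * ‖φ‖) ^ 2 = η ^ 2 * (η * (cub * mφ * ‖φ‖ ^ 2)) := by ring
      rw [h7] at h4
      have h8 : η ^ 2 * κ = η ^ 2 * I - η ^ 2 * E := by rw [hκ]; ring
      linarith
    · rw [hw0', hT', show q * (2 / q * Λ) = Λ + Λ by field_simp; ring, Real.exp_add, hΛ,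
        Real.exp_log (div_pos hθ0 hηa)]
      refine le_of_eq ?_
      field_simp
  have hsub : Icc 0 T ⊆ Icc 0 T' := Icc_subset_Icc_right hT.2
  refine ⟨T, ?_, hT.2, fun t p => U p + v t p, ?_, ?_, ?_⟩
  · have h1 := hθT.trans (hvK T hT)
    rw [hv₀n, mul_comm, ← div_le_iff₀ hηa] at h1
    have h2 := Real.log_le_log (div_pos hθ0 hηa) h1
    rw [Real.log_exp] at h2
    rw [one_div, inv_mul_le_iff₀ hK0]
    exact h2
  · refine isSolution_of_weak hk hU hstat hg (hvc.mono hsub) (fun t ht => hvB t (hsub ht))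
      (fun t ht => ?_) fun φ ψ h1 h2 t ht => (hvw φ ψ h1 h2 t (hsub ht)).mono hsub
    filter_upwards [ae_abs_le_of_form_le hk (hvE t (hsub ht))] with p hp
    refine hp.trans (le_trans ?_ (le_max_right _ _))
    have h1 : ‖v t‖ ≤ ‖v₀‖ * Real.exp (K * T') := by
      refine (hvK t (hsub ht)).trans ?_
      have := (hsub ht).2
      gcongr
    gcongr
  · have h := lintegral_sobWeight_pow_four_le hk hBφ
    rw [← mul_pow] at h
    refine sobolevENorm_smul_le (φ := φ) hη0.le ?_ (by positivity) h
    refine Eventually.of_forall fun p => ?_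
    simp [hv0, hv₀]
  · have e : (fun p => U p + v T p) - U = v T := by ext p; simp
    rw [e, ← Lp.enorm_def, ← ofReal_norm]
    exact ENNReal.ofReal_le_ofReal hθT

end GSH

namespace GSH

theorem IsEvenStationary.contDiff_extend_and_bounded {b s ε ω : ℝ} {u : ℝ → ℝ}
    (hu : IsEvenStationary b s ε ω u) :
    ContDiff ℝ 4 (extend u) ∧ ∃ U₀, ∀ p, |extend u p| ≤ U₀ := by
  refine ⟨hu.contDiff.comp (EuclideanSpace.proj 0 : Plane →L[ℝ] ℝ).contDiff, ?_⟩
  obtain ⟨U₀, hU₀⟩ := (isCompact_Icc (a := (0 : ℝ)) (b := 2 * Real.pi)).exists_bound_of_continuousOn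
    hu.contDiff.continuous.continuousOn
  refine ⟨U₀, fun p => ?_⟩
  obtain ⟨y, hy, hxy⟩ := (show Function.Periodic u (2 * Real.pi) from hu.periodic).exists_mem_Ico₀
    Real.two_pi_pos (p 0)
  rw [extend, hxy]
  exact hU₀ y (Ico_subset_Icc_self hy)

theorem isTheta_abs_log_of_le {T : ℝ → ℝ} {c K K' δ₀ : ℝ} (hc : 0 < c) (hK : 0 < K) (hK' : 0 < K')
    (hδ₀ : 0 < δ₀) (h : ∀ δ, 0 < δ → δ ≤ δ₀ → 0 ≤ Real.log (c / δ) ∧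
      1 / K * Real.log (c / δ) ≤ T δ ∧ T δ ≤ K' * Real.log (c / δ)) :
    T =Θ[𝓝[>] 0] fun δ => |Real.log δ| := by
  have hlarge : ∀ᶠ δ in 𝓝[>] (0 : ℝ), 2 * |Real.log c| + 1 ≤ |Real.log δ| :=
    (tendsto_abs_atBot_atTop.comp Real.tendsto_log_nhdsGT_zero).eventually_ge_atTop _
  have hsmall : ∀ᶠ δ in 𝓝[>] (0 : ℝ), δ ≤ min δ₀ 1 :=
    nhdsWithin_le_nhds (Iic_mem_nhds (lt_min hδ₀ one_pos))
  have hev : ∀ᶠ δ in 𝓝[>] (0 : ℝ), 0 ≤ T δ ∧ T δ ≤ 2 * K' * |Real.log δ| ∧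
      |Real.log δ| ≤ 2 * K * T δ := by
    filter_upwards [hlarge, hsmall, self_mem_nhdsWithin] with δ h1 h2 h3
    have h3 : 0 < δ := h3
    obtain ⟨g0, g1, g2⟩ := h δ h3 (h2.trans (min_le_left _ _))
    have hlog : Real.log δ ≤ 0 := Real.log_nonpos h3.le (h2.trans (min_le_right _ _))
    rw [abs_of_nonpos hlog] at h1 ⊢
    rw [Real.log_div hc.ne' h3.ne'] at g0 g1 g2
    have a1 := le_abs_self (Real.log c)
    have a2 := neg_abs_le (Real.log c)
    have a3 := abs_nonneg (Real.log c)
    refine ⟨le_trans (by positivity) g1, g2.trans ?_, ?_⟩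
    · have : Real.log c - Real.log δ ≤ 2 * -Real.log δ := by linarith
      nlinarith
    · rw [one_div, inv_mul_le_iff₀ hK] at g1
      linarith
  constructor
  · refine IsBigO.of_bound (2 * K') ?_
    filter_upwards [hev] with δ h1
    rw [Real.norm_of_nonneg h1.1, Real.norm_of_nonneg (abs_nonneg _)]
    exact h1.2.1
  · refine IsBigO.of_bound (2 * K) ?_
    filter_upwards [hev] with δ h1
    rw [Real.norm_of_nonneg h1.1, Real.norm_of_nonneg (abs_nonneg _)]
    exact h1.2.2

theorem IsRollFamily.nonlinear_instability {b s ε₀ : ℝ} {u : ℝ → ℝ → ℝ → ℝ}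
    (hu : IsRollFamily b s ε₀ u) (hb : b ≠ 0) (hs : 0 < 27 * s - 38 * b ^ 2) :
    ∃ ε₁ ∈ Ioc 0 ε₀, ∀ ε ∈ Ioo 0 ε₁, ∀ ω ∈ Ioo (-(1 / 2) : ℝ) (1 / 2),
      ∃ θ : ℝ, 0 < θ ∧ ∃ T : ℝ → ℝ, (T =Θ[𝓝[>] 0] fun δ => |Real.log δ|) ∧
        ∀ δ : ℝ, 0 < δ → 0 < T δ ∧ ∃ V : ℝ → Plane → ℝ,
          IsSolution b s ε ω (extend (u ε ω)) (T δ) V ∧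
          sobolevENorm 4 (V 0 - extend (u ε ω)) ≤ ENNReal.ofReal δ ∧
          ENNReal.ofReal θ ≤ eLpNorm (V (T δ) - extend (u ε ω)) 2 volume := by
  obtain ⟨ε₁, hε₁, hε₁2, h⟩ := hu.exists_isTest hb hs
  refine ⟨ε₁, hε₁, fun ε hε ω hω => ?_⟩
  obtain ⟨φ₀, hφ₀, hlt⟩ := h ε hε ω hω
  have hsol := hu.solution ε ⟨hε.1, hε.2.le.trans hε₁.2⟩ ω ⟨hω.1.le, hω.2.le⟩
  obtain ⟨hU, U₀, hU₀⟩ := hsol.contDiff_extend_and_bounded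
  have hs0 : 0 < s := by nlinarith [sq_nonneg b]
  obtain ⟨θ, hθ, M, hM, a, ha, K, hK, K', hK', η₀, hη₀, hgrow⟩ :=
    exists_growing_solutions hs0 (by nlinarith [hε.1, hε.2, hω.1]) hU hU₀ hsol.stationary hφ₀ hlt
  have hη : ∀ δ : ℝ, 0 < δ → min (δ / M) η₀ ∈ Ioc 0 η₀ := fun δ hδ =>
    ⟨by positivity, min_le_right _ _⟩
  choose hlt' T hT1 hT2 V hV hV0 hVT using fun δ : Ioi (0 : ℝ) => hgrow _ (hη δ δ.2)
  have hΛ : ∀ δ : Ioi (0 : ℝ), 0 < Real.log (θ / (min (δ / M) η₀ * a)) := fun δ =>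
    Real.log_pos ((one_lt_div (mul_pos (hη δ δ.2).1 ha)).2 (hlt' δ))
  refine ⟨θ, hθ, fun δ => if hδ : 0 < δ then T ⟨δ, hδ⟩ else 0, ?_, fun δ hδ => ?_⟩
  · refine isTheta_abs_log_of_le (c := θ * M / a) (δ₀ := η₀ * M) (by positivity) hK hK'
      (by positivity) fun δ hδ hδ₀ => ?_
    have e : θ / (min (δ / M) η₀ * a) = θ * M / a / δ := by
      rw [min_eq_left ((div_le_iff₀ hM).2 hδ₀)]
      field_simp
    have h1 := hΛ ⟨δ, hδ⟩
    have h2 := hT1 ⟨δ, hδ⟩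
    have h3 := hT2 ⟨δ, hδ⟩
    simp only [e] at h1 h2 h3
    simp only [dif_pos hδ]
    exact ⟨h1.le, h2, h3⟩
  · simp only [dif_pos hδ]
    refine ⟨lt_of_lt_of_le (mul_pos (by positivity) (hΛ ⟨δ, hδ⟩)) (hT1 ⟨δ, hδ⟩), V ⟨δ, hδ⟩,
      hV _, (hV0 _).trans (ENNReal.ofReal_le_ofReal ?_), hVT _⟩
    calc min (δ / M) η₀ * M ≤ δ / M * M := by gcongr; exact min_le_left _ _
      _ = δ := by field_simp

end GSH

namespace GSH

open BoundedContinuousFunction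

/-- The Banach algebra of continuous, even, `2π`-periodic functions. -/
def evenPeriodic : Subalgebra ℝ (ℝ →ᵇ ℝ) where
  carrier := {f | (∀ x, f (-x) = f x) ∧ ∀ x, f (x + 2 * Real.pi) = f x}
  mul_mem' := fun {f g} hf hg => ⟨fun x => by simp [hf.1, hg.1], fun x => by simp [hf.2, hg.2]⟩
  add_mem' := fun {f g} hf hg => ⟨fun x => by simp [hf.1, hg.1], fun x => by simp [hf.2, hg.2]⟩
  algebraMap_mem' := fun r => ⟨fun x => rfl, fun x => rfl⟩

theorem isClosed_evenPeriodic : IsClosed (evenPeriodic : Set (ℝ →ᵇ ℝ)) := by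
  have h : (evenPeriodic : Set (ℝ →ᵇ ℝ)) =
      (⋂ x, {f : ℝ →ᵇ ℝ | f (-x) = f x}) ∩ ⋂ x, {f : ℝ →ᵇ ℝ | f (x + 2 * Real.pi) = f x} := by
    ext f
    simp [evenPeriodic]
  rw [h]
  exact (isClosed_iInter fun x => isClosed_eq (continuous_eval_const _) (continuous_eval_const _)).inter
    (isClosed_iInter fun x => isClosed_eq (continuous_eval_const _) (continuous_eval_const _))

/-- The continuous, even, `2π`-periodic functions. -/
def EvenPeriodic : Type := evenPeriodic

namespace EvenPeriodic

instance : NormedCommRing EvenPeriodic := inferInstanceAs (NormedCommRing evenPeriodic)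

instance : NormedAlgebra ℝ EvenPeriodic := inferInstanceAs (NormedAlgebra ℝ evenPeriodic)

instance : CompleteSpace EvenPeriodic := isClosed_evenPeriodic.completeSpace_coe

/-- The underlying function. -/
def toFun (f : EvenPeriodic) : ℝ → ℝ := (show evenPeriodic from f).1

instance : CoeFun EvenPeriodic (fun _ => ℝ → ℝ) := ⟨toFun⟩

theorem even (f : EvenPeriodic) (x : ℝ) : f (-x) = f x := f.2.1 x

theorem periodic (f : EvenPeriodic) : Function.Periodic f (2 * Real.pi) := f.2.2

theorem continuous (f : EvenPeriodic) : Continuous f := f.1.continuous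

theorem abs_le_norm (f : EvenPeriodic) (x : ℝ) : |f x| ≤ ‖f‖ := f.1.norm_coe_le_norm x

theorem add_apply (f g : EvenPeriodic) (x : ℝ) : (f + g) x = f x + g x := rfl
theorem sub_apply (f g : EvenPeriodic) (x : ℝ) : (f - g) x = f x - g x := rfl
theorem mul_apply (f g : EvenPeriodic) (x : ℝ) : (f * g) x = f x * g x := rfl
theorem smul_apply (r : ℝ) (f : EvenPeriodic) (x : ℝ) : (r • f) x = r * f x := rfl
theorem one_apply (x : ℝ) : (1 : EvenPeriodic) x = 1 := rfl
theorem pow_apply (f : EvenPeriodic) (n : ℕ) (x : ℝ) : (f ^ n) x = f x ^ n := by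
  induction n with
  | zero => rfl
  | succ n ih => rw [pow_succ, pow_succ, mul_apply, ih]

theorem ext {f g : EvenPeriodic} (h : ∀ x, f x = g x) : f = g := Subtype.ext (DFunLike.ext _ _ h)

/-- The cosine. -/
def cosine : EvenPeriodic :=
  ⟨BoundedContinuousFunction.ofNormedAddCommGroup Real.cos Real.continuous_cos 1
    Real.abs_cos_le_one, Real.cos_neg, Real.cos_add_two_pi⟩

theorem cosine_apply (x : ℝ) : cosine x = Real.cos x := rfl

theorem exists_eq_of_abs_le {f : ℝ → ℝ} (hf : Continuous f) (he : ∀ x, f (-x) = f x)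
    (hp : Function.Periodic f (2 * Real.pi)) {C : ℝ} (hC : ∀ x, |f x| ≤ C) :
    ∃ g : EvenPeriodic, (∀ x, g x = f x) ∧ ‖g‖ ≤ C :=
  ⟨⟨BoundedContinuousFunction.ofNormedAddCommGroup f hf C hC, he, hp⟩, fun _ => rfl,
    BoundedContinuousFunction.norm_ofNormedAddCommGroup_le hf ((abs_nonneg _).trans (hC 0)) hC⟩

/-- The first Fourier coefficient, as a linear map. -/
def coeffLM : EvenPeriodic →ₗ[ℝ] ℝ where
  toFun f := (∫ x in 0..2 * Real.pi, f x * Real.cos x) / Real.pi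
  map_add' f g := by
    simp only [add_apply, add_mul]
    rw [intervalIntegral.integral_add, add_div] <;>
    exact ((continuous _).mul Real.continuous_cos).intervalIntegrable _ _
  map_smul' r f := by
    simp only [smul_apply, mul_assoc, intervalIntegral.integral_const_mul, mul_div_assoc,
      RingHom.id_apply, smul_eq_mul]

/-- The first Fourier coefficient. -/
def coeff : EvenPeriodic →L[ℝ] ℝ :=
  coeffLM.mkContinuous 2 fun f => by
    have h : ‖∫ x in 0..2 * Real.pi, f x * Real.cos x‖ ≤ ‖f‖ * |2 * Real.pi - 0| := by
      refine intervalIntegral.norm_integral_le_of_norm_le_const fun x _ => ?_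
      rw [norm_mul, ← mul_one ‖f‖]
      exact mul_le_mul (abs_le_norm f x) (Real.abs_cos_le_one x) (norm_nonneg _) (norm_nonneg _)
    rw [sub_zero, abs_of_pos Real.two_pi_pos] at h
    change ‖(∫ x in 0..2 * Real.pi, f x * Real.cos x) / Real.pi‖ ≤ _
    rw [norm_div, Real.norm_of_nonneg Real.pi_pos.le, div_le_iff₀ Real.pi_pos]
    linarith

theorem coeff_apply (f : EvenPeriodic) :
    coeff f = (∫ x in 0..2 * Real.pi, f x * Real.cos x) / Real.pi := rfl

theorem integral_sin_mul (f : EvenPeriodic) : ∫ x in 0..2 * Real.pi, Real.sin x * f x = 0 := by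
  have hp : Function.Periodic (fun x => Real.sin x * f x) (2 * Real.pi) := fun x => by
    simp only [Real.sin_add_two_pi, periodic f x]
  have h1 := hp.intervalIntegral_add_eq 0 (-(2 * Real.pi))
  rw [zero_add, neg_add_cancel] at h1
  have h2 := intervalIntegral.integral_comp_neg (a := 0) (b := 2 * Real.pi)
    (fun x => Real.sin x * f x)
  simp only [Real.sin_neg, even, neg_mul, intervalIntegral.integral_neg, neg_zero] at h2
  linarith

/-- The solution of `f'' + f = h` with `f(0) = f'(0) = 0`. -/
def duhamel (h : ℝ → ℝ) (x : ℝ) : ℝ :=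
  Real.sin x * (∫ y in 0..x, Real.cos y * h y) - Real.cos x * ∫ y in 0..x, Real.sin y * h y

/-- The derivative of `duhamel h`. -/
def duhamelDeriv (h : ℝ → ℝ) (x : ℝ) : ℝ :=
  Real.cos x * (∫ y in 0..x, Real.cos y * h y) + Real.sin x * ∫ y in 0..x, Real.sin y * h y

theorem hasDerivAt_duhamel {h : ℝ → ℝ} (hh : Continuous h) (x : ℝ) :
    HasDerivAt (duhamel h) (duhamelDeriv h x) x ∧
      HasDerivAt (duhamelDeriv h) (h x - duhamel h x) x := by
  have h1 : HasDerivAt (fun x => ∫ y in 0..x, Real.cos y * h y) (Real.cos x * h x) x :=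
    ((Real.continuous_cos.mul hh).integral_hasStrictDerivAt 0 x).hasDerivAt
  have h2 : HasDerivAt (fun x => ∫ y in 0..x, Real.sin y * h y) (Real.sin x * h x) x :=
    ((Real.continuous_sin.mul hh).integral_hasStrictDerivAt 0 x).hasDerivAt
  constructor
  · exact (((Real.hasDerivAt_sin x).mul h1).sub ((Real.hasDerivAt_cos x).mul h2)).congr_deriv (by
      rw [duhamelDeriv]; ring)
  · exact (((Real.hasDerivAt_cos x).mul h1).add ((Real.hasDerivAt_sin x).mul h2)).congr_deriv (by
      rw [duhamel]; linear_combination h x * Real.sin_sq_add_cos_sq x)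

theorem duhamel_eq {f f' h : ℝ → ℝ} (hf : ∀ x, HasDerivAt f (f' x) x)
    (hf' : ∀ x, HasDerivAt f' (h x - f x) x) (h0 : f' 0 = 0) (hh : Continuous h) (x : ℝ) :
    duhamel h x = f x - f 0 * Real.cos x := by
  have hfc : Continuous f := continuous_iff_continuousAt.2 fun x => (hf x).continuousAt
  have h1 : ∫ y in 0..x, Real.cos y * h y = (Real.cos x * f' x + Real.sin x * f x)
      - (Real.cos 0 * f' 0 + Real.sin 0 * f 0) := by
    refine intervalIntegral.integral_eq_sub_of_hasDerivAt
      (f := fun y => Real.cos y * f' y + Real.sin y * f y) (fun y _ => ?_)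
      ((by fun_prop : Continuous fun y => Real.cos y * h y).intervalIntegrable _ _)
    exact (((Real.hasDerivAt_cos y).mul (hf' y)).add ((Real.hasDerivAt_sin y).mul (hf y))).congr_deriv
      (by ring)
  have h2 : ∫ y in 0..x, Real.sin y * h y = (Real.sin x * f' x - Real.cos x * f x)
      - (Real.sin 0 * f' 0 - Real.cos 0 * f 0) := by
    refine intervalIntegral.integral_eq_sub_of_hasDerivAt
      (f := fun y => Real.sin y * f' y - Real.cos y * f y) (fun y _ => ?_)
      ((by fun_prop : Continuous fun y => Real.sin y * h y).intervalIntegrable _ _)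
    exact (((Real.hasDerivAt_sin y).mul (hf' y)).sub ((Real.hasDerivAt_cos y).mul (hf y))).congr_deriv
      (by ring)
  rw [duhamel, h1, h2, h0]
  simp only [Real.cos_zero, Real.sin_zero]
  linear_combination f x * Real.sin_sq_add_cos_sq x

theorem exists_duhamel_eq (h : EvenPeriodic) (h0 : coeff h = 0) :
    ∃ g : EvenPeriodic, (∀ x, g x = duhamel h x) ∧ ‖g‖ ≤ 4 * Real.pi * ‖h‖ := by
  have hc := continuous h
  have ic : ∀ a b, IntervalIntegrable (fun y => Real.cos y * h y) volume a b := fun a b =>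
    (Real.continuous_cos.mul hc).intervalIntegrable a b
  have is : ∀ a b, IntervalIntegrable (fun y => Real.sin y * h y) volume a b := fun a b =>
    (Real.continuous_sin.mul hc).intervalIntegrable a b
  have hcos : ∫ x in 0..2 * Real.pi, Real.cos x * h x = 0 := by
    rw [coeff_apply, div_eq_zero_iff, or_iff_left Real.pi_ne_zero] at h0
    simpa only [mul_comm] using h0
  have pc : Function.Periodic (fun y => Real.cos y * h y) (2 * Real.pi) := fun x => by
    simp only [Real.cos_add_two_pi, periodic h x]
  have ps : Function.Periodic (fun y => Real.sin y * h y) (2 * Real.pi) := fun x => by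
    simp only [Real.sin_add_two_pi, periodic h x]
  have hp : Function.Periodic (duhamel h) (2 * Real.pi) := by
    intro x
    have e1 := intervalIntegral.integral_add_adjacent_intervals (ic 0 x) (ic x (x + 2 * Real.pi))
    have e2 := intervalIntegral.integral_add_adjacent_intervals (is 0 x) (is x (x + 2 * Real.pi))
    rw [pc.intervalIntegral_add_eq x 0, zero_add, hcos, add_zero] at e1
    rw [ps.intervalIntegral_add_eq x 0, zero_add, integral_sin_mul, add_zero] at e2
    rw [duhamel, duhamel, ← e1, ← e2, Real.sin_add_two_pi, Real.cos_add_two_pi]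
  have he : ∀ x, duhamel h (-x) = duhamel h x := by
    intro x
    have e1 := intervalIntegral.integral_comp_neg (a := 0) (b := x) (fun y => Real.cos y * h y)
    have e2 := intervalIntegral.integral_comp_neg (a := 0) (b := x) (fun y => Real.sin y * h y)
    simp only [Real.sin_neg, Real.cos_neg, even, neg_mul, intervalIntegral.integral_neg,
      neg_zero] at e1 e2
    rw [duhamel, duhamel, Real.sin_neg, Real.cos_neg, intervalIntegral.integral_symm (-x) 0,
      intervalIntegral.integral_symm (-x) 0, ← e1, ← e2]
    ring
  have hd : Continuous (duhamel h) :=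
    continuous_iff_continuousAt.2 fun x => (hasDerivAt_duhamel hc x).1.continuousAt
  refine exists_eq_of_abs_le hd he hp fun x => ?_
  obtain ⟨y, hy, hxy⟩ := hp.exists_mem_Ico₀ Real.two_pi_pos x
  rw [hxy]
  have b1 : ‖∫ z in 0..y, Real.cos z * h z‖ ≤ ‖h‖ * |y - 0| := by
    refine intervalIntegral.norm_integral_le_of_norm_le_const fun z _ => ?_
    rw [norm_mul, ← one_mul ‖h‖]
    exact mul_le_mul (Real.abs_cos_le_one z) (abs_le_norm h z) (norm_nonneg _) zero_le_one
  have b2 : ‖∫ z in 0..y, Real.sin z * h z‖ ≤ ‖h‖ * |y - 0| := by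
    refine intervalIntegral.norm_integral_le_of_norm_le_const fun z _ => ?_
    rw [norm_mul, ← one_mul ‖h‖]
    exact mul_le_mul (Real.abs_sin_le_one z) (abs_le_norm h z) (norm_nonneg _) zero_le_one
  have hy' : ‖h‖ * |y - 0| ≤ ‖h‖ * (2 * Real.pi) := by
    rw [sub_zero, abs_of_nonneg hy.1]; gcongr; exact hy.2.le
  rw [Real.norm_eq_abs] at b1 b2
  have c1 : |Real.sin y * ∫ z in 0..y, Real.cos z * h z| ≤ 1 * (‖h‖ * (2 * Real.pi)) := by
    rw [abs_mul]
    exact mul_le_mul (Real.abs_sin_le_one y) (b1.trans hy') (abs_nonneg _) zero_le_one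
  have c2 : |Real.cos y * ∫ z in 0..y, Real.sin z * h z| ≤ 1 * (‖h‖ * (2 * Real.pi)) := by
    rw [abs_mul]
    exact mul_le_mul (Real.abs_cos_le_one y) (b2.trans hy') (abs_nonneg _) zero_le_one
  refine (abs_sub _ _).trans ((add_le_add c1 c2).trans (le_of_eq ?_))
  ring

/-- The projection which removes the first Fourier mode. -/
def removeMode (f : EvenPeriodic) : EvenPeriodic := f - coeff f • cosine

theorem coeff_of_hasDerivAt (f : EvenPeriodic) {F : ℝ → ℝ}
    (hF : ∀ x, HasDerivAt F (f x * Real.cos x) x) :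
    coeff f = (F (2 * Real.pi) - F 0) / Real.pi := by
  rw [coeff_apply, intervalIntegral.integral_eq_sub_of_hasDerivAt (fun x _ => hF x)
    (((continuous f).mul Real.continuous_cos).intervalIntegrable _ _)]

theorem coeff_cosine : coeff cosine = 1 := by
  rw [coeff_of_hasDerivAt cosine (F := fun x => x / 2 + Real.sin x * Real.cos x / 2) fun x => ?_]
  · simp [Real.pi_ne_zero]
  · refine (((hasDerivAt_id x).div_const 2).add
      (((Real.hasDerivAt_sin x).mul (Real.hasDerivAt_cos x)).div_const 2)).congr_deriv ?_
    rw [cosine_apply]; linear_combination -(1 / 2) * Real.sin_sq_add_cos_sq x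

theorem coeff_one : coeff 1 = 0 := by
  rw [coeff_of_hasDerivAt 1 (F := Real.sin) fun x => ?_]
  · simp
  · simpa [one_apply] using Real.hasDerivAt_sin x

theorem coeff_cosine_sq : coeff (cosine ^ 2) = 0 := by
  rw [coeff_of_hasDerivAt _ (F := fun x => Real.sin x - Real.sin x ^ 3 / 3) fun x => ?_]
  · simp
  · refine ((Real.hasDerivAt_sin x).sub
      (((Real.hasDerivAt_sin x).pow 3).div_const 3)).congr_deriv ?_
    rw [pow_apply, cosine_apply]
    push_cast
    linear_combination -Real.cos x * Real.sin_sq_add_cos_sq x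

theorem coeff_cosine_cube : coeff (cosine ^ 3) = 3 / 4 := by
  rw [coeff_of_hasDerivAt _ (F := fun x => 3 / 8 * x + 3 / 8 * (Real.sin x * Real.cos x)
    + 1 / 4 * (Real.sin x * Real.cos x ^ 3)) fun x => ?_]
  · simp
    field_simp
    norm_num
  · refine ((((hasDerivAt_id x).const_mul (3 / 8)).add
      (((Real.hasDerivAt_sin x).mul (Real.hasDerivAt_cos x)).const_mul (3 / 8))).add
      (((Real.hasDerivAt_sin x).mul ((Real.hasDerivAt_cos x).pow 3)).const_mul
        (1 / 4))).congr_deriv ?_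
    rw [pow_apply, cosine_apply, Pi.pow_apply]
    push_cast
    linear_combination (-(3 / 8) - 3 / 4 * Real.cos x ^ 2) * Real.sin_sq_add_cos_sq x

theorem coeff_cosine_pow_four : coeff (cosine ^ 4) = 0 := by
  rw [coeff_of_hasDerivAt _ (F := fun x => Real.sin x - 2 / 3 * Real.sin x ^ 3
    + 1 / 5 * Real.sin x ^ 5) fun x => ?_]
  · simp
  · refine (((Real.hasDerivAt_sin x).sub (((Real.hasDerivAt_sin x).pow 3).const_mul (2 / 3))).add
      (((Real.hasDerivAt_sin x).pow 5).const_mul (1 / 5))).congr_deriv ?_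
    rw [pow_apply, cosine_apply]
    push_cast
    have h : Real.cos x ^ 2 = 1 - Real.sin x ^ 2 := Real.cos_sq' x
    have h5 : Real.cos x ^ 4 * Real.cos x = (Real.cos x ^ 2) ^ 2 * Real.cos x := by ring
    rw [h5, h]; ring

theorem removeMode_apply (f : EvenPeriodic) (x : ℝ) :
    removeMode f x = f x - coeff f * Real.cos x := rfl

theorem coeff_removeMode (f : EvenPeriodic) : coeff (removeMode f) = 0 := by
  rw [removeMode, map_sub, map_smul, coeff_cosine, smul_eq_mul, mul_one, sub_self]

theorem norm_cosine_le : ‖cosine‖ ≤ 1 :=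
  BoundedContinuousFunction.norm_ofNormedAddCommGroup_le Real.continuous_cos zero_le_one
    Real.abs_cos_le_one

theorem exists_norm_removeMode_le : ∃ C, 0 ≤ C ∧ ∀ f, ‖removeMode f‖ ≤ C * ‖f‖ := by
  refine ⟨1 + ‖coeff‖, by positivity, fun f => ?_⟩
  have h1 : ‖coeff f • cosine‖ ≤ ‖coeff‖ * ‖f‖ := by
    rw [norm_smul, ← mul_one (‖coeff‖ * ‖f‖)]
    exact mul_le_mul (coeff.le_opNorm f) norm_cosine_le (norm_nonneg _) (by positivity)
  refine (norm_sub_le _ _).trans ?_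
  linarith

/-- A solution of `g'' + g = removeMode f`. -/
def preSolve (f : EvenPeriodic) : EvenPeriodic :=
  (exists_duhamel_eq (removeMode f) (coeff_removeMode f)).choose

theorem preSolve_apply (f : EvenPeriodic) (x : ℝ) : preSolve f x = duhamel (removeMode f) x :=
  (exists_duhamel_eq (removeMode f) (coeff_removeMode f)).choose_spec.1 x

theorem norm_preSolve_le (f : EvenPeriodic) : ‖preSolve f‖ ≤ 4 * Real.pi * ‖removeMode f‖ :=
  (exists_duhamel_eq (removeMode f) (coeff_removeMode f)).choose_spec.2

theorem preSolve_add (f g : EvenPeriodic) : preSolve (f + g) = preSolve f + preSolve g := by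
  refine ext fun x => ?_
  have e : ∀ y, removeMode (f + g) y = removeMode f y + removeMode g y := fun y => by
    simp only [removeMode_apply, add_apply, map_add]; ring
  have hc := fun f => continuous (removeMode f)
  rw [add_apply, preSolve_apply, preSolve_apply, preSolve_apply, duhamel, duhamel, duhamel]
  simp only [e, mul_add]
  rw [intervalIntegral.integral_add, intervalIntegral.integral_add]
  · ring
  all_goals exact ((by fun_prop : Continuous fun y => _ * _)).intervalIntegrable _ _

theorem preSolve_smul (r : ℝ) (f : EvenPeriodic) : preSolve (r • f) = r • preSolve f := by
  refine ext fun x => ?_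
  have e : ∀ y, removeMode (r • f) y = r * removeMode f y := fun y => by
    simp only [removeMode_apply, smul_apply, map_smul, smul_eq_mul]; ring
  rw [smul_apply, preSolve_apply, preSolve_apply, duhamel, duhamel]
  simp only [e, mul_left_comm _ r, intervalIntegral.integral_const_mul]
  ring

/-- The linear map underlying `solve`. -/
def solveLM : EvenPeriodic →ₗ[ℝ] EvenPeriodic where
  toFun f := removeMode (preSolve f)
  map_add' f g := by
    rw [preSolve_add]; simp only [removeMode, map_add, add_smul]; abel
  map_smul' r f := by
    rw [preSolve_smul]; simp only [removeMode, map_smul, RingHom.id_apply, smul_sub, smul_assoc]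

/-- The inverse of `1 + ∂ₓ²` on the functions without first Fourier mode. -/
def solve : EvenPeriodic →L[ℝ] EvenPeriodic :=
  solveLM.mkContinuousOfExistsBound (by
    obtain ⟨C, hC0, hC⟩ := exists_norm_removeMode_le
    refine ⟨C * (4 * Real.pi * C), fun f => ?_⟩
    have := Real.pi_pos
    calc ‖removeMode (preSolve f)‖ ≤ C * ‖preSolve f‖ := hC _
      _ ≤ C * (4 * Real.pi * ‖removeMode f‖) := by gcongr; exact norm_preSolve_le f
      _ ≤ C * (4 * Real.pi * (C * ‖f‖)) := by gcongr; exact hC f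
      _ = _ := by ring)

theorem solve_eq (f : EvenPeriodic) : solve f = removeMode (preSolve f) := rfl

theorem coeff_solve (f : EvenPeriodic) : coeff (solve f) = 0 := coeff_removeMode _

theorem exists_hasDerivAt_solve (f : EvenPeriodic) : ∃ g' : ℝ → ℝ,
    (∀ x, HasDerivAt (solve f) (g' x) x) ∧
      ∀ x, HasDerivAt g' (f x - coeff f * Real.cos x - solve f x) x := by
  have hc := continuous (removeMode f)
  have e : (solve f : ℝ → ℝ) =
      fun x => duhamel (removeMode f) x - coeff (preSolve f) * Real.cos x :=
    funext fun x => by rw [solve_eq, removeMode_apply, preSolve_apply]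
  refine ⟨fun x => duhamelDeriv (removeMode f) x + coeff (preSolve f) * Real.sin x,
    fun x => ?_, fun x => ?_⟩
  · rw [e]
    exact ((hasDerivAt_duhamel hc x).1.sub ((Real.hasDerivAt_cos x).const_mul _)).congr_deriv
      (by ring)
  · rw [e]
    exact ((hasDerivAt_duhamel hc x).2.add ((Real.hasDerivAt_sin x).const_mul _)).congr_deriv
      (by rw [removeMode_apply]; ring)

theorem solve_eq_of_hasDerivAt {f g : EvenPeriodic} {g' : ℝ → ℝ}
    (h1 : ∀ x, HasDerivAt g (g' x) x)
    (h2 : ∀ x, HasDerivAt g' (f x - coeff f * Real.cos x - g x) x) (h0 : g' 0 = 0)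
    (hg : coeff g = 0) : solve f = g := by
  have h3 : preSolve f = g - g 0 • cosine := ext fun x => by
    rw [preSolve_apply, duhamel_eq (h := removeMode f) h1 h2 h0 (continuous _), sub_apply, smul_apply, cosine_apply]
  rw [solve_eq, h3, removeMode, map_sub, map_smul, hg, coeff_cosine, smul_eq_mul, mul_one, zero_sub,
    neg_smul, sub_neg_eq_add, sub_add_cancel]

theorem solve_cosine : solve cosine = 0 := by
  refine solve_eq_of_hasDerivAt (g' := fun _ => 0) (fun x => hasDerivAt_const x 0) (fun x => ?_) rfl
    (map_zero _)
  refine (hasDerivAt_const x (0 : ℝ)).congr_deriv ?_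
  rw [coeff_cosine, cosine_apply]
  change 0 = Real.cos x - 1 * Real.cos x - 0
  ring

theorem solve_one : solve 1 = 1 := by
  refine solve_eq_of_hasDerivAt (g' := fun _ => 0) (fun x => hasDerivAt_const x 1) (fun x => ?_) rfl
    coeff_one
  refine (hasDerivAt_const x (0 : ℝ)).congr_deriv ?_
  rw [coeff_one, one_apply]; ring

theorem solve_cosine_sq : solve (cosine ^ 2) = (2 / 3 : ℝ) • 1 - (1 / 3 : ℝ) • cosine ^ 2 := by
  have e : ((((2 / 3 : ℝ) • 1 - (1 / 3 : ℝ) • cosine ^ 2 : EvenPeriodic)) : ℝ → ℝ) =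
      fun x => 2 / 3 - 1 / 3 * Real.cos x ^ 2 := by
    ext x; simp only [sub_apply, smul_apply, pow_apply, one_apply, cosine_apply]; ring
  refine solve_eq_of_hasDerivAt (g' := fun x => 2 / 3 * (Real.cos x * Real.sin x)) (fun x => ?_)
    (fun x => ?_) (by simp) ?_
  · rw [e]
    exact ((((Real.hasDerivAt_cos x).pow 2).const_mul (1 / 3)).const_sub (2 / 3)).congr_deriv
      (by push_cast; ring)
  · rw [e]
    refine (((Real.hasDerivAt_cos x).mul (Real.hasDerivAt_sin x)).const_mul (2 / 3)).congr_deriv ?_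
    rw [coeff_cosine_sq, pow_apply, cosine_apply]
    linear_combination -(2 / 3) * Real.sin_sq_add_cos_sq x
  · rw [map_sub, map_smul, map_smul, coeff_one, coeff_cosine_sq]; simp

theorem solve_cosine_cube :
    solve (cosine ^ 3) = (3 / 32 : ℝ) • cosine - (1 / 8 : ℝ) • cosine ^ 3 := by
  have e : ((((3 / 32 : ℝ) • cosine - (1 / 8 : ℝ) • cosine ^ 3 : EvenPeriodic)) : ℝ → ℝ) =
      fun x => 3 / 32 * Real.cos x - 1 / 8 * Real.cos x ^ 3 := by
    ext x; simp only [sub_apply, smul_apply, pow_apply, cosine_apply]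
  refine solve_eq_of_hasDerivAt
    (g' := fun x => -(3 / 32) * Real.sin x + 3 / 8 * (Real.cos x ^ 2 * Real.sin x)) (fun x => ?_)
    (fun x => ?_) (by simp) ?_
  · rw [e]
    exact (((Real.hasDerivAt_cos x).const_mul (3 / 32)).sub
      (((Real.hasDerivAt_cos x).pow 3).const_mul (1 / 8))).congr_deriv (by push_cast; ring)
  · rw [e]
    refine (((Real.hasDerivAt_sin x).const_mul (-(3 / 32))).add
      ((((Real.hasDerivAt_cos x).pow 2).mul (Real.hasDerivAt_sin x)).const_mul (3 / 8))).congr_deriv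
      ?_
    rw [coeff_cosine_cube, pow_apply, cosine_apply, Pi.pow_apply]
    push_cast
    linear_combination -(3 / 4) * Real.cos x * Real.sin_sq_add_cos_sq x
  · rw [map_sub, map_smul, map_smul, coeff_cosine, coeff_cosine_cube]; norm_num

end EvenPeriodic

end GSH

/-- A map depending on a parameter `p` which is constant for `p = 0` has fixed points for small `p`,
which depend on `p` in a Lipschitz way. -/
theorem HasStrictFDerivAt.exists_fixedPoint {X P : Type*} [NormedAddCommGroup X] [NormedSpace ℝ X]
    [CompleteSpace X] [NormedAddCommGroup P] [NormedSpace ℝ P] {F : X × P → X} {x₀ : X}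
    {F' : X × P →L[ℝ] X} (hF : HasStrictFDerivAt F F' (x₀, 0)) (h0 : ∀ x, F (x, 0) = x₀) :
    ∃ C r : ℝ, 0 < C ∧ 0 < r ∧ ∀ p, ‖p‖ < r → ∃ x, F (x, p) = x ∧ ‖x - x₀‖ ≤ C * ‖p‖ := by
  have hF'0 : ∀ x, F' (x, 0) = 0 := by
    have h1 : HasFDerivAt (fun x => F (x, 0)) (F'.comp (ContinuousLinearMap.inl ℝ X P)) x₀ :=
      HasFDerivAt.comp x₀ (f := fun x => (x, (0 : P))) hF.hasFDerivAt (hasFDerivAt_prodMk_left x₀ 0)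
    have h2 : HasFDerivAt (fun x => F (x, 0)) (0 : X →L[ℝ] X) x₀ := by
      simp_rw [h0]; exact hasFDerivAt_const x₀ x₀
    intro x
    exact congrArg (fun A : X →L[ℝ] X => A x) (h1.unique h2)
  obtain ⟨S, hS, happ⟩ := hF.approximates_deriv_on_nhds (c := 1 / 2) (Or.inr (by norm_num))
  obtain ⟨ρ, hρ, hball⟩ := Metric.nhds_basis_closedBall.mem_iff.1 hS
  have hmem : ∀ {x p}, ‖x - x₀‖ ≤ ρ → ‖p‖ ≤ ρ → (x, p) ∈ S := fun hx hp => hball (by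
    rw [mem_closedBall_iff_norm, Prod.mk_sub_mk, sub_zero]
    exact max_le hx hp)
  have hlip : ∀ {x y p}, ‖x - x₀‖ ≤ ρ → ‖y - x₀‖ ≤ ρ → ‖p‖ ≤ ρ →
      ‖F (x, p) - F (y, p)‖ ≤ 1 / 2 * ‖x - y‖ := by
    intro x y p hx hy hp
    have h := happ _ (hmem hx hp) _ (hmem hy hp)
    rw [Prod.mk_sub_mk, sub_self, hF'0, sub_zero] at h
    refine h.trans (le_of_eq ?_)
    simp [Prod.norm_mk]
  set M := ‖F'‖ + 1 / 2 with hM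
  have hM0 : 0 < M := by positivity
  have hx₀ : ‖x₀ - x₀‖ ≤ ρ := by rw [sub_self, norm_zero]; exact hρ.le
  have hbase : ∀ {p}, ‖p‖ ≤ ρ → ‖F (x₀, p) - x₀‖ ≤ M * ‖p‖ := by
    intro p hp
    have h := happ _ (hmem hx₀ hp) _ (hmem (p := 0) hx₀ (by rw [norm_zero]; exact hρ.le))
    rw [Prod.mk_sub_mk, sub_self, sub_zero, h0] at h
    have h1 := F'.le_opNorm ((0 : X), p)
    have h2 : ‖((0 : X), p)‖ = ‖p‖ := by simp [Prod.norm_mk]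
    rw [h2] at h h1
    have h3 := norm_le_norm_sub_add (F (x₀, p) - x₀) (F' ((0 : X), p))
    have h4 : ((1 / 2 : NNReal) : ℝ) = 1 / 2 := by norm_num
    rw [h4] at h
    rw [hM, add_mul]
    linarith
  refine ⟨2 * M, min ρ (ρ / (2 * M)), by positivity, by positivity, fun p hp => ?_⟩
  have hp1 : ‖p‖ ≤ ρ := hp.le.trans (min_le_left _ _)
  have hp2 : M * ‖p‖ ≤ ρ / 2 := by
    have := (le_div_iff₀ (by positivity)).1 (hp.le.trans (min_le_right _ _))
    linarith
  have hmaps : MapsTo (fun x => F (x, p)) (Metric.closedBall x₀ ρ) (Metric.closedBall x₀ ρ) := by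
    intro x hx
    rw [mem_closedBall_iff_norm] at hx ⊢
    have h1 := hlip hx hx₀ hp1
    have h2 := hbase hp1
    have h3 := norm_sub_le_norm_sub_add_norm_sub (F (x, p)) (F (x₀, p)) x₀
    linarith
  have hcontr : ContractingWith (1 / 2) (hmaps.restrict _ _ _) := by
    refine ⟨by rw [← NNReal.coe_lt_coe]; norm_num, LipschitzWith.of_dist_le_mul fun x y => ?_⟩
    have := hlip (mem_closedBall_iff_norm.1 x.2) (mem_closedBall_iff_norm.1 y.2) hp1
    rw [Subtype.dist_eq, Subtype.dist_eq, dist_eq_norm, dist_eq_norm]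
    refine this.trans (le_of_eq ?_)
    norm_num
  obtain ⟨x, hx, hfix, -⟩ := hcontr.exists_fixedPoint' Metric.isClosed_closedBall.isComplete hmaps
    (Metric.mem_closedBall_self hρ.le) (edist_ne_top _ _)
  have hfix : F (x, p) = x := hfix
  refine ⟨x, hfix, ?_⟩
  have h1 := hlip (mem_closedBall_iff_norm.1 hx) hx₀ hp1
  have h2 := hbase hp1
  have h3 := norm_sub_le_norm_sub_add_norm_sub x (F (x₀, p)) x₀
  rw [hfix] at h1
  linarith

namespace GSH

namespace EvenPeriodic

/-- The nonlinear part of the equation for the profile. -/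
def rollNonlin (b s α : ℝ) (w : EvenPeriodic) : EvenPeriodic :=
  b • (cosine + α • w) ^ 2 - (s * α) • (cosine + α • w) ^ 3

/-- The fixed point map for the profile of the rolls: `q = (1 + ∂ₓ²)² w`. -/
def profileMap (b s : ℝ) (q : EvenPeriodic) (α ε κ : ℝ) : EvenPeriodic :=
  ε ^ 2 • solve (solve q) + removeMode (rollNonlin b s α (solve (solve q)))
    - (2 * κ) • (removeMode q - solve q)
    - κ ^ 2 • (removeMode q - (2 : ℝ) • solve q + solve (solve q))

/-- The coefficient of the reduced bifurcation equation. -/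
def amplitudeCoeff (b s : ℝ) (q : EvenPeriodic) (α : ℝ) : ℝ :=
  -b * coeff ((2 : ℝ) • (cosine * solve (solve q)) + α • solve (solve q) ^ 2)
    + s * coeff ((cosine + α • solve (solve q)) ^ 3)

/-- The profile component of the fixed point map. -/
def rollProfile (b s : ℝ) (z : (EvenPeriodic × ℝ) × ℝ × ℝ × ℝ) : EvenPeriodic :=
  profileMap b s z.1.1 (z.2.2.2 * z.1.2) z.2.1 z.2.2.1

/-- The value of `amplitudeCoeff` on the new profile. -/
def rollCoeff (b s : ℝ) (z : (EvenPeriodic × ℝ) × ℝ × ℝ × ℝ) : ℝ :=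
  amplitudeCoeff b s (rollProfile b s z) (z.2.2.2 * z.1.2)

/-- The fixed point map for the profile and the amplitude of the rolls. -/
def rollMap (b s : ℝ) (z : (EvenPeriodic × ℝ) × ℝ × ℝ × ℝ) : EvenPeriodic × ℝ :=
  (rollProfile b s z, (√(rollCoeff b s z))⁻¹)

theorem coeff_rollNonlin (b s α : ℝ) (q : EvenPeriodic) :
    coeff (rollNonlin b s α (solve (solve q))) = -(α * amplitudeCoeff b s q α) := by
  have h : (cosine + α • solve (solve q)) ^ 2 = cosine ^ 2 +
      α • ((2 : ℝ) • (cosine * solve (solve q)) + α • solve (solve q) ^ 2) := by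
    simp only [Algebra.smul_def, map_ofNat]; ring
  rw [rollNonlin, h, amplitudeCoeff]
  simp only [map_sub, map_smul, map_add, coeff_cosine_sq, smul_eq_mul]
  ring

theorem coeff_profileMap (b s : ℝ) (q : EvenPeriodic) (α ε κ : ℝ) :
    coeff (profileMap b s q α ε κ) = 0 := by
  simp only [profileMap, map_sub, map_add, map_smul, coeff_solve, coeff_removeMode]
  simp

/-- The leading order profile. -/
def profile₀ (b : ℝ) : EvenPeriodic := b • cosine ^ 2

theorem solve_solve_cosine_sq :
    solve (solve (cosine ^ 2)) = (4 / 9 : ℝ) • 1 + (1 / 9 : ℝ) • cosine ^ 2 := by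
  simp only [solve_cosine_sq, map_sub, map_smul, solve_one]
  module

theorem cosine_mul_solve_solve_cosine_sq :
    cosine * solve (solve (cosine ^ 2)) = (4 / 9 : ℝ) • cosine + (1 / 9 : ℝ) • cosine ^ 3 := by
  rw [solve_solve_cosine_sq]
  simp only [mul_add, mul_smul_comm, mul_one]
  rw [pow_succ' cosine 2]

theorem profileMap_zero (b s : ℝ) (q : EvenPeriodic) : profileMap b s q 0 0 0 = profile₀ b := by
  simp [profileMap, rollNonlin, removeMode, profile₀, coeff_cosine_sq]

theorem amplitudeCoeff_profile₀ (b s : ℝ) :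
    amplitudeCoeff b s (profile₀ b) 0 = (27 * s - 38 * b ^ 2) / 36 := by
  simp only [amplitudeCoeff, profile₀, map_smul, zero_smul, add_zero, coeff_cosine_cube,
    mul_smul_comm, cosine_mul_solve_solve_cosine_sq, map_add, coeff_cosine, smul_eq_mul]
  ring

theorem contDiff_rollProfile (b s : ℝ) : ContDiff ℝ 1 (rollProfile b s) := by
  unfold rollProfile profileMap rollNonlin removeMode
  fun_prop

theorem contDiff_rollCoeff (b s : ℝ) : ContDiff ℝ 1 (rollCoeff b s) := by
  have := contDiff_rollProfile b s
  unfold rollCoeff amplitudeCoeff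
  fun_prop

theorem rollProfile_zero (b s : ℝ) (x : EvenPeriodic × ℝ) :
    rollProfile b s (x, 0) = profile₀ b := by
  have h : rollProfile b s (x, 0) = profileMap b s x.1 (0 * x.2) 0 0 := rfl
  rw [h, zero_mul, profileMap_zero]

theorem rollCoeff_zero (b s : ℝ) (x : EvenPeriodic × ℝ) :
    rollCoeff b s (x, 0) = (27 * s - 38 * b ^ 2) / 36 := by
  have h : rollCoeff b s (x, 0) = amplitudeCoeff b s (rollProfile b s (x, 0)) (0 * x.2) := rfl
  rw [h, rollProfile_zero, zero_mul, amplitudeCoeff_profile₀]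

theorem exists_rollMap_eq {b s : ℝ} (hs : 0 < 27 * s - 38 * b ^ 2) :
    ∃ C r : ℝ, 0 < C ∧ 0 < r ∧ ∀ p : ℝ × ℝ × ℝ, ‖p‖ < r → ∃ (q : EvenPeriodic) (a : ℝ), 0 < a ∧
      profileMap b s q (p.2.2 * a) p.1 p.2.1 = q ∧
      a ^ 2 * amplitudeCoeff b s q (p.2.2 * a) = 1 ∧ ‖q - profile₀ b‖ ≤ C * ‖p‖ ∧
      |a - 6 / √(27 * s - 38 * b ^ 2)| ≤ C * ‖p‖ := by
  set D := 27 * s - 38 * b ^ 2 with hD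
  have hsD : 0 < √D := Real.sqrt_pos.2 hs
  have ha₀ : (√(D / 36))⁻¹ = 6 / √D := by
    rw [Real.sqrt_div' _ (by norm_num), show (36 : ℝ) = 6 ^ 2 by norm_num,
      Real.sqrt_sq (by norm_num), inv_div]
  have h0 : ∀ x, rollMap b s (x, 0) = (profile₀ b, 6 / √D) := fun x => by
    rw [rollMap, rollProfile_zero, rollCoeff_zero, ← hD, ha₀]
  have hc : ContDiffAt ℝ 1 (rollMap b s) ((profile₀ b, 6 / √D), 0) := by
    have h3 : 0 < rollCoeff b s ((profile₀ b, 6 / √D), 0) := by rw [rollCoeff_zero]; positivity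
    exact (contDiff_rollProfile b s).contDiffAt.prodMk
      (((contDiff_rollCoeff b s).contDiffAt.sqrt h3.ne').inv (Real.sqrt_pos.2 h3).ne')
  obtain ⟨C, r, hC, hr, h⟩ :=
    (hc.hasStrictFDerivAt one_ne_zero).exists_fixedPoint h0
  refine ⟨C, min r (6 / √D / C), hC, by positivity, fun p hp => ?_⟩
  obtain ⟨⟨q, a⟩, hfix, hle⟩ := h p (hp.trans_le (min_le_left _ _))
  rw [Prod.mk_sub_mk] at hle
  have hq : ‖q - profile₀ b‖ ≤ C * ‖p‖ := (le_max_left _ _).trans hle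
  have ha : |a - 6 / √D| ≤ C * ‖p‖ := (le_max_right _ _).trans hle
  have hfix1 : profileMap b s q (p.2.2 * a) p.1 p.2.1 = q := congrArg Prod.fst hfix
  have hfix2 : (√(amplitudeCoeff b s (profileMap b s q (p.2.2 * a) p.1 p.2.1) (p.2.2 * a)))⁻¹ = a :=
    congrArg Prod.snd hfix
  rw [hfix1] at hfix2
  have ha0 : 0 < a := by
    have h1 : C * ‖p‖ < 6 / √D := by
      rw [mul_comm, ← lt_div_iff₀ hC]; exact hp.trans_le (min_le_right _ _)
    linarith [(abs_le.1 ha).1]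
  have hc0 : 0 < amplitudeCoeff b s q (p.2.2 * a) := by
    by_contra! hle
    rw [Real.sqrt_eq_zero_of_nonpos hle, inv_zero] at hfix2
    exact ha0.ne hfix2
  refine ⟨q, a, ha0, hfix1, ?_, hq, ha⟩
  have hsq : a ^ 2 = (amplitudeCoeff b s q (p.2.2 * a))⁻¹ := by
    conv_lhs => rw [← hfix2]
    rw [inv_pow, Real.sq_sqrt hc0.le]
  rw [hsq, inv_mul_cancel₀ hc0.ne']

end EvenPeriodic

end GSH

namespace GSH

theorem contDiff_add_two_of_hasDerivAt {f f' f'' : ℝ → ℝ} {n : ℕ} (h1 : ∀ x, HasDerivAt f (f' x) x)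
    (h2 : ∀ x, HasDerivAt f' (f'' x) x) (h : ContDiff ℝ n f'') : ContDiff ℝ (n + 2 : ℕ) f := by
  have e1 : deriv f = f' := funext fun x => (h1 x).deriv
  have e2 : deriv f' = f'' := funext fun x => (h2 x).deriv
  have h3 : ContDiff ℝ (n + 1 : ℕ) f' := by
    push_cast
    exact contDiff_succ_iff_deriv.2 ⟨fun x => (h2 x).differentiableAt, by simp, by rwa [e2]⟩
  have h4 : ContDiff ℝ ((n + 1 : ℕ) + 1 : WithTop ℕ∞) f :=
    contDiff_succ_iff_deriv.2 ⟨fun x => (h1 x).differentiableAt, by simp, by rwa [e1]⟩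
  exact_mod_cast h4

theorem partialDeriv_zero_extend {f f' : ℝ → ℝ} (h : ∀ x, HasDerivAt f (f' x) x) :
    partialDeriv 0 (extend f) = extend f' := by
  ext p
  have h1 : HasFDerivAt (extend f) (f' (p 0) • (EuclideanSpace.proj 0 : Plane →L[ℝ] ℝ)) p :=
    (h (p 0)).comp_hasFDerivAt p (hasFDerivAt_coord 0 p)
  rw [partialDeriv, h1.fderiv]
  simp [extend]

theorem partialDeriv_one_extend {f f' : ℝ → ℝ} (h : ∀ x, HasDerivAt f (f' x) x) :
    partialDeriv 1 (extend f) = fun _ => 0 := by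
  ext p
  have h1 : HasFDerivAt (extend f) (f' (p 0) • (EuclideanSpace.proj 0 : Plane →L[ℝ] ℝ)) p :=
    (h (p 0)).comp_hasFDerivAt p (hasFDerivAt_coord 0 p)
  rw [partialDeriv, h1.fderiv]
  simp

theorem opA_extend {f f' f'' : ℝ → ℝ} (h1 : ∀ x, HasDerivAt f (f' x) x)
    (h2 : ∀ x, HasDerivAt f' (f'' x) x) (ε ω : ℝ) :
    opA ε ω (extend f) = extend fun x => f x + (1 + 2 * ε * ω) * f'' x := by
  ext p
  rw [opA, partialDeriv_zero_extend h1, partialDeriv_zero_extend h2, partialDeriv_one_extend h1]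
  simp [extend, partialDeriv]

namespace EvenPeriodic

/-- The roll with profile `q` and amplitude `α`. -/
def roll (q : EvenPeriodic) (α : ℝ) : EvenPeriodic := α • cosine + α ^ 2 • solve (solve q)

theorem coeff_roll (q : EvenPeriodic) (α : ℝ) : coeff (roll q α) = α := by
  simp only [roll, map_add, map_smul, coeff_cosine, coeff_solve, smul_eq_mul]
  ring

theorem isEvenStationary_roll {b s ε ω μ a : ℝ} {q : EvenPeriodic}
    (hμ : μ ^ 2 = ε ^ 2 - (2 * ε * ω) ^ 2)
    (hq : profileMap b s q (μ * a) ε (2 * ε * ω) = q)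
    (ha : a ^ 2 * amplitudeCoeff b s q (μ * a) = 1) :
    IsEvenStationary b s ε ω (roll q (μ * a)) := by
  set α := μ * a with hα
  set κ := 2 * ε * ω with hκ
  set v := solve q with hv
  set w := solve v with hw
  set C := amplitudeCoeff b s q α with hC
  have hαC : α ^ 2 * C = μ ^ 2 := by rw [hα]; linear_combination μ ^ 2 * ha
  have hq0 : coeff q = 0 := by rw [← hq, coeff_profileMap]
  obtain ⟨v', hv1, hv2⟩ := exists_hasDerivAt_solve q
  obtain ⟨w', hw1, hw2⟩ := exists_hasDerivAt_solve v
  rw [← hv] at hv1 hv2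
  rw [← hw] at hw1 hw2
  have hv2' : ∀ x, HasDerivAt v' (q x - v x) x := fun x =>
    (hv2 x).congr_deriv (by rw [hq0]; ring)
  have hw2' : ∀ x, HasDerivAt w' (v x - w x) x := fun x =>
    (hw2 x).congr_deriv (by rw [hv, coeff_solve]; ring)
  have hvc : ContDiff ℝ 2 v := contDiff_add_two_of_hasDerivAt (n := 0) hv1 hv2'
    (contDiff_zero.2 ((continuous q).sub (continuous v)))
  have hwc2 : ContDiff ℝ 2 w := contDiff_add_two_of_hasDerivAt (n := 0) hw1 hw2'
    (contDiff_zero.2 ((continuous v).sub (continuous w)))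
  have hwc : ContDiff ℝ 4 w := contDiff_add_two_of_hasDerivAt (n := 2) hw1 hw2' (hvc.sub hwc2)
  have hu : (roll q α : ℝ → ℝ) = fun x => α * Real.cos x + α ^ 2 * w x := rfl
  refine ⟨?_, even _, periodic _, fun p => ?_⟩
  · rw [hu]
    exact (contDiff_const.mul Real.contDiff_cos).add (contDiff_const.mul hwc)
  have d1 : ∀ x, HasDerivAt (fun x => α * Real.cos x + α ^ 2 * w x)
      (-α * Real.sin x + α ^ 2 * w' x) x := fun x =>
    (((Real.hasDerivAt_cos x).const_mul α).add ((hw1 x).const_mul (α ^ 2))).congr_deriv (by ring)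
  have d2 : ∀ x, HasDerivAt (fun x => -α * Real.sin x + α ^ 2 * w' x)
      (-α * Real.cos x + α ^ 2 * (v x - w x)) x := fun x =>
    ((Real.hasDerivAt_sin x).const_mul (-α)).add ((hw2' x).const_mul (α ^ 2))
  have e1 : opA ε ω (extend (roll q α)) =
      extend fun x => -α * κ * Real.cos x + α ^ 2 * ((1 + κ) * v x - κ * w x) := by
    rw [hu, opA_extend d1 d2]
    congr 1; ext x; rw [hκ]; ring
  have d3 : ∀ x, HasDerivAt (fun x => -α * κ * Real.cos x + α ^ 2 * ((1 + κ) * v x - κ * w x))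
      (α * κ * Real.sin x + α ^ 2 * ((1 + κ) * v' x - κ * w' x)) x := fun x =>
    (((Real.hasDerivAt_cos x).const_mul (-α * κ)).add ((((hv1 x).const_mul (1 + κ)).sub
      ((hw1 x).const_mul κ)).const_mul (α ^ 2))).congr_deriv (by ring)
  have d4 : ∀ x, HasDerivAt (fun x => α * κ * Real.sin x + α ^ 2 * ((1 + κ) * v' x - κ * w' x))
      (α * κ * Real.cos x + α ^ 2 * ((1 + κ) * (q x - v x) - κ * (v x - w x))) x := fun x =>
    ((Real.hasDerivAt_sin x).const_mul (α * κ)).add ((((hv2' x).const_mul (1 + κ)).sub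
      ((hw2' x).const_mul κ)).const_mul (α ^ 2))
  rw [e1, opA_extend d3 d4, ← hκ]
  simp only [extend, hu]
  set x := p 0
  have hx := congrArg (fun f : EvenPeriodic => f x) hq
  simp only [profileMap, removeMode, hq0, ← hv, ← hw] at hx
  rw [hw, hv, coeff_rollNonlin, ← hv, ← hw, ← hC, rollNonlin] at hx
  simp only [add_apply, sub_apply, smul_apply, pow_apply, cosine_apply] at hx
  unfold reaction
  linear_combination α ^ 2 * hx - α * Real.cos x * hαC - α * Real.cos x * hμ

theorem roll_eq_zero_iff (q : EvenPeriodic) (α : ℝ) : (∀ x, roll q α x = 0) ↔ α = 0 := by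
  refine ⟨fun h => ?_, fun h x => ?_⟩
  · have h0 : roll q α = 0 := ext h
    rw [← coeff_roll q α, h0, map_zero]
  · change α * Real.cos x + α ^ 2 * _ = 0
    rw [h]; ring

end EvenPeriodic

end GSH

namespace GSH

namespace EvenPeriodic

/-- `removeMode` as a continuous linear map. -/
def removeModeL : EvenPeriodic →L[ℝ] EvenPeriodic :=
  ContinuousLinearMap.id ℝ EvenPeriodic - coeff.smulRight cosine

theorem removeModeL_apply (f : EvenPeriodic) : removeModeL f = f - coeff f • cosine := rfl

theorem removeMode_eq (f : EvenPeriodic) : removeMode f = removeModeL f := rfl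

/-- The leading order of `solve (solve q)`. -/
def shape₀ (b : ℝ) : EvenPeriodic := solve (solve (profile₀ b))

theorem shape₀_eq (b : ℝ) :
    shape₀ b = (4 / 9 * b) • (1 : EvenPeriodic) + (1 / 9 * b) • cosine ^ 2 := by
  rw [shape₀, profile₀, map_smul, map_smul, solve_solve_cosine_sq]
  module

/-- The profile up to terms of second order. -/
def profile₁ (b s α κ : ℝ) : EvenPeriodic :=
  profile₀ b + α • removeModeL ((2 * b) • (cosine * shape₀ b) - s • cosine ^ 3)
    - (2 * κ) • (removeModeL (profile₀ b) - solve (profile₀ b))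

/-- The remainder of the nonlinearity. -/
def nonlinRem (b s α : ℝ) (w : EvenPeriodic) : EvenPeriodic :=
  α • (cosine * ((2 * b) • (w - shape₀ b))) + α ^ 2 • (b • w ^ 2
    - s • ((3 : ℝ) • (cosine ^ 2 * w) + (3 * α) • (cosine * w ^ 2) + α ^ 2 • w ^ 3))

theorem rollNonlin_eq (b s α : ℝ) (w : EvenPeriodic) :
    rollNonlin b s α w = profile₀ b + α • ((2 * b) • (cosine * shape₀ b) - s • cosine ^ 3)
      + nonlinRem b s α w := by
  simp only [rollNonlin, profile₀, nonlinRem, Algebra.smul_def, map_mul, map_pow, map_ofNat]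
  ring

theorem removeModeL_profile₀ (b : ℝ) : removeModeL (profile₀ b) = profile₀ b := by
  rw [removeModeL_apply, profile₀, map_smul, coeff_cosine_sq, smul_zero, zero_smul, sub_zero]

theorem sub_profile₁ {b s α ε κ : ℝ} {q : EvenPeriodic} (hq : profileMap b s q α ε κ = q) :
    q - profile₁ b s α κ = ε ^ 2 • solve (solve q)
      + removeModeL (nonlinRem b s α (solve (solve q)))
      - (2 * κ) • (removeModeL (q - profile₀ b) - solve (q - profile₀ b))
      - κ ^ 2 • (removeModeL q - (2 : ℝ) • solve q + solve (solve q)) := by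
  conv_lhs => rw [← hq]
  rw [profileMap, rollNonlin_eq, removeMode_eq, removeMode_eq, profile₁]
  simp only [map_add, map_sub, map_smul, removeModeL_profile₀]
  module

theorem solve_removeModeL_cosine_cube :
    solve (solve (removeModeL (cosine ^ 3))) =
      (-(3 / 256) : ℝ) • cosine + (1 / 64 : ℝ) • cosine ^ 3 := by
  rw [removeModeL_apply]
  simp only [map_sub, map_smul, solve_cosine, solve_cosine_cube, smul_zero, sub_zero]
  module

theorem coeff_cosine_mul_solve_profile₁ (b s α κ : ℝ) :
    coeff (cosine * solve (solve (profile₁ b s α κ))) = 19 / 36 * b - 2 * b * κ / 27 := by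
  have e1 : solve (solve (removeModeL ((2 * b) • (cosine * shape₀ b) - s • cosine ^ 3))) =
      (2 * b * (1 / 9 * b) - s) • ((-(3 / 256) : ℝ) • cosine + (1 / 64 : ℝ) • cosine ^ 3) := by
    have h : (2 * b) • (cosine * shape₀ b) - s • cosine ^ 3 =
        (2 * b * (4 / 9 * b)) • cosine + (2 * b * (1 / 9 * b) - s) • cosine ^ 3 := by
      rw [shape₀_eq]
      simp only [Algebra.smul_def, map_mul, map_sub]
      ring
    rw [h, map_add, map_smul, map_smul, show removeModeL cosine = 0 by
      rw [removeModeL_apply, coeff_cosine, one_smul, sub_self], smul_zero, zero_add, map_smul,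
      map_smul, solve_removeModeL_cosine_cube]
  have e2 : solve (solve (removeModeL (profile₀ b) - solve (profile₀ b))) =
      (-(2 / 27) * b) • (1 : EvenPeriodic) + (4 / 27 * b) • cosine ^ 2 := by
    rw [removeModeL_profile₀, profile₀]
    simp only [map_sub, map_smul, solve_cosine_sq, solve_one]
    module
  have e3 : cosine * solve (solve (profile₁ b s α κ)) =
      (4 / 9 * b + 2 * κ * (2 / 27 * b)) • cosine + (1 / 9 * b - 2 * κ * (4 / 27 * b)) • cosine ^ 3
      + (α * (2 * b * (1 / 9 * b) - s)) • ((-(3 / 256) : ℝ) • cosine ^ 2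
        + (1 / 64 : ℝ) • cosine ^ 4) := by
    rw [profile₁]
    simp only [map_add _ (_ : EvenPeriodic), map_sub solve, map_smul solve]
    have e0 : solve (solve (profile₀ b)) = shape₀ b := rfl
    have e2' := e2
    simp only [map_sub] at e2'
    rw [e1, e2', e0, shape₀_eq]
    simp only [Algebra.smul_def, map_mul, map_sub, map_add, map_neg]
    ring
  rw [e3]
  simp only [map_add, map_smul, coeff_cosine, coeff_cosine_cube, coeff_cosine_sq,
    coeff_cosine_pow_four, smul_eq_mul]
  ring

theorem coeff_shape₀_sq (b : ℝ) : coeff (shape₀ b ^ 2) = 0 := by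
  have h : shape₀ b ^ 2 = ((4 / 9 * b) ^ 2) • (1 : EvenPeriodic)
      + (2 * (4 / 9 * b) * (1 / 9 * b)) • cosine ^ 2 + ((1 / 9 * b) ^ 2) • cosine ^ 4 := by
    rw [shape₀_eq]
    simp only [Algebra.smul_def, map_mul, map_pow, map_ofNat]
    ring
  rw [h]
  simp only [map_add, map_smul, coeff_one, coeff_cosine_sq, coeff_cosine_pow_four, smul_zero,
    add_zero]

theorem coeff_cosine_sq_mul_shape₀ (b : ℝ) : coeff (cosine ^ 2 * shape₀ b) = 0 := by
  have h : cosine ^ 2 * shape₀ b = (4 / 9 * b) • cosine ^ 2 + (1 / 9 * b) • cosine ^ 4 := by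
    rw [shape₀_eq]
    simp only [Algebra.smul_def]
    ring
  rw [h]
  simp only [map_add, map_smul, coeff_cosine_sq, coeff_cosine_pow_four, smul_zero, add_zero]

theorem amplitudeCoeff_sub {b s α κ : ℝ} {q w : EvenPeriodic} (hw : solve (solve q) = w) :
    amplitudeCoeff b s q α - ((27 * s - 38 * b ^ 2) / 36 + 4 / 27 * b ^ 2 * κ) =
      -2 * b * coeff (cosine * solve (solve (q - profile₁ b s α κ)))
      - b * (α * coeff ((w - shape₀ b) * (w + shape₀ b)))
      + 3 * s * (α * coeff (cosine ^ 2 * (w - shape₀ b)))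
      + s * (α ^ 2 * coeff ((3 : ℝ) • (cosine * w ^ 2) + α • w ^ 3)) := by
  have h1 : (cosine + α • w) ^ 3 = cosine ^ 3 + (3 * α) • (cosine ^ 2 * w)
      + (3 * α ^ 2) • (cosine * w ^ 2) + α ^ 3 • w ^ 3 := by
    simp only [Algebra.smul_def, map_mul, map_pow, map_ofNat]
    ring
  have h2 : (w - shape₀ b) * (w + shape₀ b) = w ^ 2 - shape₀ b ^ 2 := by ring
  rw [amplitudeCoeff, hw, h1, h2]
  simp only [map_add, map_sub, map_smul, mul_sub, coeff_cosine_cube, coeff_shape₀_sq, hw,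
    coeff_cosine_mul_solve_profile₁, coeff_cosine_sq_mul_shape₀, smul_eq_mul]
  ring

end EvenPeriodic

end GSH

namespace GSH

namespace EvenPeriodic

section Asymptotics

variable {P : Type*} {l : Filter P} {g : P → ℝ} {b s : ℝ}

theorem isBigO_nonlinRem (hg : g =O[l] (1 : P → ℝ)) {α : P → ℝ} {w : P → EvenPeriodic}
    (hα : α =O[l] g) (hw : (fun p => w p - shape₀ b) =O[l] g) (hw1 : w =O[l] (1 : P → ℝ)) :
    (fun p => nonlinRem b s (α p) (w p)) =O[l] fun p => g p ^ 2 := by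
  have hα1 : α =O[l] (1 : P → ℝ) := hα.trans hg
  have hc : ∀ n : ℕ, (fun _ : P => cosine ^ n) =O[l] (1 : P → ℝ) := fun n =>
    isBigO_const_const _ one_ne_zero _
  have hc1 : (fun _ : P => cosine) =O[l] (1 : P → ℝ) := isBigO_const_const _ one_ne_zero _
  have h1 : (fun p => α p • (cosine * ((2 * b) • (w p - shape₀ b)))) =O[l] fun p => g p ^ 2 :=
    (hα.smul (hc1.mul (hw.const_smul_left (2 * b)))).congr_right fun p => by
      simp only [Pi.one_apply, smul_eq_mul]; ring
  have hw2 := hw1.pow 2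
  have hw3 := hw1.pow 3
  have h2 : (fun p => α p ^ 2 • (b • w p ^ 2 - s • ((3 : ℝ) • (cosine ^ 2 * w p)
      + (3 * α p) • (cosine * w p ^ 2) + α p ^ 2 • w p ^ 3))) =O[l] fun p => g p ^ 2 := by
    have e1 : (fun p => (3 : ℝ) • (cosine ^ 2 * w p)) =O[l] (1 : P → ℝ) :=
      (((hc 2).mul hw1).const_smul_left (3 : ℝ)).congr_right fun p => by simp
    have e2 : (fun p => (3 * α p) • (cosine * w p ^ 2)) =O[l] (1 : P → ℝ) :=
      ((hα1.const_mul_left 3).smul (hc1.mul hw2)).congr_right fun p => by simp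
    have e3 : (fun p => α p ^ 2 • w p ^ 3) =O[l] (1 : P → ℝ) :=
      ((hα1.pow 2).smul hw3).congr_right fun p => by simp
    have e4 : (fun p => b • w p ^ 2) =O[l] (1 : P → ℝ) :=
      (hw2.const_smul_left b).congr_right fun p => by simp
    exact ((hα.pow 2).smul (e4.sub (((e1.add e2).add e3).const_smul_left s))).congr_right
      fun p => by simp
  exact h1.add h2

theorem isBigO_solve_sub_shape₀ {q : P → EvenPeriodic} (hq : (fun p => q p - profile₀ b) =O[l] g) :
    (fun p => solve (solve (q p)) - shape₀ b) =O[l] g := by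
  have h : (fun p => solve (solve (q p)) - shape₀ b) =
      fun p => (solve.comp solve) (q p - profile₀ b) := by
    ext1 p
    simp only [shape₀, ContinuousLinearMap.comp_apply, map_sub]
  rw [h]
  exact ((solve.comp solve).isBigO_comp _ _).trans hq

theorem isBigO_one_of_sub_const {E : Type*} [SeminormedAddCommGroup E] {f : P → E} {c : E}
    (hg : g =O[l] (1 : P → ℝ)) (h : (fun p => f p - c) =O[l] g) : f =O[l] (1 : P → ℝ) := by
  have h1 := (h.trans hg).add (isBigO_const_const c (one_ne_zero (α := ℝ)) l)
  exact h1.congr_left fun p => by simp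

theorem isBigO_sub_profile₁ (hg : g =O[l] (1 : P → ℝ)) {α ε κ : P → ℝ} {q : P → EvenPeriodic}
    (hα : α =O[l] g) (hε : ε =O[l] g) (hκ : κ =O[l] g)
    (hq : (fun p => q p - profile₀ b) =O[l] g)
    (hfix : ∀ᶠ p in l, profileMap b s (q p) (α p) (ε p) (κ p) = q p) :
    (fun p => q p - profile₁ b s (α p) (κ p)) =O[l] fun p => g p ^ 2 := by
  have hw := isBigO_solve_sub_shape₀ hq
  have hq1 := isBigO_one_of_sub_const hg hq
  have hw1 := isBigO_one_of_sub_const hg hw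
  have hv1 : (fun p => solve (q p)) =O[l] (1 : P → ℝ) := (solve.isBigO_comp _ _).trans hq1
  have hr1 : (fun p => removeModeL (q p)) =O[l] (1 : P → ℝ) :=
    (removeModeL.isBigO_comp _ _).trans hq1
  have h1 : (fun p => ε p ^ 2 • solve (solve (q p))) =O[l] fun p => g p ^ 2 :=
    ((hε.pow 2).smul hw1).congr_right fun p => by simp
  have h2 : (fun p => removeModeL (nonlinRem b s (α p) (solve (solve (q p))))) =O[l]
      fun p => g p ^ 2 :=
    (removeModeL.isBigO_comp _ _).trans (isBigO_nonlinRem hg hα hw hw1)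
  have h3 : (fun p => (2 * κ p) • (removeModeL (q p - profile₀ b) - solve (q p - profile₀ b)))
      =O[l] fun p => g p ^ 2 :=
    ((hκ.const_mul_left 2).smul (((removeModeL.isBigO_comp _ _).trans hq).sub
      ((solve.isBigO_comp _ _).trans hq))).congr_right fun p => by simp only [smul_eq_mul]; ring
  have h4 : (fun p => κ p ^ 2 • (removeModeL (q p) - (2 : ℝ) • solve (q p)
      + solve (solve (q p)))) =O[l] fun p => g p ^ 2 :=
    ((hκ.pow 2).smul ((hr1.sub ((hv1.const_smul_left (2 : ℝ)).congr_right fun p => rfl)).add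
      hw1)).congr_right fun p => by simp
  refine (((h1.add h2).sub h3).sub h4).congr' ?_ EventuallyEq.rfl
  filter_upwards [hfix] with p hp
  exact (sub_profile₁ hp).symm

theorem isBigO_amplitudeCoeff_sub (hg : g =O[l] (1 : P → ℝ)) {α ε κ : P → ℝ}
    {q : P → EvenPeriodic} (hα : α =O[l] g) (hε : ε =O[l] g) (hκ : κ =O[l] g)
    (hq : (fun p => q p - profile₀ b) =O[l] g)
    (hfix : ∀ᶠ p in l, profileMap b s (q p) (α p) (ε p) (κ p) = q p) :
    (fun p => amplitudeCoeff b s (q p) (α p)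
      - ((27 * s - 38 * b ^ 2) / 36 + 4 / 27 * b ^ 2 * κ p)) =O[l] fun p => g p ^ 2 := by
  have hw := isBigO_solve_sub_shape₀ hq
  have hw1 := isBigO_one_of_sub_const hg hw
  have hα1 : α =O[l] (1 : P → ℝ) := hα.trans hg
  have hc : ∀ n : ℕ, (fun _ : P => cosine ^ n) =O[l] (1 : P → ℝ) := fun n =>
    isBigO_const_const _ one_ne_zero _
  have hc1 : (fun _ : P => cosine) =O[l] (1 : P → ℝ) := isBigO_const_const _ one_ne_zero _
  have hs1 : (fun _ : P => shape₀ b) =O[l] (1 : P → ℝ) := isBigO_const_const _ one_ne_zero _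
  have h1 : (fun p => coeff (cosine * solve (solve (q p - profile₁ b s (α p) (κ p))))) =O[l]
      fun p => g p ^ 2 := by
    refine (coeff.isBigO_comp _ _).trans ?_
    exact (hc1.mul (((solve.comp solve).isBigO_comp _ _).trans
      (isBigO_sub_profile₁ hg hα hε hκ hq hfix))).congr_right fun p => by simp
  have h2 : (fun p => α p * coeff ((solve (solve (q p)) - shape₀ b)
      * (solve (solve (q p)) + shape₀ b))) =O[l] fun p => g p ^ 2 :=
    (hα.mul ((coeff.isBigO_comp _ _).trans (hw.mul (hw1.add hs1)))).congr_right fun p => by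
      simp only [Pi.one_apply]; ring
  have h3 : (fun p => α p * coeff (cosine ^ 2 * (solve (solve (q p)) - shape₀ b))) =O[l]
      fun p => g p ^ 2 :=
    (hα.mul ((coeff.isBigO_comp _ _).trans ((hc 2).mul hw))).congr_right fun p => by
      simp only [Pi.one_apply]; ring
  have h4 : (fun p => α p ^ 2 * coeff ((3 : ℝ) • (cosine * solve (solve (q p)) ^ 2)
      + α p • solve (solve (q p)) ^ 3)) =O[l] fun p => g p ^ 2 := by
    have e1 : (fun p => (3 : ℝ) • (cosine * solve (solve (q p)) ^ 2)) =O[l] (1 : P → ℝ) :=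
      ((hc1.mul (hw1.pow 2)).const_smul_left (3 : ℝ)).congr_right fun p => by simp
    have e2 : (fun p => α p • solve (solve (q p)) ^ 3) =O[l] (1 : P → ℝ) :=
      (hα1.smul (hw1.pow 3)).congr_right fun p => by simp
    exact ((hα.pow 2).mul ((coeff.isBigO_comp _ _).trans (e1.add e2))).congr_right
      fun p => by simp
  refine ((((h1.const_mul_left (-2 * b)).sub (h2.const_mul_left b)).add
    (h3.const_mul_left (3 * s))).add (h4.const_mul_left s)).congr_left fun p => ?_
  exact (amplitudeCoeff_sub rfl).symm

/-- The expansion of the amplitude. -/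
theorem isBigO_amplitude_sub (hs : 0 < 27 * s - 38 * b ^ 2) (hg : Tendsto g l (𝓝 0))
    {α ε κ a : P → ℝ} {q : P → EvenPeriodic} (hα : α =O[l] g) (hε : ε =O[l] g) (hκ : κ =O[l] g)
    (hq : (fun p => q p - profile₀ b) =O[l] g)
    (hfix : ∀ᶠ p in l, profileMap b s (q p) (α p) (ε p) (κ p) = q p)
    (ha : (fun p => a p - 6 / √(27 * s - 38 * b ^ 2)) =O[l] g)
    (hac : ∀ᶠ p in l, a p ^ 2 * amplitudeCoeff b s (q p) (α p) = 1) :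
    (fun p => a p - 6 / √(27 * s - 38 * b ^ 2)
      * (1 - 8 * b ^ 2 / (3 * (27 * s - 38 * b ^ 2)) * κ p)) =O[l] fun p => g p ^ 2 := by
  have hg1 : g =O[l] (1 : P → ℝ) := hg.isBigO_one ℝ
  have hC := isBigO_amplitudeCoeff_sub hg1 hα hε hκ hq hfix
  set D := 27 * s - 38 * b ^ 2 with hD
  set β := 8 * b ^ 2 / (3 * D) with hβ
  have hsD : 0 < √D := Real.sqrt_pos.2 hs
  set a₀ := 6 / √D with ha₀
  have ha₀0 : 0 < a₀ := by positivity
  have ha₀2 : a₀ ^ 2 * D = 36 := by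
    rw [ha₀, div_pow, Real.sq_sqrt hs.le]
    field_simp
    norm_num
  have hβD : 4 / 27 * b ^ 2 = D / 36 * (2 * β) := by
    rw [hβ]; field_simp; ring
  have ha1 : a =O[l] (1 : P → ℝ) := isBigO_one_of_sub_const hg1 ha
  have hκ1 : κ =O[l] (1 : P → ℝ) := hκ.trans hg1
  have hA1 : (fun p => a₀ * (1 - β * κ p)) =O[l] (1 : P → ℝ) :=
    ((isBigO_const_const (1 : ℝ) one_ne_zero l).sub (hκ1.const_mul_left β)).const_mul_left a₀
  have hta : Tendsto a l (𝓝 a₀) := by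
    have := (ha.trans_tendsto hg).add_const a₀
    simpa using this
  have htA : Tendsto (fun p => a₀ * (1 - β * κ p)) l (𝓝 a₀) := by
    have := ((tendsto_const_nhds (x := (1 : ℝ))).sub
      ((hκ.trans_tendsto hg).const_mul β)).const_mul a₀
    simpa using this
  have hsum : Tendsto (fun p => a p + a₀ * (1 - β * κ p)) l (𝓝 (a₀ + a₀)) := hta.add htA
  have hinv : (fun p => (a p + a₀ * (1 - β * κ p))⁻¹) =O[l] (1 : P → ℝ) :=
    (hsum.inv₀ (by positivity)).isBigO_one ℝ
  have h1 : (fun p => 3 * β ^ 2 * κ p ^ 2 - 2 * β ^ 3 * (κ p ^ 2 * κ p)) =O[l]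
      fun p => g p ^ 2 :=
    ((hκ.pow 2).const_mul_left _).sub
      ((((hκ.pow 2).mul hκ1).congr_right fun p => by simp).const_mul_left _)
  have h2 : (fun p => (a₀ * (1 - β * κ p)) ^ 2 * (amplitudeCoeff b s (q p) (α p)
      - (D / 36 + 4 / 27 * b ^ 2 * κ p))) =O[l] fun p => g p ^ 2 :=
    ((hA1.pow 2).mul hC).congr_right fun p => by simp
  have h3 := ((ha1.pow 2).mul ((h1.sub h2).mul hinv)).congr_right
    (g₂ := fun p => g p ^ 2) fun p => by simp
  refine h3.congr' ?_ EventuallyEq.rfl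
  filter_upwards [hac, hsum.eventually_ne (add_pos ha₀0 ha₀0).ne'] with p hp hne
  have key : 3 * β ^ 2 * κ p ^ 2 - 2 * β ^ 3 * (κ p ^ 2 * κ p) - (a₀ * (1 - β * κ p)) ^ 2
      * (amplitudeCoeff b s (q p) (α p) - (D / 36 + 4 / 27 * b ^ 2 * κ p))
      = 1 - (a₀ * (1 - β * κ p)) ^ 2 * amplitudeCoeff b s (q p) (α p) := by
    rw [hβD]
    linear_combination (1 - β * κ p) ^ 2 * (1 + 2 * β * κ p) / 36 * ha₀2
  rw [key, ← mul_assoc, ← div_eq_mul_inv, div_eq_iff hne]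
  linear_combination (-(a₀ * (1 - β * κ p)) ^ 2) * hp

/-- The expansion of the rolls in `EvenPeriodic`. -/
theorem isBigO_roll_sub (hs : 0 < 27 * s - 38 * b ^ 2) (hg : Tendsto g l (𝓝 0))
    {μ ε κ a : P → ℝ} {q : P → EvenPeriodic} (hμ : μ =O[l] g) (hε : ε =O[l] g) (hκ : κ =O[l] g)
    (hq : (fun p => q p - profile₀ b) =O[l] g)
    (hfix : ∀ᶠ p in l, profileMap b s (q p) (μ p * a p) (ε p) (κ p) = q p)
    (ha : (fun p => a p - 6 / √(27 * s - 38 * b ^ 2)) =O[l] g)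
    (hac : ∀ᶠ p in l, a p ^ 2 * amplitudeCoeff b s (q p) (μ p * a p) = 1) :
    (fun p => roll (q p) (μ p * a p) - ((μ p * (6 / √(27 * s - 38 * b ^ 2)
        * (1 - 8 * b ^ 2 / (3 * (27 * s - 38 * b ^ 2)) * κ p))) • cosine
      + (μ p * (6 / √(27 * s - 38 * b ^ 2))) ^ 2 • shape₀ b)) =O[l] fun p => g p ^ 3 := by
  have hg1 : g =O[l] (1 : P → ℝ) := hg.isBigO_one ℝ
  have ha1 : a =O[l] (1 : P → ℝ) := isBigO_one_of_sub_const hg1 ha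
  have hα : (fun p => μ p * a p) =O[l] g := (hμ.mul ha1).congr_right fun p => by simp
  have hA := isBigO_amplitude_sub hs hg hα hε hκ hq hfix ha hac
  have hw := isBigO_solve_sub_shape₀ hq
  have hw1 := isBigO_one_of_sub_const hg1 hw
  set a₀ := 6 / √(27 * s - 38 * b ^ 2)
  have h1 := ((hμ.mul hA).smul (isBigO_const_const cosine (one_ne_zero (α := ℝ)) l)).congr_right
    (g₂ := fun p => g p ^ 3) fun p => by simp only [smul_eq_mul]; ring
  have h2 := (((hμ.pow 2).mul (ha.mul (ha1.add (isBigO_const_const a₀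
    (one_ne_zero (α := ℝ)) l)))).smul hw1).congr_right
    (g₂ := fun p => g p ^ 3) fun p => by simp only [smul_eq_mul, Pi.one_apply]; ring
  have h3 := (((hμ.pow 2).const_mul_left (a₀ ^ 2)).smul hw).congr_right
    (g₂ := fun p => g p ^ 3) fun p => by simp only [smul_eq_mul]; ring
  refine ((h1.add h2).add h3).congr_left fun p => ?_
  rw [roll]
  module

end Asymptotics

end EvenPeriodic

open EvenPeriodic in
theorem leading_order_eq_rollExpansion {b s : ℝ} (hs : 0 < 27 * s - 38 * b ^ 2) {ε ω : ℝ}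
    (hω : 4 * ω ^ 2 ≤ 1) (x : ℝ) :
    (((ε * √(1 - 4 * ω ^ 2)) * (6 / √(27 * s - 38 * b ^ 2)
        * (1 - 8 * b ^ 2 / (3 * (27 * s - 38 * b ^ 2)) * (2 * ε * ω)))) • cosine
      + ((ε * √(1 - 4 * ω ^ 2)) * (6 / √(27 * s - 38 * b ^ 2))) ^ 2 • shape₀ b) x =
      rollExpansion b s ε ω x := by
  set D := 27 * s - 38 * b ^ 2 with hD
  have hsD : 0 < √D := Real.sqrt_pos.2 hs
  have h1 : √D ^ 2 = D := Real.sq_sqrt hs.le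
  have h2 : √(1 - 4 * ω ^ 2) ^ 2 = 1 - 4 * ω ^ 2 := Real.sq_sqrt (by linarith)
  rw [shape₀_eq, rollExpansion, ← hD]
  simp only [add_apply, smul_apply, pow_apply, one_apply, cosine_apply]
  rw [Real.cos_two_mul, mul_pow, mul_pow, h2, div_pow, h1]
  field_simp
  ring

open EvenPeriodic in
/-- There is a family of rolls. -/
theorem exists_isRollFamily {b s : ℝ} (hs : 0 < 27 * s - 38 * b ^ 2) :
    ∃ (ε₀ : ℝ) (u : ℝ → ℝ → ℝ → ℝ), IsRollFamily b s ε₀ u := by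
  obtain ⟨C, r, hC, hr, h⟩ := exists_rollMap_eq hs
  have h' : ∀ p : ℝ × ℝ × ℝ, ∃ (q : EvenPeriodic) (a : ℝ), ‖p‖ < r → 0 < a ∧
      profileMap b s q (p.2.2 * a) p.1 p.2.1 = q ∧
      a ^ 2 * amplitudeCoeff b s q (p.2.2 * a) = 1 ∧ ‖q - profile₀ b‖ ≤ C * ‖p‖ ∧
      |a - 6 / √(27 * s - 38 * b ^ 2)| ≤ C * ‖p‖ := fun p => by
    by_cases hp : ‖p‖ < r
    · obtain ⟨q, a, hqa⟩ := h p hp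
      exact ⟨q, a, fun _ => hqa⟩
    · exact ⟨0, 0, fun h => (hp h).elim⟩
  choose q a hqa using h'
  have hev : ∀ᶠ p : ℝ × ℝ × ℝ in 𝓝 0, ‖p‖ < r :=
    (continuous_norm.tendsto' _ _ norm_zero).eventually_lt_const hr
  have hO := isBigO_roll_sub (b := b) (s := s) (P := ℝ × ℝ × ℝ) (l := 𝓝 0) (g := fun p => ‖p‖)
    (μ := fun p => p.2.2) (ε := fun p => p.1) (κ := fun p => p.2.1) (a := a) (q := q) hs
    (continuous_norm.tendsto' _ _ norm_zero)
    (IsBigO.of_bound 1 (Eventually.of_forall fun p => by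
      rw [one_mul, norm_norm]; exact (norm_snd_le p.2).trans (norm_snd_le p)))
    (IsBigO.of_bound 1 (Eventually.of_forall fun p => by
      rw [one_mul, norm_norm]; exact norm_fst_le p))
    (IsBigO.of_bound 1 (Eventually.of_forall fun p => by
      rw [one_mul, norm_norm]; exact (norm_fst_le p.2).trans (norm_snd_le p)))
    (IsBigO.of_bound C (hev.mono fun p hp => by rw [norm_norm]; exact (hqa p hp).2.2.2.1))
    (hev.mono fun p hp => (hqa p hp).2.1)
    (IsBigO.of_bound C (hev.mono fun p hp => by rw [norm_norm]; exact (hqa p hp).2.2.2.2))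
    (hev.mono fun p hp => (hqa p hp).2.2.1)
  obtain ⟨K, hK, hO⟩ := hO.exists_nonneg
  obtain ⟨ρ, hρ, hball⟩ := Metric.eventually_nhds_iff.1 hO.bound
  let P : ℝ → ℝ → ℝ × ℝ × ℝ := fun ε ω => (ε, 2 * ε * ω, ε * √(1 - 4 * ω ^ 2))
  have hsq : ∀ {ω : ℝ}, ω ∈ Icc (-(1 / 2) : ℝ) (1 / 2) → 4 * ω ^ 2 ≤ 1 := fun {ω} hω => by
    nlinarith [hω.1, hω.2]
  have hP : ∀ {ε ω : ℝ}, 0 < ε → ω ∈ Icc (-(1 / 2) : ℝ) (1 / 2) → ‖P ε ω‖ ≤ ε := by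
    intro ε ω hε hω
    have h1 : √(1 - 4 * ω ^ 2) ≤ 1 := Real.sqrt_le_one.2 (by nlinarith [sq_nonneg ω])
    refine max_le ?_ (max_le ?_ ?_)
    · exact (Real.norm_of_nonneg hε.le).le
    · rw [Real.norm_eq_abs]
      exact abs_le.2 ⟨by nlinarith [hω.1], by nlinarith [hω.2]⟩
    · rw [Real.norm_of_nonneg (by positivity)]
      nlinarith
  refine ⟨min r ρ / 2, fun ε ω => roll (q (P ε ω)) ((P ε ω).2.2 * a (P ε ω)), by positivity,
    ?_, ?_, K, ?_⟩
  all_goals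
    intro ε hε ω hω
    have hε1 : ε < r := by linarith [hε.2, lt_min hr hρ, min_le_left r ρ]
    have hε2 : ε < ρ := by linarith [hε.2, lt_min hr hρ, min_le_right r ρ]
    have hn := hP hε.1 hω
    obtain ⟨ha, hfix, hac, -⟩ := hqa (P ε ω) (hn.trans_lt hε1)
  · refine isEvenStationary_roll ?_ hfix hac
    change (ε * √(1 - 4 * ω ^ 2)) ^ 2 = _
    rw [mul_pow, Real.sq_sqrt (by linarith [hsq hω])]
    ring
  · rw [roll_eq_zero_iff]
    change ε * √(1 - 4 * ω ^ 2) * a (P ε ω) = 0 ↔ _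
    have h1 : ε * √(1 - 4 * ω ^ 2) * a (P ε ω) = 0 ↔ √(1 - 4 * ω ^ 2) = 0 := by
      simp [hε.1.ne', ha.ne']
    rw [h1, Real.sqrt_eq_zero (by linarith [hsq hω]), ← abs_of_pos (one_half_pos (α := ℝ)),
      ← sq_eq_sq_iff_abs_eq_abs]
    constructor <;> intro h <;> linarith
  · intro x
    have h1 := hball (show dist (P ε ω) 0 < ρ by rw [dist_zero_right]; exact hn.trans_lt hε2)
    rw [← leading_order_eq_rollExpansion hs (hsq hω), ← EvenPeriodic.sub_apply]
    refine (abs_le_norm _ x).trans (h1.trans ?_)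
    rw [norm_pow, norm_norm]
    gcongr

end GSH

end

/-- Nonlinear instability of the roll solutions of the generalized Swift-Hohenberg equation. -/
theorem theorem1p3 (b s : ℝ) (hb : b ≠ 0) (hs : 0 < 27 * s - 38 * b ^ 2) :
    (∃ (ε₀ : ℝ) (u : ℝ → ℝ → ℝ → ℝ), GSH.IsRollFamily b s ε₀ u) ∧
    ∀ (ε₀ : ℝ) (u : ℝ → ℝ → ℝ → ℝ), GSH.IsRollFamily b s ε₀ u →
      ∃ ε₁ ∈ Ioc 0 ε₀, ∀ ε ∈ Ioo 0 ε₁, ∀ ω ∈ Ioo (-(1 / 2) : ℝ) (1 / 2),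
        ∃ θ : ℝ, 0 < θ ∧ ∃ T : ℝ → ℝ,
          (T =Θ[𝓝[>] 0] fun δ => |Real.log δ|) ∧
          ∀ δ : ℝ, 0 < δ → 0 < T δ ∧ ∃ V : ℝ → GSH.Plane → ℝ,
            GSH.IsSolution b s ε ω (GSH.extend (u ε ω)) (T δ) V ∧
            GSH.sobolevENorm 4 (V 0 - GSH.extend (u ε ω)) ≤ ENNReal.ofReal δ ∧
            ENNReal.ofReal θ ≤ eLpNorm (V (T δ) - GSH.extend (u ε ω)) 2 volume := by
  exact ⟨GSH.exists_isRollFamily hs, fun _ _ hu => hu.nonlinear_instability hb hs⟩
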